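/- **Theorem.** Let $G=(V,E)$ be a finite simple undirected graph. Two vertices are connected in $G-X$ if they lie outside $X$ and some path of $G$ avoiding $X$ joins them. For disjoint $S,T\subseteq V$, an $S$-$T$ separator is a set $X\subseteq V\setminus(S\cup T)$ such that no vertex of $S$ is connected to a vertex of $T$ in $G-X$. For a set $X$ disjoint from $S$ let $C_X$ be the set of vertices connected to $S$ in $G-X$. An inclusion-minimal $S$-$T$ separator $X$ is *important* if $|X'|>|X|$ for every inclusion-minimal $S$-$T$ separator $X'$ with $C_{X'}\supsetneq C_X$. For disjoint $W,Y\subseteq V$, the *shadow* $R_W(Y)$ is the set of vertices $v\in V\setminus(W\cup Y)$ that are not connected to any vertex of $W$ in $G-Y$. A set $Y\subseteq V$ disjoint from $W$ is *$k$-shadow-removable* with respect to $W$ if 1. $|Y|\le k$; 2. for each $v\in R_W(Y)$ there is an important $\{v\}$-$W$ separator of size at most $k$ that is contained in $Y$; 3. for each $v\in Y$, no important $\{v\}$-$W$ separator of size at most $k$ is contained in $Y$. There are a deterministic algorithm (a program for a unit-cost random access machine with addition and subtraction) and constants $C,c,d\in\mathbb N$ such that the following holds. On input a graph $G$ with $n\ge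 0$ vertices, a set $W\subseteq V(G)$ and an integer $k\ge 0$, the algorithm halts after at most $C\,k^{ck}(n+1)^{d}$ steps (with $0^0=1$) and outputs a family $\mathcal Z$ of at most $C\,k^{ck}\lfloor\log_2(n+2)\rfloor$ vertex sets, each disjoint from $W$, such that for every set $Y\subseteq V(G)$ that is $k$-shadow-removable with respect to $W$ there is a set $Z\in\mathcal Z$ with $$Y\cap Z=\emptyset\qquad\text{and}\qquad R_W(Y)\subseteq Z .$$ -/

import Mathlib

/-! ### Separators and shadows in a finite simple graph -/

namespace ShadowRemoval

variable {V : Type*}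

/-- `u` and `v` are connected in `G - X`: some walk of `G` from `u` to `v` uses no vertex of `X`
(in particular `u` and `v` themselves are not in `X`). -/
def ConnectedIn (G : SimpleGraph V) (X : Set V) (u v : V) : Prop :=
  ∃ p : G.Walk u v, ∀ x ∈ p.support, x ∉ X

/-- `X` is an `S`-`T` separator: a set of vertices outside `S ∪ T` such that no path of `G - X`
connects `S` to `T`. -/
def IsSeparator (G : SimpleGraph V) (S T X : Set V) : Prop :=
  Disjoint X (S ∪ T) ∧ ∀ s ∈ S, ∀ t ∈ T, ¬ ConnectedIn G X s t

/-- An inclusion-minimal `S`-`T` separator. -/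
def IsMinimalSeparator (G : SimpleGraph V) (S T X : Set V) : Prop :=
  Minimal (IsSeparator G S T) X

/-- The set `C` of all vertices that are connected to `S` in `G - X`. If `X` is a minimal
`S`-`T` separator, then `X = N(C)`. -/
def sourceSide (G : SimpleGraph V) (S X : Set V) : Set V :=
  {v | ∃ s ∈ S, ConnectedIn G X s v}

/-- `X = N(C)` is an important `S`-`T` separator: it is a minimal `S`-`T` separator, and every
minimal `S`-`T` separator `X' = N(C')` with `C ⊂ C'` is strictly larger. -/
def IsImportantSeparator (G : SimpleGraph V) (S T X : Set V) : Prop :=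
  IsMinimalSeparator G S T X ∧
    ∀ X', IsMinimalSeparator G S T X' → sourceSide G S X ⊂ sourceSide G S X' →
      X.ncard < X'.ncard

/-- The shadow `R_W(Y)`: the vertices of `G - Y` outside `W` that are not connected to `W`
in `G - Y`. -/
def shadow (G : SimpleGraph V) (W Y : Set V) : Set V :=
  {v | v ∉ W ∧ v ∉ Y ∧ ∀ w ∈ W, ¬ ConnectedIn G Y v w}

/-- `Y` is `k`-shadow-removable with respect to `W`. -/
structure IsShadowRemovable (G : SimpleGraph V) (W : Set V) (k : ℕ) (Y : Set V) : Prop where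
  disjoint : Disjoint W Y
  card_le : Y.ncard ≤ k
  exists_important : ∀ v ∈ shadow G W Y,
    ∃ X, IsImportantSeparator G {v} W X ∧ X.ncard ≤ k ∧ X ⊆ Y
  not_subset : ∀ v ∈ Y, ∀ X, IsImportantSeparator G {v} W X → X.ncard ≤ k → ¬ X ⊆ Y

end ShadowRemoval

/-! ### A random access machine with unit cost

Programs are deterministic structured programs over natural-number registers and arrays.
The only arithmetic operations are addition and truncated subtraction, so that `t` steps produce
numbers of at most `t + O(1)` more bits than those in the input, and the unit-cost measure is
polynomially related to running time on a Turing machine. -/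

namespace RAM

/-- The memory: registers, and arrays (given by their name) of registers. A program mentions only
finitely many registers and arrays by name. -/
@[ext]
structure State where
  reg : ℕ → ℕ
  arr : ℕ → ℕ → ℕ

/-- Expressions: constants, registers, array entries (with a computed index), sums, and
differences (cut off at `0`). -/
inductive Expr where
  | const (c : ℕ)
  | reg (x : ℕ)
  | get (a : ℕ) (i : Expr)
  | add (e f : Expr)
  | sub (e f : Expr)

/-- The value of an expression. -/
def Expr.eval (s : State) : Expr → ℕ
  | .const c => c
  | .reg x => s.reg x
  | .get a i => s.arr a (i.eval s)
  | .add e f => e.eval s + f.eval s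
  | .sub e f => e.eval s - f.eval s

/-- The number of steps that evaluating an expression takes: one for each of its nodes. -/
def Expr.cost : Expr → ℕ
  | .const _ => 1
  | .reg _ => 1
  | .get _ i => i.cost + 1
  | .add e f => e.cost + f.cost + 1
  | .sub e f => e.cost + f.cost + 1

/-- Programs. In `cond` and `loop` a test expression counts as true if its value is not `0`. -/
inductive Prog where
  | assign (x : ℕ) (e : Expr)
  | store (a : ℕ) (i e : Expr)
  | seq (p q : Prog)
  | cond (e : Expr) (p q : Prog)
  | loop (e : Expr) (p : Prog)

/-- The state after writing `v` to register `x`. -/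
def State.setReg (s : State) (x v : ℕ) : State :=
  { s with reg := Function.update s.reg x v }

/-- The state after writing `v` to entry `i` of array `a`. -/
def State.setArr (s : State) (a i v : ℕ) : State :=
  { s with arr := Function.update s.arr a (Function.update (s.arr a) i v) }

/-- `Runs p s t s'`: started in state `s`, program `p` halts after exactly `t` steps in
state `s'`. -/
inductive Runs : Prog → State → ℕ → State → Prop
  | assign (s : State) (x : ℕ) (e : Expr) :
      Runs (.assign x e) s (e.cost + 1) (s.setReg x (e.eval s))
  | store (s : State) (a : ℕ) (i e : Expr) :
      Runs (.store a i e) s (i.cost + e.cost + 1) (s.setArr a (i.eval s) (e.eval s))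
  | seq {p q : Prog} {s s' s'' : State} {t t' : ℕ} :
      Runs p s t s' → Runs q s' t' s'' → Runs (.seq p q) s (t + t') s''
  | cond_true {e : Expr} {p q : Prog} {s s' : State} {t : ℕ} :
      e.eval s ≠ 0 → Runs p s t s' → Runs (.cond e p q) s (e.cost + 1 + t) s'
  | cond_false {e : Expr} {p q : Prog} {s s' : State} {t : ℕ} :
      e.eval s = 0 → Runs q s t s' → Runs (.cond e p q) s (e.cost + 1 + t) s'
  | loop_done {e : Expr} {p : Prog} {s : State} :
      e.eval s = 0 → Runs (.loop e p) s (e.cost + 1) s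
  | loop_step {e : Expr} {p : Prog} {s s' s'' : State} {t t' : ℕ} :
      e.eval s ≠ 0 → Runs p s t s' → Runs (.loop e p) s' t' s'' →
        Runs (.loop e p) s (e.cost + 1 + t + t') s''

/-- Programs are deterministic: the number of steps and the final state are determined by the
program and the initial state. -/
theorem Runs.deterministic {p : Prog} {s s₁ s₂ : State} {t₁ t₂ : ℕ}
    (h₁ : Runs p s t₁ s₁) (h₂ : Runs p s t₂ s₂) : t₁ = t₂ ∧ s₁ = s₂ := by
  induction h₁ generalizing t₂ s₂ with
  | assign => cases h₂; exact ⟨rfl, rfl⟩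
  | store => cases h₂; exact ⟨rfl, rfl⟩
  | seq _ _ ih ih' =>
    cases h₂ with
    | seq a b =>
      obtain ⟨rfl, rfl⟩ := ih a
      obtain ⟨rfl, rfl⟩ := ih' b
      exact ⟨rfl, rfl⟩
  | cond_true h _ ih =>
    cases h₂ with
    | cond_true _ a => obtain ⟨rfl, rfl⟩ := ih a; exact ⟨rfl, rfl⟩
    | cond_false h' _ => exact absurd h' h
  | cond_false h _ ih =>
    cases h₂ with
    | cond_true h' _ => exact absurd h h'
    | cond_false _ a => obtain ⟨rfl, rfl⟩ := ih a; exact ⟨rfl, rfl⟩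
  | loop_done h =>
    cases h₂ with
    | loop_done _ => exact ⟨rfl, rfl⟩
    | loop_step h' _ _ => exact absurd h h'
  | loop_step h _ _ ih ih' =>
    cases h₂ with
    | loop_done h' => exact absurd h' h
    | loop_step _ a b =>
      obtain ⟨rfl, rfl⟩ := ih a
      obtain ⟨rfl, rfl⟩ := ih' b
      exact ⟨rfl, rfl⟩

end RAM

namespace ShadowRemoval

open Classical in
/-- The input `(G, W, k)` on the vertex set `{0, …, n - 1}`: register `0` holds `n`, register `1`
holds `k`, array `0` holds the adjacency matrix of `G` (row by row), array `1` holds the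
characteristic vector of `W`, and all other cells are `0`. -/
noncomputable def input {n : ℕ} (G : SimpleGraph (Fin n)) (W : Set (Fin n)) (k : ℕ) :
    RAM.State where
  reg x := if x = 0 then n else if x = 1 then k else 0
  arr a i :=
    if a = 0 then (if ∃ u v : Fin n, G.Adj u v ∧ i = u * n + v then 1 else 0)
    else if a = 1 then (if ∃ w ∈ W, i = (w : ℕ) then 1 else 0)
    else 0

/-- The family of subsets of `{0, …, n - 1}` that a final state stands for: register `0` holds
their number, and array `0` holds their characteristic vectors one after the other, each of
length `n`, with any nonzero value standing for membership. -/
def output (n : ℕ) (s : RAM.State) : List (Set (Fin n)) :=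
  (List.range (s.reg 0)).map fun q => {v : Fin n | s.arr 0 (q * n + v) ≠ 0}

end ShadowRemoval

-- Vertices of the shadow of `Y` have an important separator of size at most `k` inside `Y`, while
-- vertices of `Y` have none. Suppose a set `A` contains `Y`, and no vertex of `Y` has an important
-- separator of size at most `k` inside `A`. Then the set of all `v` that do have one inside `A`
-- contains the shadow and misses `Y`. It also misses `W`, because a vertex of `W` has no separator
-- at all. So few sets `A` must be produced such that every `Y` has a suitable one among them, and
-- the vertices captured by `A` must be recognised quickly.
--
-- For each `v ∈ Y`, `exists_hitting_set` gives at most `k + 1` vertices outside `Y` that meet every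
-- important separator of size at most `k`. Hence it suffices that `A` contains `Y` and avoids the
-- union `H` of these sets, which has at most `k * (k + 1)` elements. The sets `A` are unions of at
-- most `k` colour classes of colourings with `M = 12 * k ^ 3 + 1` colours. A colouring in which no
-- vertex of `Y` shares its colour with a vertex of `H` does the job once the colours of `Y` are
-- selected. The `ℓ * M` colourings, `ℓ = Nat.log 2 (n + 2)`, come from a derandomised greedy
-- choice. A pair of vertices weighs `2` to the number of its collisions, each colouring multiplies
-- the total weight by at most `1 + 1 / M`, so no pair collides more than `6 * ℓ` times
-- (`collisions_le`). The pairs in `Y × H` then cannot spoil all colourings (`exists_separating`).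
-- The selections are the `k`-digit numbers to base `M`, giving `ℓ * M * M ^ k` sets.
--
-- Both the hitting set and the test for `A` rest on one branching-free argument. Let `T` be a set
-- that must lie on the side of `v`, and `R` the largest side containing `T` with minimum boundary.
-- If `T` is `Anchored`, submodularity shows that the boundary of `R` is important
-- (`IsFarthest.isImportantSeparator`), and that every important separator with `T` on its source
-- side keeps each vertex of that boundary on the source side or contains it
-- (`IsFarthest.boundary_subset`). A boundary vertex that the separator may not contain can
-- therefore be added to `T`, which stays anchored, and the minimum strictly grows. After at most `k
-- + 1` increases it exceeds `k`.
--
-- The test finds `R` by augmenting paths in the vertex-split network. The statement that `r` is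
-- residual to a flow of value `val` is expressed only through cuts: every source-sink cut of the
-- capacities exceeds its residual cut by `val`. Flow conservation never has to be mentioned, and
-- adding arcs changes both sides equally, so the flow is kept when `T` grows.

namespace RAM

/-! ### Counting-loop programs and their running times. -/

/-- Programs all of whose loops are counting loops: `rep i x c` runs `c` for the values
`0, 1, …` of register `i` that are below the value of register `x`. -/
inductive Cmd where
  | assign (x : ℕ) (e : Expr)
  | store (a : ℕ) (i e : Expr)
  | seq (c d : Cmd)
  | cond (e : Expr) (c d : Cmd)
  | rep (i x : ℕ) (c : Cmd)

namespace Cmd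

/-- The program that a counting-loop program stands for. -/
def toProg : Cmd → Prog
  | assign x e => .assign x e
  | store a i e => .store a i e
  | seq c d => .seq c.toProg d.toProg
  | cond e c d => .cond e c.toProg d.toProg
  | rep i x c => .seq (.assign i (.const 0)) (.loop (.sub (.reg x) (.reg i))
      (.seq c.toProg (.assign i (.add (.reg i) (.const 1)))))

/-- The state after running a counting-loop program. -/
def run : Cmd → State → State
  | assign x e, s => s.setReg x (e.eval s)
  | store a i e, s => s.setArr a (i.eval s) (e.eval s)
  | seq c d, s => d.run (c.run s)
  | cond e c d, s => if e.eval s ≠ 0 then c.run s else d.run s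
  | rep i x c, s => (fun t => (c.run t).setReg i ((c.run t).reg i + 1))^[s.reg x] (s.setReg i 0)

/-- The registers written by a program. -/
def regs : Cmd → List ℕ
  | assign x _ => [x]
  | store _ _ _ => []
  | seq c d => c.regs ++ d.regs
  | cond _ c d => c.regs ++ d.regs
  | rep i _ c => i :: c.regs

/-- The arrays written by a program. -/
def arrs : Cmd → List ℕ
  | assign _ _ => []
  | store a _ _ => [a]
  | seq c d => c.arrs ++ d.arrs
  | cond _ c d => c.arrs ++ d.arrs
  | rep _ _ c => c.arrs

/-- The registers that bound the loops of a program. -/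
def bounds : Cmd → List ℕ
  | assign _ _ => []
  | store _ _ _ => []
  | seq c d => c.bounds ++ d.bounds
  | cond _ c d => c.bounds ++ d.bounds
  | rep _ x c => x :: c.bounds

/-- No loop body writes the counter of its loop. -/
def wf : Cmd → Bool
  | assign _ _ => true
  | store _ _ _ => true
  | seq c d => c.wf && d.wf
  | cond _ c d => c.wf && d.wf
  | rep i _ c => !c.regs.contains i && c.wf

/-- A bound for the running time, in terms of the values of the registers that bound loops. -/
def time : Cmd → (ℕ → ℕ) → ℕ
  | assign _ e, _ => e.cost + 1
  | store _ i e, _ => i.cost + e.cost + 1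
  | seq c d, g => c.time g + d.time g
  | cond e c d, g => e.cost + 1 + (c.time g + d.time g)
  | rep _ x c, g => g x * (c.time g + 8) + 6

end Cmd

/-- The states agree outside the listed registers and arrays. -/
structure Same (R A : List ℕ) (s t : State) : Prop where
  reg : ∀ x, x ∉ R → t.reg x = s.reg x
  arr : ∀ a, a ∉ A → t.arr a = s.arr a

theorem Same.refl (R A : List ℕ) (s : State) : Same R A s s := ⟨fun _ _ => rfl, fun _ _ => rfl⟩

theorem Same.trans {R A : List ℕ} {s t u : State} (h : Same R A s t) (h' : Same R A t u) :
    Same R A s u :=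
  ⟨fun x hx => (h'.reg x hx).trans (h.reg x hx), fun a ha => (h'.arr a ha).trans (h.arr a ha)⟩

theorem Same.mono {R A R' A' : List ℕ} {s t : State} (h : Same R A s t) (hR : R ⊆ R')
    (hA : A ⊆ A') : Same R' A' s t :=
  ⟨fun x hx => h.reg x fun h => hx (hR h), fun a ha => h.arr a fun h => ha (hA h)⟩

@[simp] theorem State.reg_setReg (s : State) (x v y : ℕ) :
    (s.setReg x v).reg y = if y = x then v else s.reg y := by
  simp [State.setReg, Function.update_apply]

@[simp] theorem State.arr_setReg (s : State) (x v : ℕ) : (s.setReg x v).arr = s.arr := rfl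

@[simp] theorem State.reg_setArr (s : State) (a i v : ℕ) : (s.setArr a i v).reg = s.reg := rfl

@[simp] theorem State.arr_setArr (s : State) (a i v b : ℕ) :
    (s.setArr a i v).arr b = if b = a then Function.update (s.arr a) i v else s.arr b := by
  simp [State.setArr, Function.update_apply]

theorem Same.setReg {R A : List ℕ} {s t : State} (h : Same R A s t) {x : ℕ} (hx : x ∈ R) (v : ℕ) :
    Same R A s (t.setReg x v) :=
  ⟨fun y hy => by
    rw [State.reg_setReg, if_neg (by rintro rfl; exact hy hx), h.reg y hy], h.arr⟩

namespace Cmd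

theorem run_assign (x : ℕ) (e : Expr) (s : State) :
    (assign x e).run s = s.setReg x (e.eval s) := rfl

theorem run_store (a : ℕ) (i e : Expr) (s : State) :
    (store a i e).run s = s.setArr a (i.eval s) (e.eval s) := rfl

theorem run_seq (c d : Cmd) (s : State) : (seq c d).run s = d.run (c.run s) := rfl

theorem run_cond (e : Expr) (c d : Cmd) (s : State) :
    (cond e c d).run s = if e.eval s ≠ 0 then c.run s else d.run s := rfl

/-- The frame rule: facts about untouched memory are transported along it, membership in the
concrete lists being settled by `decide`. -/
theorem run_same (c : Cmd) (s : State) : Same c.regs c.arrs s (c.run s) := by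
  induction c generalizing s with
  | assign x e => exact (Same.refl _ _ s).setReg (by simp [regs]) _
  | store a i e =>
    refine ⟨fun _ _ => rfl, fun b hb => ?_⟩
    simp only [arrs, List.mem_singleton] at hb
    simp [run, hb]
  | seq c d ihc ihd =>
    exact ((ihc s).mono (by simp [regs]) (by simp [arrs])).trans
      ((ihd _).mono (by simp [regs]) (by simp [arrs]))
  | cond e c d ihc ihd =>
    rw [run]
    split_ifs
    · exact (ihc s).mono (by simp [regs]) (by simp [arrs])
    · exact (ihd s).mono (by simp [regs]) (by simp [arrs])
  | rep i x c ih =>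
    have key : ∀ m t, Same (rep i x c).regs (rep i x c).arrs s t →
        Same (rep i x c).regs (rep i x c).arrs s
          ((fun t => (c.run t).setReg i ((c.run t).reg i + 1))^[m] t) := by
      intro m
      induction m with
      | zero => exact fun t h => h
      | succ m ihm =>
        intro t h
        exact ihm _ ((h.trans ((ih t).mono (by simp [regs]) (by simp [arrs]))).setReg
          (by simp [regs]) _)
    exact key _ _ ((Same.refl _ _ s).setReg (by simp [regs]) _)

theorem time_congr (c : Cmd) {g g' : ℕ → ℕ} (h : ∀ x ∈ c.bounds, g x = g' x) :
    c.time g = c.time g' := by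
  induction c with
  | assign x e => rfl
  | store a i e => rfl
  | seq c d ihc ihd =>
    rw [time, time, ihc fun x hx => h x (by simp [bounds, hx]),
      ihd fun x hx => h x (by simp [bounds, hx])]
  | cond e c d ihc ihd =>
    rw [time, time, ihc fun x hx => h x (by simp [bounds, hx]),
      ihd fun x hx => h x (by simp [bounds, hx])]
  | rep i x c ih =>
    rw [time, time, ih fun y hy => h y (by simp [bounds, hy]), h x (by simp [bounds])]

/-- A counting-loop program halts within the given time if it does not write the registers that
bound its loops. -/
theorem runs_toProg (c : Cmd) (hwf : c.wf = true) (hb : ∀ x ∈ c.bounds, x ∉ c.regs) (s : State) :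
    ∃ t ≤ c.time s.reg, Runs c.toProg s t (c.run s) := by
  induction c generalizing s with
  | assign x e => exact ⟨_, le_rfl, .assign s x e⟩
  | store a i e => exact ⟨_, le_rfl, .store s a i e⟩
  | seq c d ihc ihd =>
    simp only [wf, Bool.and_eq_true] at hwf
    obtain ⟨t, ht, hr⟩ := ihc hwf.1 (fun x hx h => hb x (by simp [bounds, hx]) (by simp [regs, h])) s
    obtain ⟨t', ht', hr'⟩ := ihd hwf.2
      (fun x hx h => hb x (by simp [bounds, hx]) (by simp [regs, h])) (c.run s)
    refine ⟨_, add_le_add ht (ht'.trans_eq (time_congr d fun x hx => ?_)), .seq hr hr'⟩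
    exact (c.run_same s).reg x fun h => hb x (by simp [bounds, hx]) (by simp [regs, h])
  | cond e c d ihc ihd =>
    simp only [wf, Bool.and_eq_true] at hwf
    by_cases he : e.eval s ≠ 0
    · obtain ⟨t, ht, hr⟩ :=
        ihc hwf.1 (fun x hx h => hb x (by simp [bounds, hx]) (by simp [regs, h])) s
      refine ⟨_, ?_, by rw [run, if_pos he]; exact .cond_true he hr⟩
      rw [time]; lia
    · obtain ⟨t, ht, hr⟩ :=
        ihd hwf.2 (fun x hx h => hb x (by simp [bounds, hx]) (by simp [regs, h])) s
      refine ⟨_, ?_, by rw [run, if_neg he]; exact .cond_false (not_not.1 he) hr⟩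
      rw [time]; lia
  | rep i x c ih =>
    simp only [wf, Bool.and_eq_true, Bool.not_eq_true', List.contains_eq_mem,
      decide_eq_false_iff_not] at hwf
    have hxi : x ≠ i := fun h => hb x (by simp [bounds]) (by simp [regs, h])
    have hxc : x ∉ c.regs := fun h => hb x (by simp [bounds]) (by simp [regs, h])
    have hbc : ∀ y ∈ c.bounds, y ∉ c.regs := fun y hy h =>
      hb y (by simp [bounds, hy]) (by simp [regs, h])
    have hbi : ∀ y ∈ c.bounds, y ≠ i := fun y hy h => hb y (by simp [bounds, hy]) (by simp [regs, h])
    -- Generalised to a loop entered with `m` rounds left. A round costs the body plus 8 (test 4,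
    -- increment 4); the last, failing test costs 4.
    have key : ∀ m u, u.reg x = u.reg i + m →
        ∃ t ≤ m * (c.time u.reg + 8) + 4,
          Runs (.loop (.sub (.reg x) (.reg i)) (.seq c.toProg (.assign i (.add (.reg i) (.const 1)))))
            u t ((fun t => (c.run t).setReg i ((c.run t).reg i + 1))^[m] u) := by
      intro m
      induction m with
      | zero =>
        intro u hu
        exact ⟨_, by simp [Expr.cost], .loop_done (by simp [Expr.eval, hu])⟩
      | succ m ihm =>
        intro u hu
        obtain ⟨t, ht, hr⟩ := ih hwf.2 hbc u
        have hx' : (c.run u).reg x = u.reg x := (c.run_same u).reg x hxc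
        have hi' : (c.run u).reg i = u.reg i := (c.run_same u).reg i hwf.1
        obtain ⟨t', ht', hr'⟩ := ihm ((c.run u).setReg i ((c.run u).reg i + 1)) (by
          simp [hxi, hx', hi', hu]; ring)
        have htc : c.time ((c.run u).setReg i ((c.run u).reg i + 1)).reg = c.time u.reg :=
          time_congr c fun y hy => by
            rw [State.reg_setReg, if_neg (hbi y hy), (c.run_same u).reg y (hbc y hy)]
        refine ⟨_, ?_, .loop_step (by simp [Expr.eval, hu]) (.seq hr (.assign _ _ _)) hr'⟩
        rw [htc] at ht'
        simp only [Expr.cost]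
        rw [Nat.succ_mul]
        lia
    obtain ⟨t, ht, hr⟩ := key (s.reg x) (s.setReg i 0) (by simp [hxi])
    refine ⟨_, ?_, .seq (.assign _ _ _) hr⟩
    rw [time, ← time_congr c (g := (s.setReg i 0).reg) fun y hy => by
      rw [State.reg_setReg, if_neg (hbi y hy)]]
    simp only [Expr.cost]
    lia

/-- Induction along a counting loop. -/
theorem run_rep {i x : ℕ} {c : Cmd} {s : State} (P : ℕ → State → Prop) (hi : i ∉ c.regs)
    (h0 : P 0 (s.setReg i 0))
    (hs : ∀ j t, j < s.reg x → t.reg i = j → Same (i :: c.regs) c.arrs s t → P j t →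
      P (j + 1) ((c.run t).setReg i (j + 1))) :
    P (s.reg x) ((rep i x c).run s) := by
  have key : ∀ m, m ≤ s.reg x →
      ∀ u, u = (fun t => (c.run t).setReg i ((c.run t).reg i + 1))^[m] (s.setReg i 0) →
        u.reg i = m ∧ Same (i :: c.regs) c.arrs s u ∧ P m u := by
    intro m
    induction m with
    | zero =>
      rintro - u rfl
      exact ⟨by simp, (Same.refl _ _ s).setReg (by simp) _, h0⟩
    | succ m ih =>
      rintro hm u rfl
      obtain ⟨h1, h2, h3⟩ := ih (by lia) _ rfl
      rw [Function.iterate_succ_apply']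
      set u := (fun t => (c.run t).setReg i ((c.run t).reg i + 1))^[m] (s.setReg i 0)
      have hi' : (c.run u).reg i = m := ((c.run_same u).reg i hi).trans h1
      rw [hi']
      exact ⟨by simp, (h2.trans ((c.run_same u).mono (by simp) (by simp))).setReg (by simp) _,
        hs m u (by lia) h1 h2 h3⟩
  exact (key _ le_rfl _ rfl).2.2

end Cmd

end RAM

/-! ### Separators, submodularity and hitting sets. -/

namespace ShadowRemoval

section Graph

variable {V : Type*} {G : SimpleGraph V} {W X X' R R' S T D K : Set V} {u v x : V}

theorem ConnectedIn.refl (h : v ∉ X) : ConnectedIn G X v v := ⟨.nil, by simpa using h⟩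

theorem ConnectedIn.concat (h : ConnectedIn G X v u) (hux : G.Adj u x) (hx : x ∉ X) :
    ConnectedIn G X v x := by
  obtain ⟨p, hp⟩ := h
  refine ⟨p.concat hux, fun y hy => ?_⟩
  rw [SimpleGraph.Walk.support_concat] at hy
  simp only [List.mem_append, List.mem_singleton] at hy
  rcases hy with hy | rfl
  exacts [hp y hy, hx]

theorem ConnectedIn.mono (h : ConnectedIn G X v u) (hX : X' ⊆ X) : ConnectedIn G X' v u :=
  h.imp fun _ hp y hy hy' => hp y hy (hX hy')

theorem ConnectedIn.right_notMem (h : ConnectedIn G X v u) : u ∉ X := by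
  obtain ⟨p, hp⟩ := h
  exact hp u p.end_mem_support

theorem ConnectedIn.left_notMem (h : ConnectedIn G X v u) : v ∉ X := by
  obtain ⟨p, hp⟩ := h
  exact hp v p.start_mem_support

/-- The vertices outside `R` with a neighbour in `R`. -/
def boundary (G : SimpleGraph V) (R : Set V) : Set V := {x | x ∉ R ∧ ∃ u ∈ R, G.Adj u x}

/-- A walk that leaves `R` must enter a boundary vertex, and these are all deleted. -/
theorem ConnectedIn.mem_of_boundary_subset (h : ConnectedIn G X v u) (hv : v ∈ R)
    (hR : boundary G R ⊆ X) : u ∈ R := by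
  obtain ⟨p, hp⟩ := h
  induction p with
  | nil => exact hv
  | cons hadj p ih =>
    simp only [SimpleGraph.Walk.support_cons, List.mem_cons, forall_eq_or_imp] at hp
    refine ih ?_ hp.2
    by_contra hc
    exact hp.2 _ p.start_mem_support (hR ⟨hc, _, hv, hadj⟩)

/-- The vertices that can be reached from `v` within `R`. -/
def component (G : SimpleGraph V) (v : V) (R : Set V) : Set V := sourceSide G {v} Rᶜ

theorem mem_sourceSide : u ∈ sourceSide G {v} X ↔ ConnectedIn G X v u := by
  simp [sourceSide]

theorem mem_component : u ∈ component G v R ↔ ConnectedIn G Rᶜ v u := mem_sourceSide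

theorem component_subset : component G v R ⊆ R := fun _ hu => by
  simpa using (mem_component.1 hu).right_notMem

theorem component_mono (h : R ⊆ R') : component G v R ⊆ component G v R' := fun _ hu =>
  mem_component.2 ((mem_component.1 hu).mono (Set.compl_subset_compl.2 h))

theorem mem_component_self (h : v ∈ R) : v ∈ component G v R :=
  mem_component.2 (.refl (by simpa using h))

theorem ConnectedIn.of_closed {P : Set V} (h : ConnectedIn G X v u)
    (hP : ∀ y z, y ∈ P → G.Adj y z → z ∉ X → z ∈ P) (hv : v ∈ P) : u ∈ P := by
  refine h.mem_of_boundary_subset hv fun z hz => ?_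
  by_contra hc
  obtain ⟨y, hy, hyz⟩ := hz.2
  exact hz.1 (hP y z hy hyz hc)

/-- A walk within `R` from `v` visits only vertices reachable within `R`. -/
theorem component_component : component G v (component G v R) = component G v R := by
  refine component_subset.antisymm fun u hu => ?_
  have hu' := mem_component.1 hu
  have hv : v ∈ R := by simpa using hu'.left_notMem
  refine hu'.of_closed (P := component G v (component G v R)) (fun y z hy hyz hz => ?_)
    (mem_component_self (mem_component_self hv))
  have hyc := component_subset hy
  exact mem_component.2 ((mem_component.1 hy).concat hyz
    (by simpa using mem_component.2 ((mem_component.1 hyc).concat hyz hz)))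

theorem boundary_sourceSide_subset : boundary G (sourceSide G {v} X) ⊆ X := by
  rintro x ⟨hx, u, hu, hux⟩
  by_contra hc
  exact hx (mem_sourceSide.2 ((mem_sourceSide.1 hu).concat hux hc))

theorem boundary_component_subset : boundary G (component G v R) ⊆ boundary G R := by
  intro x hx
  obtain ⟨hx', u, hu, hux⟩ := hx
  exact ⟨by simpa using boundary_sourceSide_subset ⟨hx', u, hu, hux⟩, u, component_subset hu, hux⟩

theorem sourceSide_boundary (hv : v ∈ R) :
    sourceSide G {v} (boundary G R) = component G v R := by
  ext u
  rw [mem_sourceSide]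
  constructor
  · intro h
    refine h.of_closed (P := component G v R) (fun y z hy hyz hz => ?_) (mem_component_self hv)
    refine mem_component.2 ((mem_component.1 hy).concat hyz ?_)
    intro hzR
    exact hz ⟨hzR, y, component_subset hy, hyz⟩
  · intro h
    exact (mem_component.1 h).mono fun z hz => hz.1

theorem component_sourceSide :
    component G v (sourceSide G {v} X) = sourceSide G {v} X := by
  have : sourceSide G {v} X = component G v Xᶜ := by rw [component, compl_compl]
  rw [this, component_component]

theorem boundary_union_subset : boundary G (R ∪ R') ⊆ boundary G R ∪ boundary G R' := by
  rintro x ⟨hx, u, hu | hu, hux⟩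
  · exact Or.inl ⟨fun h => hx (Or.inl h), u, hu, hux⟩
  · exact Or.inr ⟨fun h => hx (Or.inr h), u, hu, hux⟩

theorem boundary_inter_subset : boundary G (R ∩ R') ⊆ boundary G R ∪ boundary G R' := by
  rintro x ⟨hx, u, hu, hux⟩
  by_cases hxR : x ∈ R
  · exact Or.inr ⟨fun h => hx ⟨hxR, h⟩, u, hu.2, hux⟩
  · exact Or.inl ⟨hxR, u, hu.1, hux⟩

/-- Each boundary vertex of the union or intersection is a boundary vertex of `R` or `R'`, and one
counted twice on the left is counted twice on the right. -/
theorem ncard_boundary_submodular [Finite V] (R R' : Set V) :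
    (boundary G (R ∪ R')).ncard + (boundary G (R ∩ R')).ncard ≤
      (boundary G R).ncard + (boundary G R').ncard := by
  rw [← Set.ncard_union_add_ncard_inter (boundary G (R ∪ R')),
    ← Set.ncard_union_add_ncard_inter (boundary G R)]
  refine add_le_add (Set.ncard_le_ncard (Set.union_subset boundary_union_subset
    boundary_inter_subset)) (Set.ncard_le_ncard ?_)
  rintro x ⟨⟨hx, -⟩, -, u, hu, hux⟩
  exact ⟨⟨fun h => hx (Or.inl h), u, hu.1, hux⟩, ⟨fun h => hx (Or.inr h), u, hu.2, hux⟩⟩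

/-- `R` is a set whose boundary separates `v` from `W`. -/
structure IsSide (G : SimpleGraph V) (v : V) (W R : Set V) : Prop where
  mem : v ∈ R
  disjoint : Disjoint R W
  disjoint_boundary : Disjoint (boundary G R) W

theorem IsSide.union (h : IsSide G v W R) (h' : IsSide G v W R') : IsSide G v W (R ∪ R') :=
  ⟨Or.inl h.mem, h.disjoint.union_left h'.disjoint,
    (h.disjoint_boundary.union_left h'.disjoint_boundary).mono_left boundary_union_subset⟩

theorem IsSide.inter (h : IsSide G v W R) (h' : IsSide G v W R') : IsSide G v W (R ∩ R') :=
  ⟨⟨h.mem, h'.mem⟩, h.disjoint.mono_left Set.inter_subset_left,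
    (h.disjoint_boundary.union_left h'.disjoint_boundary).mono_left boundary_inter_subset⟩

theorem IsSide.component (h : IsSide G v W R) : IsSide G v W (component G v R) :=
  ⟨mem_component_self h.mem, h.disjoint.mono_left component_subset,
    h.disjoint_boundary.mono_left boundary_component_subset⟩

theorem IsSide.isSeparator (h : IsSide G v W R) : IsSeparator G {v} W (boundary G R) := by
  refine ⟨Set.disjoint_union_right.2 ⟨?_, h.disjoint_boundary⟩, ?_⟩
  · exact Set.disjoint_singleton_right.2 fun hv => hv.1 h.mem
  · rintro _ rfl w hw hc
    exact Set.disjoint_left.1 h.disjoint (hc.mem_of_boundary_subset h.mem subset_rfl) hw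

theorem IsSeparator.notMem (h : IsSeparator G {v} W X) : v ∉ X := fun hv =>
  Set.disjoint_left.1 h.1 hv (Or.inl rfl)

theorem IsSeparator.isSide (h : IsSeparator G {v} W X) : IsSide G v W (sourceSide G {v} X) where
  mem := mem_sourceSide.2 (.refl h.notMem)
  disjoint := Set.disjoint_left.2 fun w hw hw' => h.2 v rfl w hw' (mem_sourceSide.1 hw)
  disjoint_boundary := (Set.disjoint_union_right.1 h.1).2.mono_left boundary_sourceSide_subset

/-- The boundary of the source side is a separator inside `X`, so minimality forces equality.
Minimal separators can thus be handled as boundaries of sides. -/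
theorem IsMinimalSeparator.boundary_sourceSide (h : IsMinimalSeparator G {v} W X) :
    boundary G (sourceSide G {v} X) = X :=
  boundary_sourceSide_subset.antisymm (h.2 h.1.isSide.isSeparator boundary_sourceSide_subset)

theorem IsImportantSeparator.notMem_right (h : IsImportantSeparator G {v} W X) : v ∉ W := fun hv =>
  h.1.1.2 v rfl v hv (.refl h.1.1.notMem)

/-- Nothing beyond an important separator has a boundary that is at most as large. -/
theorem IsImportantSeparator.component_subset [Finite V] (h : IsImportantSeparator G {v} W S)
    (hR : IsSide G v W R) (hSR : sourceSide G {v} S ⊆ R) (hcard : (boundary G R).ncard ≤ S.ncard) :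
    component G v R ⊆ sourceSide G {v} S := by
  -- Importance only speaks of minimal separators, so the boundary of `R` is shrunk to one; this can
  -- only enlarge the side reachable from `v`.
  obtain ⟨X, hX, hXmin⟩ := exists_minimal_le_of_wellFoundedLT (IsSeparator G {v} W)
    (boundary G R) hR.isSeparator
  have h1 : component G v R ⊆ sourceSide G {v} X := by
    rw [← sourceSide_boundary hR.mem]
    exact fun u hu => mem_sourceSide.2 ((mem_sourceSide.1 hu).mono hX)
  have h2 : sourceSide G {v} S ⊆ component G v R := by
    rw [← component_sourceSide]
    exact component_mono hSR
  by_contra hc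
  have := h.2 X hXmin ⟨h2.trans h1, fun h' => hc (h1.trans h')⟩
  have := Set.ncard_le_ncard hX
  lia

/-- `R` is the largest among the sets containing `T` whose boundary is a minimum separator. -/
structure IsFarthest (G : SimpleGraph V) (v : V) (W T R : Set V) : Prop where
  isSide : IsSide G v W R
  subset : T ⊆ R
  ncard_le : ∀ R', IsSide G v W R' → T ⊆ R' → (boundary G R).ncard ≤ (boundary G R').ncard
  le : ∀ R', IsSide G v W R' → T ⊆ R' → (boundary G R').ncard ≤ (boundary G R).ncard → R' ⊆ R

/-- By submodularity, the union of two sides of minimum boundary again has minimum boundary, since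
their intersection still contains `T` and cannot do better. A maximal minimiser is therefore the
largest one. -/
theorem IsSide.exists_isFarthest [Finite V] (h : IsSide G v W R) (hT : T ⊆ R) :
    ∃ R', IsFarthest G v W T R' := by
  obtain ⟨m, ⟨R₀, hR₀, hTR₀, rfl⟩, hm⟩ := WellFounded.has_min (wellFounded_lt (α := ℕ))
    {m | ∃ R', IsSide G v W R' ∧ T ⊆ R' ∧ (boundary G R').ncard = m} ⟨_, R, h, hT, rfl⟩
  have hmin : ∀ R', IsSide G v W R' → T ⊆ R' → (boundary G R₀).ncard ≤ (boundary G R').ncard :=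
    fun R' h1 h2 => not_lt.1 (hm _ ⟨R', h1, h2, rfl⟩)
  obtain ⟨R₁, -, ⟨hR₁, hTR₁, hc⟩, hmax⟩ := exists_maximal_ge_of_wellFoundedGT
    (fun R' => IsSide G v W R' ∧ T ⊆ R' ∧ (boundary G R').ncard ≤ (boundary G R₀).ncard)
    R₀ ⟨hR₀, hTR₀, le_rfl⟩
  refine ⟨R₁, hR₁, hTR₁, fun R' h1 h2 => hc.trans (hmin R' h1 h2), fun R' h1 h2 h3 => ?_⟩
  have h4 := ncard_boundary_submodular (G := G) R₁ R'
  have h5 := hmin _ (hR₁.inter h1) (Set.subset_inter hTR₁ h2)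
  exact Set.subset_union_right.trans (hmax ⟨hR₁.union h1, hTR₁.trans Set.subset_union_left, by lia⟩
    Set.subset_union_left)

/-- `T` extends to a connected set without making separators larger. -/
def Anchored (G : SimpleGraph V) (v : V) (W T : Set V) : Prop :=
  ∃ K, T ⊆ K ∧ K ⊆ component G v K ∧ ∀ R, IsSide G v W R → T ⊆ R →
    IsSide G v W (R ∪ K) ∧ (boundary G (R ∪ K)).ncard ≤ (boundary G R).ncard

theorem anchored_singleton : Anchored G v W {v} := by
  refine ⟨{v}, subset_rfl, ?_, fun R hR hv => ?_⟩
  · rintro _ rfl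
    exact mem_component_self rfl
  · rw [Set.union_eq_self_of_subset_right hv]
    exact ⟨hR, le_rfl⟩

/-- Adding the connected set `K` does not enlarge the boundary, so `K ⊆ R` by the choice of `R` as
largest minimiser. Hence `T` is reachable from `v` inside `R`. -/
theorem IsFarthest.subset_component (h : IsFarthest G v W T R) (hT : Anchored G v W T) :
    T ⊆ component G v R := by
  obtain ⟨K, hTK, hK, hR⟩ := hT
  have h1 := hR R h.isSide h.subset
  have h2 : K ⊆ R := Set.subset_union_right.trans
    (h.le _ h1.1 (h.subset.trans Set.subset_union_left) h1.2)
  exact (hTK.trans hK).trans (component_mono h2)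

theorem IsFarthest.boundary_component [Finite V] (h : IsFarthest G v W T R)
    (hT : Anchored G v W T) : boundary G (component G v R) = boundary G R :=
  Set.eq_of_subset_of_ncard_le boundary_component_subset
    (h.ncard_le _ h.isSide.component (h.subset_component hT))

/-- The source side of a separator inside the boundary of `R` still contains `T`, so it has no
smaller boundary. A separator that reaches strictly further without being larger has its source side
inside `R`, by the choice of `R`, and so does not reach further. -/
theorem IsFarthest.isImportantSeparator [Finite V] (h : IsFarthest G v W T R)
    (hT : Anchored G v W T) : IsImportantSeparator G {v} W (boundary G R) := by
  have hTC := h.subset_component hT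
  refine ⟨⟨h.isSide.isSeparator, fun X hX hXR => ?_⟩, fun X hX hRX => ?_⟩
  · have h1 : component G v R ⊆ sourceSide G {v} X := by
      rw [← sourceSide_boundary h.isSide.mem]
      exact fun u hu => mem_sourceSide.2 ((mem_sourceSide.1 hu).mono hXR)
    have h2 := h.ncard_le _ hX.isSide (hTC.trans h1)
    have h3 := Set.ncard_le_ncard (boundary_sourceSide_subset (G := G) (v := v) (X := X))
    exact (Set.eq_of_subset_of_ncard_le hXR (h2.trans h3)).ge
  · rw [sourceSide_boundary h.isSide.mem] at hRX
    by_contra hc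
    have h1 := h.le _ hX.1.isSide (hTC.trans hRX.1) (by rw [hX.boundary_sourceSide]; lia)
    refine hRX.2 ?_
    rw [← component_sourceSide]
    exact component_mono h1

theorem component_union_component :
    component G v R ∪ component G v R' ⊆ component G v (component G v R ∪ component G v R') := by
  rintro u (hu | hu)
  · rw [← component_component] at hu
    exact component_mono Set.subset_union_left hu
  · rw [← component_component] at hu
    exact component_mono Set.subset_union_right hu

/-- Uncrossing: the intersection of the two sides contains `T`, so its boundary is at least the
minimum. Submodularity then leaves the union a boundary no larger than `S`, and importance of `S`
forbids it from reaching beyond `S`. -/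
theorem IsFarthest.component_subset [Finite V] (h : IsFarthest G v W T R)
    (hT : Anchored G v W T) (hS : IsImportantSeparator G {v} W S) (hTS : T ⊆ sourceSide G {v} S) :
    component G v R ⊆ sourceSide G {v} S := by
  have hTC := h.subset_component hT
  have hb := h.boundary_component hT
  have h1 := ncard_boundary_submodular (G := G) (component G v R) (sourceSide G {v} S)
  have h2 := h.ncard_le _ (h.isSide.component.inter hS.1.1.isSide) (Set.subset_inter hTC hTS)
  rw [hb] at h1
  have h3 := hS.component_subset (h.isSide.component.union hS.1.1.isSide) Set.subset_union_right
    (by rw [hS.1.boundary_sourceSide] at h1; lia)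
  have h4 : sourceSide G {v} S = ShadowRemoval.component G v Sᶜ := by
    rw [ShadowRemoval.component, compl_compl]
  have h5 : component G v R ∪ sourceSide G {v} S ⊆
      ShadowRemoval.component G v (component G v R ∪ sourceSide G {v} S) := by
    rw [h4]
    exact component_union_component
  exact (Set.subset_union_left.trans h5).trans h3

/-- An important separator that leaves `T` on the side of `v` also leaves there, or contains, all
vertices of the farthest minimum separator. -/
theorem IsFarthest.boundary_subset [Finite V] (h : IsFarthest G v W T R)
    (hT : Anchored G v W T) (hS : IsImportantSeparator G {v} W S) (hTS : T ⊆ sourceSide G {v} S) :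
    boundary G R ⊆ sourceSide G {v} S ∪ S := by
  rw [← h.boundary_component hT]
  rintro x ⟨-, u, hu, hux⟩
  have hu' := h.component_subset hT hS hTS hu
  by_cases hx : x ∈ S
  · exact Or.inr hx
  · exact Or.inl (mem_sourceSide.2 ((mem_sourceSide.1 hu').concat hux hx))

/-- The new connected set is the component of `R` together with `D`, whose vertices are adjacent to
that component. A side containing `T ∪ D` absorbs it at no cost by submodularity, its intersection
with the component having at least the minimum boundary. -/
theorem IsFarthest.anchored_union [Finite V] (h : IsFarthest G v W T R)
    (hT : Anchored G v W T) (hD : D ⊆ boundary G R) : Anchored G v W (T ∪ D) := by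
  have hTC := h.subset_component hT
  have hb := h.boundary_component hT
  refine ⟨component G v R ∪ D, Set.union_subset_union_left D hTC, ?_, fun R' hR' hTR' => ?_⟩
  · rintro u (hu | hu)
    · rw [← component_component] at hu
      exact component_mono Set.subset_union_left hu
    · obtain ⟨-, y, hy, hyu⟩ := hb.symm ▸ hD hu
      rw [← component_component] at hy
      have hy' := component_mono (G := G) (v := v)
        (Set.subset_union_left (s := component G v R) (t := D)) hy
      exact mem_component.2 ((mem_component.1 hy').concat hyu (by simp [hu]))
  · obtain ⟨h1, h2⟩ := Set.union_subset_iff.1 hTR'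
    have : R' ∪ (component G v R ∪ D) = R' ∪ component G v R := by
      rw [← Set.union_assoc]
      exact Set.union_eq_self_of_subset_right (h2.trans Set.subset_union_left)
    rw [this]
    refine ⟨hR'.union h.isSide.component, ?_⟩
    have h3 := ncard_boundary_submodular (G := G) R' (component G v R)
    have h4 := h.ncard_le _ (hR'.inter h.isSide.component) (Set.subset_inter h1 hTC)
    rw [hb] at h3
    lia

/-- A side with no larger boundary would lie in `R`, whereas `D` lies outside. This strict increase
bounds the number of extensions. -/
theorem IsFarthest.ncard_lt (h : IsFarthest G v W T R) (hD : D ⊆ boundary G R) (hne : D.Nonempty)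
    (hR' : IsSide G v W R') (hTR' : T ∪ D ⊆ R') :
    (boundary G R).ncard < (boundary G R').ncard := by
  by_contra hc
  obtain ⟨x, hx⟩ := hne
  exact (hD hx).1 (h.le R' hR' (Set.subset_union_left.trans hTR') (not_lt.1 hc)
    (hTR' (Or.inr hx)))

/-- If no important separator of size at most `k` is contained in `Y`, then few vertices outside
`Y` hit all of them. -/
theorem exists_hitting_set [Finite V] {Y : Set V} {k : ℕ}
    (hY : ∀ X, IsImportantSeparator G {v} W X → X.ncard ≤ k → ¬ X ⊆ Y) :
    ∃ H : Finset V, H.card ≤ k + 1 ∧ Disjoint (H : Set V) Y ∧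
      ∀ X, IsImportantSeparator G {v} W X → X.ncard ≤ k → ∃ x ∈ H, x ∈ X := by
  classical
  -- Induction on the amount `m` by which the minimum boundary may still grow before it exceeds `k`.
  suffices key : ∀ m T, Anchored G v W T →
      (∀ R, IsSide G v W R → T ⊆ R → k + 1 ≤ (boundary G R).ncard + m) →
      ∃ H : Finset V, H.card ≤ m ∧ Disjoint (H : Set V) Y ∧
        ∀ X, IsImportantSeparator G {v} W X → X.ncard ≤ k → T ⊆ sourceSide G {v} X →
          ∃ x ∈ H, x ∈ X by
    obtain ⟨H, h1, h2, h3⟩ := key (k + 1) {v} anchored_singleton fun _ _ _ => by lia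
    refine ⟨H, h1, h2, fun X hX hXk => h3 X hX hXk ?_⟩
    rintro _ rfl
    exact hX.1.1.isSide.mem
  intro m
  induction m with
  | zero =>
    refine fun T _ h => ⟨∅, by simp, by simp, fun X hX hXk hTX => ?_⟩
    have := h _ hX.1.1.isSide hTX
    rw [hX.1.boundary_sourceSide] at this
    lia
  | succ m ih =>
    intro T hT h
    by_cases hR : ∃ R, IsFarthest G v W T R ∧ (boundary G R).ncard ≤ k
    · obtain ⟨R, hR, hRk⟩ := hR
      -- The farthest minimum separator is important, so it has a vertex `x` outside `Y`. Separators
      -- containing `x` are hit; the others have `x` on the source side and are left to the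
      -- induction with `x` added to `T`.
      obtain ⟨x, hxR, hxY⟩ := Set.not_subset.1 (hY _ (hR.isImportantSeparator hT) hRk)
      have hx : {x} ⊆ boundary G R := Set.singleton_subset_iff.2 hxR
      obtain ⟨H, h1, h2, h3⟩ := ih (T ∪ {x}) (hR.anchored_union hT hx) fun R' hR' hTR' => by
        have := hR.ncard_lt hx (Set.singleton_nonempty x) hR' hTR'
        have := h R hR.isSide hR.subset
        lia
      refine ⟨insert x H, (Finset.card_insert_le x H).trans (by lia), ?_, fun X hX hXk hTX => ?_⟩
      · rw [Finset.coe_insert, Set.disjoint_insert_left]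
        exact ⟨hxY, h2⟩
      · rcases hR.boundary_subset hT hX hTX hxR with hx' | hx'
        · obtain ⟨y, hy, hyX⟩ := h3 X hX hXk
            (Set.union_subset hTX (Set.singleton_subset_iff.2 hx'))
          exact ⟨y, Finset.mem_insert_of_mem hy, hyX⟩
        · exact ⟨x, Finset.mem_insert_self x H, hx'⟩
    · refine ⟨∅, by simp, by simp, fun X hX hXk hTX => ?_⟩
      obtain ⟨R, hF⟩ := hX.1.1.isSide.exists_isFarthest hTX
      have := hF.ncard_le _ hX.1.1.isSide hTX
      rw [hX.1.boundary_sourceSide] at this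
      exact absurd ⟨R, hF, by lia⟩ hR

end Graph

end ShadowRemoval

/-! ### Cuts and residual capacities. -/

namespace ShadowRemoval

open Classical in
/-- The capacity of the arcs that leave `U`, for capacities `r` on the nodes `0, …, N - 1`. -/
noncomputable def cut (N : ℕ) (r : ℕ → ℕ → ℕ) (U : Set ℕ) : ℕ :=
  ∑ p ∈ Finset.range N ×ˢ Finset.range N, if p.1 ∈ U ∧ p.2 ∉ U then r p.1 p.2 else 0

section Cut

variable {N : ℕ} {r c δ : ℕ → ℕ → ℕ} {U : Set ℕ}

theorem cut_add : cut N (fun a b => r a b + δ a b) U = cut N r U + cut N δ U := by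
  rw [cut, cut, cut, ← Finset.sum_add_distrib]
  refine Finset.sum_congr rfl fun p _ => ?_
  split_ifs <;> rfl

theorem cut_congr (h : ∀ a < N, ∀ b < N, r a b = c a b) : cut N r U = cut N c U := by
  refine Finset.sum_congr rfl fun p hp => ?_
  simp only [Finset.mem_product, Finset.mem_range] at hp
  rw [h _ hp.1 _ hp.2]

theorem le_cut {a b : ℕ} (ha : a < N) (hb : b < N) (haU : a ∈ U) (hbU : b ∉ U) :
    r a b ≤ cut N r U := by
  classical
  have := Finset.single_le_sum (f := fun p : ℕ × ℕ => if p.1 ∈ U ∧ p.2 ∉ U then r p.1 p.2 else 0)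
    (fun _ _ => Nat.zero_le _)
    (Finset.mk_mem_product (Finset.mem_range.2 ha) (Finset.mem_range.2 hb))
  simp only [haU, hbU, not_false_eq_true, and_self, if_true] at this
  refine this.trans_eq ?_
  rw [cut]

/-- Residual cuts of value zero are the node sets closed under residual arcs. -/
theorem cut_eq_zero_iff :
    cut N r U = 0 ↔ ∀ a < N, ∀ b < N, a ∈ U → r a b ≠ 0 → b ∈ U := by
  constructor
  · intro h a ha b hb haU hr
    by_contra hbU
    have := le_cut (r := r) ha hb haU hbU
    lia
  · intro h
    refine Finset.sum_eq_zero fun p hp => ?_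
    simp only [Finset.mem_product, Finset.mem_range] at hp
    split_ifs with hU
    · by_contra hr
      exact hU.2 (h _ hp.1 _ hp.2 hU.1 hr)
    · rfl

open Classical in
theorem cut_update {r' : ℕ → ℕ → ℕ} {a b : ℕ} (ha : a < N) (hb : b < N)
    (h : ∀ x < N, ∀ y < N, ¬ (x = a ∧ y = b) → r' x y = r x y) :
    cut N r' U + (if a ∈ U ∧ b ∉ U then r a b else 0) =
      cut N r U + (if a ∈ U ∧ b ∉ U then r' a b else 0) := by
  have hab : (a, b) ∈ Finset.range N ×ˢ Finset.range N :=
    Finset.mk_mem_product (Finset.mem_range.2 ha) (Finset.mem_range.2 hb)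
  rw [cut, cut, ← Finset.add_sum_erase _ _ hab, ← Finset.add_sum_erase _ _ hab]
  have : ∑ p ∈ (Finset.range N ×ˢ Finset.range N).erase (a, b),
      (if p.1 ∈ U ∧ p.2 ∉ U then r' p.1 p.2 else 0) =
      ∑ p ∈ (Finset.range N ×ˢ Finset.range N).erase (a, b),
      (if p.1 ∈ U ∧ p.2 ∉ U then r p.1 p.2 else 0) := by
    refine Finset.sum_congr rfl fun p hp => ?_
    simp only [Finset.mem_erase, Finset.mem_product, Finset.mem_range] at hp
    rw [h _ hp.2.1 _ hp.2.2 fun he => hp.1 (Prod.ext he.1 he.2)]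
  rw [this]
  lia

/-- Sending a unit along one arc. -/
theorem cut_push {r' : ℕ → ℕ → ℕ} {a b : ℕ} (ha : a < N) (hb : b < N) (hab : a ≠ b)
    (h : ∀ x < N, ∀ y < N, ¬ (x = a ∧ y = b) → ¬ (x = b ∧ y = a) → r' x y = r x y)
    (h1 : r' a b + 1 = r a b) (h2 : r' b a = r b a + 1) [DecidablePred (· ∈ U)] :
    cut N r' U + (if a ∈ U then 1 else 0) = cut N r U + (if b ∈ U then 1 else 0) := by
  classical
  -- The two opposite arcs are changed one at a time, through an intermediate capacity function.
  have e1 := cut_update (U := U) (r := r)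
    (r' := fun x y => if x = a ∧ y = b then r' a b else r x y) ha hb
    fun x _ y _ hxy => if_neg hxy
  have e2 := cut_update (U := U) (r := fun x y => if x = a ∧ y = b then r' a b else r x y)
    (r' := r') hb ha fun x hx y hy hxy => by
      by_cases h' : x = a ∧ y = b
      · rw [if_pos h', h'.1, h'.2]
      · rw [if_neg h', h x hx y hy h' hxy]
  have h3 : ¬ (b = a ∧ a = b) := fun h => hab h.2
  simp only [and_self, if_true, h3, if_false] at e1 e2
  by_cases haU : a ∈ U <;> by_cases hbU : b ∈ U <;> simp [haU, hbU] at e1 e2 ⊢ <;> lia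

end Cut

/-! ### Separators as cuts, and the search for an important separator inside a set. -/

section Network

variable {n : ℕ} {G : SimpleGraph (Fin n)} {W A T R : Set (Fin n)} {k : ℕ} {v : Fin n}
  {c r r' : ℕ → ℕ → ℕ} {val it : ℕ} {U : Set ℕ}

open Classical in
/-- The capacities of the network in which cuts correspond to separators. Vertex `x` becomes an
arc of capacity `1` from node `x` to node `n + x`; the sink is `2 * n`. -/
noncomputable def baseCap (G : SimpleGraph (Fin n)) (W : Set (Fin n)) (k a b : ℕ) : ℕ :=
  if a < n then
    if b = n + a then 1 else if b = n + n ∧ ∃ w ∈ W, a = (w : ℕ) then k + 1 else 0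
  else if b < n ∧ (a = n + b ∨ ∃ x y, G.Adj x y ∧ a = n + x ∧ b = y) then k + 1 else 0

/-- `c` is the base network with arcs from the source to the vertices of `T` added. -/
structure IsNet (G : SimpleGraph (Fin n)) (W : Set (Fin n)) (k : ℕ) (v : Fin n) (T : Set (Fin n))
    (c : ℕ → ℕ → ℕ) : Prop where
  base_le : ∀ a b, baseCap G W k a b ≤ c a b
  le : ∀ x ∈ T, x ≠ v → k + 1 ≤ c (n + v) (n + x)
  eq : ∀ a b, ¬ (a = n + v ∧ ∃ x ∈ T, b = n + x) → c a b = baseCap G W k a b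

theorem baseCap_arc (x : Fin n) : baseCap G W k x (n + x) = 1 := by
  simp [baseCap]

theorem baseCap_self (x : Fin n) : baseCap G W k (n + x) x = k + 1 := by
  simp [baseCap]

theorem baseCap_adj {x y : Fin n} (h : G.Adj x y) : baseCap G W k (n + x) y = k + 1 := by
  rw [baseCap, if_neg (by lia), if_pos ⟨y.2, Or.inr ⟨x, y, h, rfl, rfl⟩⟩]

theorem baseCap_sink {w : Fin n} (h : w ∈ W) : baseCap G W k w (n + n) = k + 1 := by
  rw [baseCap, if_pos w.2, if_neg (by lia), if_pos ⟨rfl, w, h, rfl⟩]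

/-- Capacity `k + 1` acts as infinity for cuts of value at most `k`. -/
theorem IsNet.mem_of_cut_le (hc : IsNet G W k v T c) (hU : cut (2 * n + 1) c U ≤ k) {a b : ℕ}
    (ha : a < 2 * n + 1) (hb : b < 2 * n + 1) (haU : a ∈ U) (h : baseCap G W k a b = k + 1) :
    b ∈ U := by
  by_contra hbU
  have h1 := le_cut (r := c) ha hb haU hbU
  have h2 := hc.base_le a b
  lia

/-- A small cut gives a separator. -/
theorem IsNet.isSide (hc : IsNet G W k v T c) (hs : n + v ∈ U) (ht : 2 * n ∉ U)
    (hU : cut (2 * n + 1) c U ≤ k) :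
    IsSide G v W {x | n + (x : ℕ) ∈ U} ∧ T ⊆ {x | n + (x : ℕ) ∈ U} ∧
      boundary G {x | n + (x : ℕ) ∈ U} ⊆ {x | (x : ℕ) ∈ U ∧ n + (x : ℕ) ∉ U} ∧
      {x : Fin n | (x : ℕ) ∈ U ∧ n + (x : ℕ) ∉ U}.ncard ≤ cut (2 * n + 1) c U := by
  classical
  have hW : ∀ w ∈ W, (w : ℕ) ∉ U := fun w hw hwU => ht (by
    rw [two_mul]
    exact hc.mem_of_cut_le hU (by lia) (by lia) hwU (baseCap_sink hw))
  have hself : ∀ x : Fin n, n + (x : ℕ) ∈ U → (x : ℕ) ∈ U := fun x hx =>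
    hc.mem_of_cut_le hU (by lia) (by lia) hx (baseCap_self x)
  have hb : boundary G {x | n + (x : ℕ) ∈ U} ⊆ {x | (x : ℕ) ∈ U ∧ n + (x : ℕ) ∉ U} := by
    rintro x ⟨hx, u, hu, hux⟩
    exact ⟨hc.mem_of_cut_le hU (by lia) (by lia) hu (baseCap_adj hux), hx⟩
  refine ⟨⟨hs, ?_, ?_⟩, ?_, hb, ?_⟩
  · exact Set.disjoint_left.2 fun w hw hwW => hW w hwW (hself w hw)
  · exact Set.disjoint_left.2 fun w hw hwW => hW w hwW (hb hw).1
  · intro x hx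
    by_cases hxv : x = v
    · rw [hxv]; exact hs
    · by_contra hxU
      have h1 := le_cut (N := 2 * n + 1) (r := c) (by lia) (by lia) hs hxU
      have h2 := hc.le x hx hxv
      lia
  · rw [Set.ncard_eq_toFinset_card', cut]
    -- Every such vertex contributes its own splitting arc, of capacity at least `1`.
    calc _ = ∑ p ∈ ({x : Fin n | (x : ℕ) ∈ U ∧ n + (x : ℕ) ∉ U} : Set (Fin n)).toFinset.image
          (fun x : Fin n => ((x : ℕ), n + (x : ℕ))), 1 := by
          rw [Finset.sum_const, smul_eq_mul, mul_one, Finset.card_image_of_injective]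
          intro x y hxy
          exact Fin.ext (Prod.ext_iff.1 hxy).1
      _ ≤ ∑ p ∈ ({x : Fin n | (x : ℕ) ∈ U ∧ n + (x : ℕ) ∉ U} : Set (Fin n)).toFinset.image
          (fun x : Fin n => ((x : ℕ), n + (x : ℕ))),
            if p.1 ∈ U ∧ p.2 ∉ U then c p.1 p.2 else 0 := by
          refine Finset.sum_le_sum fun p hp => ?_
          simp only [Finset.mem_image, Set.mem_toFinset, Set.mem_ofPred_eq] at hp
          obtain ⟨x, hx, rfl⟩ := hp
          rw [if_pos hx, ← baseCap_arc (G := G) (W := W) (k := k) x]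
          exact hc.base_le _ _
      _ ≤ _ := by
          refine Finset.sum_le_sum_of_subset fun p hp => ?_
          simp only [Finset.mem_image, Set.mem_toFinset, Set.mem_ofPred_eq] at hp
          obtain ⟨x, hx, rfl⟩ := hp
          simp only [Finset.mem_product, Finset.mem_range]
          lia

/-- A separator gives a small cut. -/
theorem IsNet.exists_cut (hc : IsNet G W k v T c) (hR : IsSide G v W R) (hTR : T ⊆ R) :
    ∃ U : Set ℕ, n + (v : ℕ) ∈ U ∧ 2 * n ∉ U ∧ (∀ x : Fin n, n + (x : ℕ) ∈ U ↔ x ∈ R) ∧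
      cut (2 * n + 1) c U ≤ (boundary G R).ncard := by
  classical
  -- The cut consists of the out-nodes of `R` and the in-nodes of `R` and its boundary. Only the
  -- splitting arcs of boundary vertices leave it; the extra arcs from the source end in `T ⊆ R`.
  have hout : ∀ x : Fin n, n + (x : ℕ) ∈ {a : ℕ | ∃ x : Fin n, (a = n + x ∧ x ∈ R) ∨
      (a = x ∧ (x ∈ R ∨ x ∈ boundary G R))} ↔ x ∈ R := by
    intro x
    constructor
    · rintro ⟨y, ⟨hy, hyR⟩ | ⟨hy, -⟩⟩
      · have : x = y := Fin.ext (by lia)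
        rwa [this]
      · lia
    · exact fun hx => ⟨x, Or.inl ⟨rfl, hx⟩⟩
  have hin : ∀ x : Fin n, (x : ℕ) ∈ {a : ℕ | ∃ x : Fin n, (a = n + x ∧ x ∈ R) ∨
      (a = x ∧ (x ∈ R ∨ x ∈ boundary G R))} ↔ x ∈ R ∨ x ∈ boundary G R := by
    intro x
    constructor
    · rintro ⟨y, ⟨hy, -⟩ | ⟨hy, hyR⟩⟩
      · lia
      · rwa [Fin.ext hy]
    · exact fun hx => ⟨x, Or.inr ⟨rfl, hx⟩⟩
  refine ⟨_, (hout v).2 hR.mem, ?_, hout, ?_⟩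
  · rintro ⟨x, ⟨hx, -⟩ | ⟨hx, -⟩⟩ <;> lia
  generalize {a : ℕ | ∃ x : Fin n, (a = n + x ∧ x ∈ R) ∨
      (a = x ∧ (x ∈ R ∨ x ∈ boundary G R))} = U at hout hin
  rw [Set.ncard_eq_toFinset_card', cut]
  calc _ ≤ ∑ p ∈ Finset.range (2 * n + 1) ×ˢ Finset.range (2 * n + 1),
        if p ∈ (boundary G R).toFinset.image (fun x : Fin n => ((x : ℕ), n + (x : ℕ)))
        then 1 else 0 := by
        refine Finset.sum_le_sum fun p _ => ?_
        split_ifs with h1 h2 h2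
        · simp only [Finset.mem_image, Set.mem_toFinset] at h2
          obtain ⟨x, hx, rfl⟩ := h2
          rw [hc.eq _ _ fun h => by have := h.1; lia, baseCap_arc]
        · rw [nonpos_iff_eq_zero]
          obtain ⟨a, b⟩ := p
          simp only at h1 h2 ⊢
          rw [hc.eq a b (by
            rintro ⟨-, x, hx, rfl⟩
            exact h1.2 ((hout x).2 (hTR hx)))]
          unfold baseCap
          split_ifs with h3 h4 h5 h5
          · exfalso
            refine h2 (Finset.mem_image.2 ⟨⟨a, h3⟩, ?_, by simp [h4]⟩)
            have h6 := (hin ⟨a, h3⟩).1 h1.1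
            rw [Set.mem_toFinset]
            refine h6.resolve_left fun h7 => h1.2 ?_
            rw [h4]
            exact (hout ⟨a, h3⟩).2 h7
          · exfalso
            obtain ⟨-, w, hw, rfl⟩ := h5
            rcases (hin w).1 h1.1 with h6 | h6
            · exact Set.disjoint_left.1 hR.disjoint h6 hw
            · exact Set.disjoint_left.1 hR.disjoint_boundary h6 hw
          · rfl
          · exfalso
            rcases h5 with ⟨hb, rfl | ⟨x, y, hxy, rfl, rfl⟩⟩
            · exact h1.2 ((hin ⟨b, hb⟩).2 (Or.inl ((hout ⟨b, hb⟩).1 h1.1)))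
            · refine h1.2 ((hin y).2 ?_)
              by_cases hy : y ∈ R
              · exact Or.inl hy
              · exact Or.inr ⟨hy, x, (hout x).1 h1.1, hxy⟩
          · rfl
        · exact Nat.zero_le _
        · exact le_rfl
    _ = ((Finset.range (2 * n + 1) ×ˢ Finset.range (2 * n + 1)).filter
        (· ∈ (boundary G R).toFinset.image (fun x : Fin n => ((x : ℕ), n + (x : ℕ))))).card := by
        rw [Finset.card_filter]
    _ ≤ ((boundary G R).toFinset.image (fun x : Fin n => ((x : ℕ), n + (x : ℕ)))).card := by
        refine Finset.card_le_card fun p hp => (Finset.mem_filter.1 hp).2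
    _ ≤ _ := Finset.card_image_le

/-- `r` is what a flow of value `val` leaves of the capacities `c`. -/
def IsResidual (v : Fin n) (c r : ℕ → ℕ → ℕ) (val : ℕ) : Prop :=
  ∀ U : Set ℕ, n + (v : ℕ) ∈ U → 2 * n ∉ U →
    cut (2 * n + 1) r U + val = cut (2 * n + 1) c U

/-- The farthest cut without residual capacity is the farthest minimum separator. -/
theorem IsNet.isFarthest (hc : IsNet G W k v T c) (hr : IsResidual v c r val) (hval : val ≤ k)
    (hs : n + (v : ℕ) ∈ U) (ht : 2 * n ∉ U) (h0 : cut (2 * n + 1) r U = 0)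
    (hmax : ∀ U' : Set ℕ, n + (v : ℕ) ∈ U' → 2 * n ∉ U' → cut (2 * n + 1) r U' = 0 →
      ∀ a < 2 * n + 1, a ∈ U' → a ∈ U) :
    IsFarthest G v W T {x | n + (x : ℕ) ∈ U} ∧
      boundary G {x | n + (x : ℕ) ∈ U} = {x : Fin n | (x : ℕ) ∈ U ∧ n + (x : ℕ) ∉ U} ∧
      (boundary G {x | n + (x : ℕ) ∈ U}).ncard = val := by
  have hcut : cut (2 * n + 1) c U = val := by
    have := hr U hs ht
    lia
  obtain ⟨h1, h2, h3, h4⟩ := hc.isSide hs ht (by lia)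
  -- Weak duality: a side smaller than `val` would give a cut of negative residual capacity.
  have h5 : ∀ R, IsSide G v W R → T ⊆ R → val ≤ (boundary G R).ncard := by
    intro R hR hTR
    obtain ⟨U', hU1, hU2, -, hU4⟩ := hc.exists_cut hR hTR
    have := hr U' hU1 hU2
    lia
  have h6 := h5 _ h1 h2
  have h7 := Set.ncard_le_ncard h3
  refine ⟨⟨h1, h2, fun R hR hTR => (by lia : _ ≤ val).trans (h5 R hR hTR), ?_⟩,
    Set.eq_of_subset_of_ncard_le h3 (by lia), by lia⟩
  intro R hR hTR hcard x hx
  obtain ⟨U', hU1, hU2, hU3, hU4⟩ := hc.exists_cut hR hTR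
  have := hr U' hU1 hU2
  exact hmax U' hU1 hU2 (by lia) (n + x) (by lia) ((hU3 x).2 hx)

/-- Some important separator of size at most `k` is contained in `A`. -/
def Captured (G : SimpleGraph (Fin n)) (W : Set (Fin n)) (k : ℕ) (A : Set (Fin n)) (v : Fin n) :
    Prop :=
  ∃ X, IsImportantSeparator G {v} W X ∧ X.ncard ≤ k ∧ X ⊆ A

/-- What is known after `it` rounds of the search for an important separator inside `A`: `stat` is
`1` if there is one, `2` if there is none, and `0` if this is not decided yet. -/
structure Search (G : SimpleGraph (Fin n)) (W : Set (Fin n)) (k : ℕ) (A : Set (Fin n)) (v : Fin n)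
    (it : ℕ) (r : ℕ → ℕ → ℕ) (val stat : ℕ) : Prop where
  one : stat = 1 → Captured G W k A v
  two : stat ≠ 0 → stat ≠ 1 → ¬ Captured G W k A v
  zero : stat = 0 → val ≤ k ∧ ∃ T c, v ∈ T ∧ Anchored G v W T ∧
    (∀ X, IsImportantSeparator G {v} W X → X.ncard ≤ k → X ⊆ A → T ⊆ sourceSide G {v} X) ∧
    IsNet G W k v T c ∧ IsResidual v c r val ∧
    (it ≤ 2 * val ∨ it ≤ 2 * val + 1 ∧
      ∀ U : Set ℕ, n + (v : ℕ) ∈ U → 2 * n ∉ U → cut (2 * n + 1) r U ≠ 0)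

theorem Search.start (h : ∀ a < 2 * n + 1, ∀ b < 2 * n + 1, r a b = baseCap G W k a b) :
    Search G W k A v 0 r 0 0 where
  one h := absurd h (by simp)
  two h := absurd rfl h
  zero _ := by
    refine ⟨Nat.zero_le _, {v}, baseCap G W k, rfl, anchored_singleton, ?_, ⟨fun _ _ => le_rfl,
      fun x hx hxv => absurd hx hxv, fun _ _ _ => rfl⟩, fun U _ _ => cut_congr h, Or.inl le_rfl⟩
    rintro X hX - - _ rfl
    exact hX.1.1.isSide.mem

theorem Search.skip {stat : ℕ} (h : Search G W k A v it r val stat) (hstat : stat ≠ 0)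
    {r' : ℕ → ℕ → ℕ} {val' it' : ℕ} : Search G W k A v it' r' val' stat :=
  ⟨h.one, h.two, fun h => absurd h hstat⟩

/-- Once the flow value exceeds `k`, a captured separator would yield a cut too small for it, so the
answer is negative. -/
theorem Search.augment (h : Search G W k A v it r val 0)
    (hr' : ∀ U : Set ℕ, n + (v : ℕ) ∈ U → 2 * n ∉ U →
      cut (2 * n + 1) r' U + 1 = cut (2 * n + 1) r U) :
    Search G W k A v (it + 1) r' (val + 1) (if k < val + 1 then 2 else 0) := by
  obtain ⟨hval, T, c, hvT, hT, hTX, hc, hr, hit⟩ := h.zero rfl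
  have hres : IsResidual v c r' (val + 1) := fun U hs ht => by
    have := hr U hs ht
    have := hr' U hs ht
    lia
  refine ⟨fun h => ?_, fun h h' => ?_, fun h => ?_⟩
  · split_ifs at h
    simp at h
  · have hk : k < val + 1 := by
      by_contra hk
      exact h (if_neg hk)
    rintro ⟨X, hX, hXk, hXA⟩
    obtain ⟨U, hU1, hU2, -, hU4⟩ := hc.exists_cut hX.1.1.isSide (hTX X hX hXk hXA)
    rw [hX.1.boundary_sourceSide] at hU4
    have := hres U hU1 hU2
    lia
  · have hk : ¬ k < val + 1 := fun hk => by simp [hk] at h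
    exact ⟨by lia, T, c, hvT, hT, hTX, hc, hres, Or.inl (by lia)⟩

/-- The farthest minimum separator is important, and here it lies entirely in `A`. -/
theorem Search.succeed (h : Search G W k A v it r val 0)
    (hs : n + (v : ℕ) ∈ U) (ht : 2 * n ∉ U) (h0 : cut (2 * n + 1) r U = 0)
    (hmax : ∀ U' : Set ℕ, n + (v : ℕ) ∈ U' → 2 * n ∉ U' → cut (2 * n + 1) r U' = 0 →
      ∀ a < 2 * n + 1, a ∈ U' → a ∈ U)
    (hA : ∀ x : Fin n, (x : ℕ) ∈ U → n + (x : ℕ) ∉ U → x ∈ A) {it' : ℕ} :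
    Search G W k A v it' r val 1 := by
  obtain ⟨hval, T, c, hvT, hT, hTX, hc, hr, hit⟩ := h.zero rfl
  obtain ⟨h1, h2, h3⟩ := hc.isFarthest hr hval hs ht h0 hmax
  refine ⟨fun _ => ⟨_, h1.isImportantSeparator hT, by lia, ?_⟩, fun _ h => absurd rfl h,
    fun h => absurd h (by simp)⟩
  rw [h2]
  exact fun x hx => hA x hx.1 hx.2

/-- The vertices of `D` lie on the farthest minimum separator but not in `A`, so every important
separator that still counts has them on its source side. They join `T`, and the new arcs are added
to capacities and residual capacities alike. -/
theorem Search.extend (h : Search G W k A v it r val 0)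
    (hs : n + (v : ℕ) ∈ U) (ht : 2 * n ∉ U) (h0 : cut (2 * n + 1) r U = 0)
    (hmax : ∀ U' : Set ℕ, n + (v : ℕ) ∈ U' → 2 * n ∉ U' → cut (2 * n + 1) r U' = 0 →
      ∀ a < 2 * n + 1, a ∈ U' → a ∈ U) {D : Set (Fin n)}
    (hD : ∀ x : Fin n, x ∈ D ↔ (x : ℕ) ∈ U ∧ n + (x : ℕ) ∉ U ∧ x ∉ A) (hne : D.Nonempty)
    {δ : ℕ → ℕ → ℕ} (hδ : ∀ x ∈ D, δ (n + v) (n + x) = k + 1)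
    (hδ0 : ∀ a b, ¬ (a = n + v ∧ ∃ x ∈ D, b = n + x) → δ a b = 0)
    (hr' : ∀ a < 2 * n + 1, ∀ b < 2 * n + 1, r' a b = r a b + δ a b) :
    Search G W k A v (it + 1) r' val 0 := by
  obtain ⟨hval, T, c, hvT, hT, hTX, hc, hr, hit⟩ := h.zero rfl
  obtain ⟨h1, h2, h3⟩ := hc.isFarthest hr hval hs ht h0 hmax
  have hDb : D ⊆ boundary G {x | n + (x : ℕ) ∈ U} := fun x hx => by
    rw [h2]
    exact ⟨((hD x).1 hx).1, ((hD x).1 hx).2.1⟩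
  have hcut : ∀ U', cut (2 * n + 1) r' U' = cut (2 * n + 1) r U' + cut (2 * n + 1) δ U' :=
    fun U' => by rw [cut_congr hr', cut_add]
  refine ⟨fun h => absurd h (by simp), fun h => absurd rfl h, fun _ => ⟨hval, T ∪ D,
    fun a b => c a b + δ a b, Or.inl hvT, h1.anchored_union hT hDb, ?_, ⟨?_, ?_, ?_⟩, ?_, ?_⟩⟩
  · intro X hX hXk hXA
    refine Set.union_subset (hTX X hX hXk hXA) fun x hx => ?_
    refine (h1.boundary_subset hT hX (hTX X hX hXk hXA) (hDb hx)).resolve_right fun hxX => ?_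
    exact ((hD x).1 hx).2.2 (hXA hxX)
  · exact fun a b => (hc.base_le a b).trans (Nat.le_add_right _ _)
  · rintro x (hx | hx) hxv
    · exact (hc.le x hx hxv).trans (Nat.le_add_right _ _)
    · have := hδ x hx
      lia
  · intro a b hab
    have h4 := hδ0 a b fun ⟨h5, x, hx, h6⟩ => hab ⟨h5, x, Or.inr hx, h6⟩
    have h5 := hc.eq a b fun ⟨h5, x, hx, h6⟩ => hab ⟨h5, x, Or.inl hx, h6⟩
    lia
  · intro U' hs' ht'
    have := hr U' hs' ht'
    rw [hcut, cut_add]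
    lia
  -- A cut with zero residual capacity after the extension had it before, so it lay inside `U` and
  -- omits the out-node of any `x ∈ D`; but the new arc to that node crosses it. The next round must
  -- therefore augment.
  · refine Or.inr ⟨?_, fun U' hs' ht' h' => ?_⟩
    · rcases hit with hit | hit
      · lia
      · exact absurd h0 (hit.2 U hs ht)
    · obtain ⟨x, hx⟩ := hne
      rw [hcut] at h'
      have h4 : n + (x : ℕ) ∉ U' := fun hx' =>
        ((hD x).1 hx).2.1 (hmax U' hs' ht' (by lia) _ (by lia) hx')
      have h5 := le_cut (N := 2 * n + 1) (r := δ) (by lia) (by lia) hs' h4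
      rw [hδ x hx] at h5
      lia

/-- Two extensions never occur without an augmentation between them, so an undecided search has made
at most `2 * val + 1 ≤ 2 * k + 1` rounds. -/
theorem Search.finish {stat : ℕ} (h : Search G W k A v (2 * k + 2) r val stat) :
    stat = 1 ↔ Captured G W k A v := by
  refine ⟨h.one, fun h' => ?_⟩
  by_contra h1
  rcases Nat.eq_zero_or_pos stat with h0 | h0
  · obtain ⟨hval, -, -, -, -, -, -, -, hit⟩ := h.zero h0
    lia
  · exact h.two (by lia) h1 h'

end Network

end ShadowRemoval

/-! ### Breadth-first search backwards from the sink. -/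

namespace ShadowRemoval

open RAM RAM.Cmd

/-! The registers and arrays of the algorithm.

Registers: `0`: `n`; `1`: `k`; `2`: the number `N = 2 * n + 1` of nodes; `3`: the number `M` of
colours; `5`: the number of colourings; `6`: `M ^ k`; `8`: `2 * k + 2`; `19`: a vertex `v`; `20`: the
node `n + v`; `21`, `22`: value and status of the search; the others are auxiliary.

Arrays: `0`: output; `1`: `W`; `2`: adjacency matrix; `3`: weights; `4`: colouring; `5`: weights of
the colours; `6`: selected colours; `7`: multiples of `N`; `8`: multiples of `n`; `9`: residual
capacities; `10`: marks; `11`: next nodes; `12`: queue. -/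

/-- The command that does nothing of interest. -/
def skip : Cmd := .assign 40 (.const 0)

/-- Marks the unmarked nodes with an arc to the node in register `27`, and appends them to the
queue. -/
def visit : Cmd :=
  .rep 25 2 (.cond (.get 10 (.reg 25)) skip
    (.cond (.get 9 (.add (.get 7 (.reg 25)) (.reg 27)))
      (.seq (.store 12 (.reg 26) (.reg 25)) <|
       .seq (.store 11 (.reg 25) (.reg 27)) <|
       .seq (.assign 26 (.add (.reg 26) (.const 1)))
         (.store 10 (.reg 25) (.reg 26)))
      skip))

/-- Marks the nodes from which the sink can be reached. -/
def scan : Cmd :=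
  .seq (.rep 25 2 (.store 10 (.reg 25) (.const 0))) <|
  .seq (.store 10 (.add (.reg 0) (.reg 0)) (.const 1)) <|
  .seq (.store 12 (.const 0) (.add (.reg 0) (.reg 0))) <|
  .seq (.assign 26 (.const 1)) <|
  .rep 24 2 (.cond (.sub (.reg 26) (.reg 24))
    (.seq (.assign 27 (.get 12 (.reg 24))) visit) skip)

/-- `B a` is `0` or one more than the position of `a` in the queue `q`, and `nxt` leads along arcs
of `r` to the sink `t`. -/
structure IsQueue (N t : ℕ) (r : ℕ → ℕ → ℕ) (B nxt q : ℕ → ℕ) (tail : ℕ) : Prop where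
  root : B t ≠ 0
  mem : ∀ p < tail, q p < N ∧ B (q p) = p + 1
  rank : ∀ a < N, B a ≠ 0 → B a ≤ tail ∧ q (B a - 1) = a
  next : ∀ a < N, B a ≠ 0 → a = t ∨ nxt a < N ∧ B (nxt a) ≠ 0 ∧ B (nxt a) < B a ∧ r a (nxt a) ≠ 0

/-- Queue entries are distinct because the marks recover their positions. Hence `N` rounds of the
outer loop empty the queue. -/
theorem IsQueue.tail_le {N t : ℕ} {r : ℕ → ℕ → ℕ} {B nxt q : ℕ → ℕ} {tail : ℕ}
    (h : IsQueue N t r B nxt q tail) : tail ≤ N := by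
  have := Finset.card_le_card_of_injOn (s := Finset.range tail) (t := Finset.range N) q
    (fun p hp => by simpa using (h.mem p (by simpa using hp)).1) (fun p hp p' hp' he => by
      have h1 := (h.mem p (by simpa using hp)).2
      have h2 := (h.mem p' (by simpa using hp')).2
      rw [he] at h1
      lia)
  simpa using this

/-- The new mark exceeds all earlier ones, so marks still decrease along `nxt`. -/
theorem IsQueue.push {N t : ℕ} {r : ℕ → ℕ → ℕ} {B nxt q : ℕ → ℕ} {tail a y : ℕ}
    (h : IsQueue N t r B nxt q tail) (ha : a < N) (hBa : B a = 0) (hy : y < N) (hBy : B y ≠ 0)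
    (hr : r a y ≠ 0) :
    IsQueue N t r (Function.update B a (tail + 1)) (Function.update nxt a y)
      (Function.update q tail a) (tail + 1) := by
  refine ⟨?_, fun p hp => ?_, fun b hb hBb => ?_, fun b hb hBb => ?_⟩
  · rw [Function.update_apply]
    split_ifs
    · lia
    · exact h.root
  · rcases Nat.lt_succ_iff_lt_or_eq.1 hp with hp | rfl
    · have h1 := h.mem p hp
      have h2 : q p ≠ a := fun h2 => by rw [h2] at h1; lia
      rw [Function.update_of_ne hp.ne, Function.update_of_ne h2]
      exact h1
    · simp [ha]
  · by_cases hba : b = a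
    · subst hba
      simp
    · rw [Function.update_of_ne hba] at hBb ⊢
      have := h.rank b hb hBb
      rw [Function.update_of_ne (by lia)]
      exact ⟨by lia, this.2⟩
  · by_cases hba : b = a
    · subst hba
      have hyb : y ≠ b := fun h => hBy (h ▸ hBa)
      have := (h.rank y hy hBy).1
      simp only [Function.update_self, Function.update_of_ne hyb]
      exact Or.inr ⟨hy, hBy, by lia, hr⟩
    · rw [Function.update_of_ne hba] at hBb
      simp only [Function.update_of_ne hba]
      refine (h.next b hb hBb).imp_right fun h1 => ?_
      have h2 : nxt b ≠ a := fun h2 => by rw [h2] at h1; exact h1.2.1 hBa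
      rw [Function.update_of_ne h2]
      exact h1

/-- The marks `B` are on the nodes from which `t` can be reached along arcs of `r`. -/
structure IsScan (N t : ℕ) (r : ℕ → ℕ → ℕ) (B nxt : ℕ → ℕ) : Prop where
  root : B t ≠ 0
  closed : ∀ a < N, ∀ b < N, B b ≠ 0 → r a b ≠ 0 → B a ≠ 0
  le : ∀ a < N, B a ≤ N
  next : ∀ a < N, B a ≠ 0 → a = t ∨ nxt a < N ∧ B (nxt a) ≠ 0 ∧ B (nxt a) < B a ∧ r a (nxt a) ≠ 0

theorem isQueue_visit {s : State} {t N y i : ℕ} {r : ℕ → ℕ → ℕ} (hN : s.reg 2 = N)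
    (hrow : ∀ a < N, s.arr 7 a = a * N) (hr : ∀ a b, s.arr 9 (a * N + b) = r a b)
    (hy : s.reg 27 = y) (hi : i < s.reg 26) (hyi : s.arr 12 i = y)
    (hQ : IsQueue N t r (s.arr 10) (s.arr 11) (s.arr 12) (s.reg 26)) :
    IsQueue N t r ((visit.run s).arr 10) ((visit.run s).arr 11) ((visit.run s).arr 12)
      ((visit.run s).reg 26) ∧
    s.reg 26 ≤ (visit.run s).reg 26 ∧
    (∀ p < s.reg 26, (visit.run s).arr 12 p = s.arr 12 p) ∧
    (∀ a, s.arr 10 a ≠ 0 → (visit.run s).arr 10 a ≠ 0) ∧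
    ∀ a < N, r a y ≠ 0 → (visit.run s).arr 10 a ≠ 0 := by
  have key := run_rep (s := s) (i := 25) (x := 2) (c := .cond (.get 10 (.reg 25)) skip
    (.cond (.get 9 (.add (.get 7 (.reg 25)) (.reg 27)))
      (.seq (.store 12 (.reg 26) (.reg 25)) <|
       .seq (.store 11 (.reg 25) (.reg 27)) <|
       .seq (.assign 26 (.add (.reg 26) (.const 1)))
         (.store 10 (.reg 25) (.reg 26)))
      skip))
    (fun j u => IsQueue N t r (u.arr 10) (u.arr 11) (u.arr 12) (u.reg 26) ∧
      s.reg 26 ≤ u.reg 26 ∧ (∀ p < s.reg 26, u.arr 12 p = s.arr 12 p) ∧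
      (∀ a, s.arr 10 a ≠ 0 → u.arr 10 a ≠ 0) ∧ ∀ a < j, r a y ≠ 0 → u.arr 10 a ≠ 0)
    (by decide) ?_ ?_
  · rwa [hN] at key
  · simpa using hQ
  · rintro j u hj huj hu ⟨h1, h2, h3, h4, h5⟩
    rw [hN] at hj
    have e27 : u.reg 27 = y := (hu.reg 27 (by decide)).trans hy
    have e7 : u.arr 7 j = j * N := by rw [hu.arr 7 (by decide), hrow j hj]
    have e9 : u.arr 9 (j * N + y) = r j y := by rw [hu.arr 9 (by decide), hr]
    have hyN : y < N ∧ s.arr 10 y ≠ 0 := by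
      have := hQ.mem i hi
      rw [hyi] at this
      lia
    by_cases hB : u.arr 10 j = 0
    · by_cases hrj : r j y = 0
      · simp only [run_assign, run_store, run_seq, run_cond, skip, Expr.eval, huj, e27, e7, e9, hB, hrj, ne_eq, not_true_eq_false,
          if_false, State.arr_setReg, State.reg_setReg]
        refine ⟨h1, h2, h3, h4, fun a ha har => ?_⟩
        rcases Nat.lt_succ_iff_lt_or_eq.1 ha with ha | rfl
        · exact h5 a ha har
        · exact absurd hrj har
      · have h6 := h1.push hj hB hyN.1 (h4 y hyN.2) hrj
        simp only [run_assign, run_store, run_seq, run_cond, Expr.eval, huj, e27, e7, e9, hB, hrj, ne_eq, not_true_eq_false,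
          not_false_eq_true, if_false, if_true, State.arr_setReg, State.reg_setReg,
          State.arr_setArr, State.reg_setArr, Nat.reduceEqDiff]
        refine ⟨h6, by lia, fun p hp => ?_, fun a ha => ?_, fun a ha har => ?_⟩
        · rw [Function.update_of_ne (by lia), h3 p hp]
        · rw [Function.update_apply]
          split_ifs
          · lia
          · exact h4 a ha
        · rw [Function.update_apply]
          split_ifs
          · lia
          · exact h5 a (by lia) har
    · simp only [run_assign, run_store, run_seq, run_cond, skip, Expr.eval, huj, hB, ne_eq, not_false_eq_true, if_true,
        State.arr_setReg, State.reg_setReg]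
      refine ⟨h1, h2, h3, h4, fun a ha har => ?_⟩
      rcases Nat.lt_succ_iff_lt_or_eq.1 ha with ha | rfl
      · exact h5 a ha har
      · exact hB

theorem isScan_scan {s : State} {n N : ℕ} (hn : s.reg 0 = n) (hN : s.reg 2 = N) (ht : n + n < N)
    (hrow : ∀ a < N, s.arr 7 a = a * N) :
    IsScan N (n + n) (fun a b => s.arr 9 (a * N + b)) ((scan.run s).arr 10)
      ((scan.run s).arr 11) := by
  set r : ℕ → ℕ → ℕ := fun a b => s.arr 9 (a * N + b) with hr
  rw [scan, run_seq]
  set s₁ := (rep 25 2 (.store 10 (.reg 25) (.const 0))).run s with hs₁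
  have e₁ := run_same (rep 25 2 (.store 10 (.reg 25) (.const 0))) s
  rw [← hs₁] at e₁
  have h₁ : ∀ a < N, s₁.arr 10 a = 0 := by
    rw [← hN]
    refine run_rep (fun j t => ∀ a < j, t.arr 10 a = 0) (by decide) (by simp) ?_
    intro j t hj hi _ hP a ha
    simp only [run_store, Expr.eval, State.arr_setReg, State.arr_setArr, hi, if_true]
    rw [Function.update_apply]
    split_ifs
    · rfl
    · exact hP a (by lia)
  have hn₁ : s₁.reg 0 = n := (e₁.reg 0 (by decide)).trans hn
  have hN₁ : s₁.reg 2 = N := (e₁.reg 2 (by decide)).trans hN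
  have h7₁ : s₁.arr 7 = s.arr 7 := e₁.arr 7 (by decide)
  have h9₁ : s₁.arr 9 = s.arr 9 := e₁.arr 9 (by decide)
  simp only [run_assign, run_store, run_seq, Expr.eval, hn₁, State.reg_setArr]
  generalize hs₂ : State.setReg _ 26 1 = s₂
  have hN₂ : s₂.reg 2 = N := by simp [← hs₂, hN₁]
  have h7₂ : s₂.arr 7 = s.arr 7 := by simp [← hs₂, h7₁]
  have h9₂ : s₂.arr 9 = s.arr 9 := by simp [← hs₂, h9₁]
  have h26 : s₂.reg 26 = 1 := by simp [← hs₂]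
  have h12 : s₂.arr 12 0 = n + n := by simp [← hs₂]
  have h10 : ∀ a < N, s₂.arr 10 a = if a = n + n then 1 else 0 := by
    intro a ha
    simp [← hs₂, Function.update_apply, h₁ a ha]
  have key := run_rep (s := s₂) (i := 24) (x := 2) (c := .cond (.sub (.reg 26) (.reg 24))
    (.seq (.assign 27 (.get 12 (.reg 24))) visit) skip)
    -- All in-neighbours of the first `i` queue entries are marked; rounds past the end of the queue
    -- do nothing.
    (fun i u => IsQueue N (n + n) r (u.arr 10) (u.arr 11) (u.arr 12) (u.reg 26) ∧
      ∀ p < i, p < u.reg 26 → ∀ a < N, r a (u.arr 12 p) ≠ 0 → u.arr 10 a ≠ 0)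
    (by decide) ?_ ?_
  · rw [hN₂] at key
    generalize (rep 24 2 _).run s₂ = u at key ⊢
    obtain ⟨h2, h3⟩ := key
    refine ⟨h2.root, fun a ha b hb hBb hrab => ?_, fun a ha => ?_, h2.next⟩
    · have h4 := h2.rank b hb hBb
      have h5 := h2.tail_le
      refine h3 (u.arr 10 b - 1) (by lia) (by lia) a ha ?_
      rw [h4.2]
      exact hrab
    · rcases Nat.eq_zero_or_pos (u.arr 10 a) with h4 | h4
      · rw [h4]; exact Nat.zero_le _
      · exact (h2.rank a ha h4.ne').1.trans h2.tail_le
  · simp only [State.arr_setReg, State.reg_setReg, Nat.reduceEqDiff, if_false, h26]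
    refine ⟨⟨?_, ?_, ?_, ?_⟩, by simp⟩
    · simp [h10 _ ht]
    · intro p hp
      obtain rfl : p = 0 := by lia
      rw [h12, h10 _ ht]
      simp [ht]
    · intro a ha
      rw [h10 a ha]
      split_ifs with h
      · simp [h, h12]
      · simp
    · intro a ha
      rw [h10 a ha]
      split_ifs with h
      · simp [h]
      · simp
  · rintro i u hi hui hu ⟨h2, h3⟩
    simp only [run_assign, run_seq, run_cond, Expr.eval, hui]
    have h7 : u.arr 7 = s.arr 7 := (hu.arr 7 (by decide)).trans h7₂
    have h9 : u.arr 9 = s.arr 9 := (hu.arr 9 (by decide)).trans h9₂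
    have hNu : u.reg 2 = N := (hu.reg 2 (by decide)).trans hN₂
    by_cases htail : i < u.reg 26
    · rw [if_pos (by lia)]
      have h4 := isQueue_visit (s := u.setReg 27 (u.arr 12 i)) (t := n + n) (i := i) (r := r)
        (by simpa using hNu) (by simpa [h7] using hrow) (by simp [h9, hr]) rfl (by simpa using htail)
        (by simp) (by simpa using h2)
      generalize visit.run (u.setReg 27 (u.arr 12 i)) = u' at h4 ⊢
      simp only [State.arr_setReg, State.reg_setReg, Nat.reduceEqDiff, if_false, if_true] at h4 ⊢
      obtain ⟨h5, h6, h7, h8, h9⟩ := h4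
      refine ⟨h5, fun p hp hp' a ha har => ?_⟩
      rcases Nat.lt_succ_iff_lt_or_eq.1 hp with hp | rfl
      · rw [h7 p (by lia)] at har
        exact h8 a (h3 p hp (by lia) a ha har)
      · rw [h7 p htail] at har
        exact h9 a ha har
    · rw [if_neg (by lia)]
      simp only [skip, run_assign,  State.arr_setReg, State.reg_setReg, Nat.reduceEqDiff, if_false]
      exact ⟨h2, fun p hp hp' => h3 p (by lia) hp'⟩

end ShadowRemoval

/-! ### Augmenting along a path. -/

namespace ShadowRemoval

open RAM RAM.Cmd

theorem mul_add_inj {N a b x y : ℕ} (hb : b < N) (hy : y < N) :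
    x * N + y = a * N + b ↔ x = a ∧ y = b := by
  refine ⟨fun h => ?_, by rintro ⟨rfl, rfl⟩; rfl⟩
  have h1 := congrArg (· / N) h
  have h2 := congrArg (· % N) h
  simp only [mul_comm _ N, Nat.mul_add_div (by lia : 0 < N), Nat.div_eq_of_lt hb,
    Nat.div_eq_of_lt hy, Nat.mul_add_mod, Nat.mod_eq_of_lt hb, Nat.mod_eq_of_lt hy] at h1 h2
  exact ⟨by lia, h2⟩

/-- Sends a unit along the marked path from the node in register `20`. -/
def augment : Cmd :=
  .seq (.assign 29 (.reg 20)) <|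
  .rep 28 2 (.cond (.sub (.add (.reg 0) (.reg 0)) (.reg 29))
    (.seq (.assign 30 (.get 11 (.reg 29))) <|
     .seq (.store 9 (.add (.get 7 (.reg 29)) (.reg 30))
       (.sub (.get 9 (.add (.get 7 (.reg 29)) (.reg 30))) (.const 1))) <|
     .seq (.store 9 (.add (.get 7 (.reg 30)) (.reg 29))
       (.add (.get 9 (.add (.get 7 (.reg 30)) (.reg 29))) (.const 1)))
     (.assign 29 (.reg 30)))
    skip)

/-- Pushing a unit along one arc changes a cut by the difference of the indicators of its ends, and
this telescopes along the path from the source, inside `U`, to the sink, outside. -/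
theorem cut_augment {s : State} {n N src : ℕ} (hn : s.reg 0 = n) (hN : s.reg 2 = N)
    (hNn : N = 2 * n + 1) (hrow : ∀ a < N, s.arr 7 a = a * N) (hsrc : s.reg 20 = src)
    (hsrcN : src < N) (hB : s.arr 10 src ≠ 0)
    (hscan : IsScan N (n + n) (fun a b => s.arr 9 (a * N + b)) (s.arr 10) (s.arr 11))
    (U : Set ℕ) (hsU : src ∈ U) (htU : 2 * n ∉ U) :
    cut N (fun a b => (augment.run s).arr 9 (a * N + b)) U + 1 =
      cut N (fun a b => s.arr 9 (a * N + b)) U := by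
  classical
  rw [augment, run_seq, run_assign]
  set s₁ := s.setReg 29 (Expr.eval s (.reg 20)) with hs₁
  have e29 : s₁.reg 29 = src := by simp [hs₁, Expr.eval, hsrc]
  have e9 : s₁.arr = s.arr := rfl
  have e0 : s₁.reg 0 = n := by simp [hs₁, hn]
  have e2 : s₁.reg 2 = N := by simp [hs₁, hN]
  have key := run_rep (s := s₁) (i := 28) (x := 2)
    (c := .cond (.sub (.add (.reg 0) (.reg 0)) (.reg 29))
      (.seq (.assign 30 (.get 11 (.reg 29))) <|
       .seq (.store 9 (.add (.get 7 (.reg 29)) (.reg 30))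
         (.sub (.get 9 (.add (.get 7 (.reg 29)) (.reg 30))) (.const 1))) <|
       .seq (.store 9 (.add (.get 7 (.reg 30)) (.reg 29))
         (.add (.get 9 (.add (.get 7 (.reg 30)) (.reg 29))) (.const 1)))
       (.assign 29 (.reg 30)))
      skip)
    -- Marks drop at every step, so `N` rounds reach the sink. Nodes with marks up to the current
    -- one have not lost outgoing capacity, so the next arc is still positive and the truncated
    -- subtraction of `1` is exact.
    (fun j u => u.reg 29 < N ∧ s.arr 10 (u.reg 29) ≠ 0 ∧
      (u.reg 29 = n + n ∨ s.arr 10 (u.reg 29) + j ≤ N) ∧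
      (∀ x < N, s.arr 10 x ≤ s.arr 10 (u.reg 29) → ∀ y < N,
        s.arr 9 (x * N + y) ≤ u.arr 9 (x * N + y)) ∧
      cut N (fun a b => u.arr 9 (a * N + b)) U + 1 =
        cut N (fun a b => s.arr 9 (a * N + b)) U + if u.reg 29 ∈ U then 1 else 0)
    (by decide) ?_ ?_
  · rw [e2] at key
    generalize (rep 28 2 _).run s₁ = u at key ⊢
    obtain ⟨h1, h2, h3, h4, h5⟩ := key
    have h6 : u.reg 29 = n + n := h3.resolve_right (by lia)
    rw [h6, ← two_mul, if_neg htU] at h5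
    exact h5
  · simp only [State.reg_setReg, State.arr_setReg, Nat.reduceEqDiff, if_false, e29, e9]
    exact ⟨hsrcN, hB, Or.inr (hscan.le _ hsrcN), fun _ _ _ _ _ => le_rfl, by rw [if_pos hsU]⟩
  · rintro j u hj huj hu ⟨h1, h2, h3, h4, h5⟩
    have e0u : u.reg 0 = n := (hu.reg 0 (by decide)).trans e0
    have e7u : ∀ a < N, u.arr 7 a = a * N := by rw [hu.arr 7 (by decide)]; exact hrow
    have e11u : u.arr 11 = s.arr 11 := hu.arr 11 (by decide)
    generalize ha : u.reg 29 = a at h1 h2 h3 h4 h5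
    by_cases hat : a = n + n
    · simp only [run_cond, skip, run_assign, Expr.eval, ha, e0u, hat, tsub_self, ne_eq,
        not_true_eq_false, if_false, State.reg_setReg, State.arr_setReg, Nat.reduceEqDiff]
      subst hat
      exact ⟨h1, h2, Or.inl trivial, h4, h5⟩
    · obtain ⟨h6, h7, h8, h9⟩ := (hscan.next a h1 h2).resolve_left hat
      generalize hb : s.arr 11 a = b at h6 h7 h8 h9
      have hab : a ≠ b := fun h => by rw [h] at h8; exact lt_irrefl _ h8
      have hidx : ∀ x < N, ∀ y < N, (x * N + y = a * N + b ↔ x = a ∧ y = b) ∧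
          (x * N + y = b * N + a ↔ x = b ∧ y = a) :=
        fun x _ y hy => ⟨mul_add_inj h6 hy, mul_add_inj h1 hy⟩
      have hlt : n + n - a ≠ 0 := by lia
      simp only [run_cond, run_seq, run_store, run_assign, Expr.eval, ha, e0u, hlt, ne_eq,
        not_false_eq_true, if_true, if_false, State.reg_setReg, State.arr_setReg, Nat.reduceEqDiff,
        State.reg_setArr, State.arr_setArr, e11u, hb, e7u a h1, e7u b h6]
      have hne : ¬ (b * N + a = a * N + b) := fun h => hab ((mul_add_inj h6 h1).1 h).2
      have h10 := h4 a h1 le_rfl b h6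
      refine ⟨h6, h7, Or.inr (by have := h3.resolve_left hat; lia), fun x hx hxb y hy => ?_, ?_⟩
      · have h11 := h4 x hx (by lia) y hy
        have h12 : ¬ (x * N + y = a * N + b) := fun h => by
          rw [((hidx x hx y hy).1.1 h).1] at hxb
          lia
        simp only [Function.update_apply, h12, if_false, hne]
        split_ifs with h13
        · rw [← h13]
          lia
        · exact h11
      · rw [Function.update_of_ne hne]
        have h11 := cut_push (U := U) (r := fun x y => u.arr 9 (x * N + y))
          (r' := fun x y => Function.update (Function.update (u.arr 9) (a * N + b)
            (u.arr 9 (a * N + b) - 1)) (b * N + a) (u.arr 9 (b * N + a) + 1) (x * N + y))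
          h1 h6 hab (fun x hx y hy hxy hyx => by
            rw [Function.update_of_ne (fun h => hyx ((hidx x hx y hy).2.1 h)),
              Function.update_of_ne (fun h => hxy ((hidx x hx y hy).1.1 h))])
          (by
            simp only [Function.update_of_ne (fun h => hne h.symm : ¬ (a * N + b = b * N + a)),
              Function.update_self]
            lia)
          (by simp only [Function.update_self])
        by_cases haU : a ∈ U <;> by_cases hbU : b ∈ U <;> simp only [haU, hbU, if_true, if_false]
          at h11 h5 ⊢ <;> lia

end ShadowRemoval

/-! ### The program for the search. -/

namespace ShadowRemoval

open RAM RAM.Cmd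

/-- The memory holds the input, and tables for computing indices. -/
structure Env {n : ℕ} (G : SimpleGraph (Fin n)) (W : Set (Fin n)) (k : ℕ) (s : State) : Prop where
  order : s.reg 0 = n
  budget : s.reg 1 = k
  nodes : s.reg 2 = 2 * n + 1
  rounds : s.reg 8 = 2 * k + 2
  row : ∀ a < 2 * n + 1, s.arr 7 a = a * (2 * n + 1)
  row' : ∀ a < n, s.arr 8 a = a * n
  terminals : ∀ x : Fin n, s.arr 1 x ≠ 0 ↔ x ∈ W
  adj : ∀ x y : Fin n, s.arr 2 (x * n + y) ≠ 0 ↔ G.Adj x y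

section

variable {n : ℕ} {G : SimpleGraph (Fin n)} {W : Set (Fin n)} {k : ℕ} {s t : State}

theorem Env.same (h : Env G W k s) {R A : List ℕ} (hst : Same R A s t)
    (hR : ∀ x ∈ [0, 1, 2, 8], x ∉ R) (hA : ∀ a ∈ [1, 2, 7, 8], a ∉ A) : Env G W k t where
  order := (hst.reg 0 (hR 0 (by simp))).trans h.order
  budget := (hst.reg 1 (hR 1 (by simp))).trans h.budget
  nodes := (hst.reg 2 (hR 2 (by simp))).trans h.nodes
  rounds := (hst.reg 8 (hR 8 (by simp))).trans h.rounds
  row := by rw [hst.arr 7 (hA 7 (by simp))]; exact h.row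
  row' := by rw [hst.arr 8 (hA 8 (by simp))]; exact h.row'
  terminals := by rw [hst.arr 1 (hA 1 (by simp))]; exact h.terminals
  adj := by rw [hst.arr 2 (hA 2 (by simp))]; exact h.adj

/-- Writes the capacity of one arc of the base network. -/
def capacity : Cmd :=
  .cond (.sub (.reg 0) (.reg 31))
    (.cond (.add (.sub (.reg 32) (.add (.reg 0) (.reg 31)))
        (.sub (.add (.reg 0) (.reg 31)) (.reg 32)))
      (.cond (.add (.sub (.reg 32) (.add (.reg 0) (.reg 0)))
          (.sub (.add (.reg 0) (.reg 0)) (.reg 32)))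
        (.assign 30 (.const 0))
        (.cond (.get 1 (.reg 31)) (.assign 30 (.add (.reg 1) (.const 1)))
          (.assign 30 (.const 0))))
      (.assign 30 (.const 1)))
    (.cond (.sub (.reg 0) (.reg 32))
      (.cond (.add (.sub (.reg 31) (.add (.reg 0) (.reg 32)))
          (.sub (.add (.reg 0) (.reg 32)) (.reg 31)))
        (.cond (.sub (.add (.reg 0) (.reg 0)) (.reg 31))
          (.cond (.get 2 (.add (.get 8 (.sub (.reg 31) (.reg 0))) (.reg 32)))
            (.assign 30 (.add (.reg 1) (.const 1))) (.assign 30 (.const 0)))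
          (.assign 30 (.const 0)))
        (.assign 30 (.add (.reg 1) (.const 1))))
      (.assign 30 (.const 0)))

theorem capacity_run (h : Env G W k s) {a b : ℕ} (ha : s.reg 31 = a) (hb : s.reg 32 = b) :
    (capacity.run s).reg 30 = baseCap G W k a b := by
  -- A sum of the two truncated differences is the machine's test for inequality.
  have hsub : ∀ x y : ℕ, (x - y) + (y - x) ≠ 0 ↔ x ≠ y := fun x y => by lia
  simp only [capacity, run_cond, run_assign, Expr.eval, ha, hb, h.order, h.budget, hsub]
  unfold baseCap
  by_cases han : a < n
  · rw [if_pos (by lia : n - a ≠ 0), if_pos han]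
    by_cases hb1 : b = n + a
    · simp [hb1]
    rw [if_pos hb1, if_neg hb1]
    by_cases hb2 : b = n + n
    · have := h.terminals ⟨a, han⟩
      simp only at this
      rw [if_neg (by lia)]
      by_cases hW : (⟨a, han⟩ : Fin n) ∈ W
      · rw [if_pos (this.2 hW), if_pos ⟨hb2, _, hW, rfl⟩]
        simp
      · rw [if_neg (fun h => hW (this.1 h)), if_neg]
        · simp
        · rintro ⟨-, w, hw, rfl⟩
          exact hW hw
    · rw [if_pos hb2, if_neg (fun h => hb2 h.1)]
      simp
  · rw [if_neg (by lia : ¬ n - a ≠ 0), if_neg han]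
    by_cases hbn : b < n
    · rw [if_pos (by lia : n - b ≠ 0)]
      by_cases hab : a = n + b
      · simp [hab, hbn]
      rw [if_pos hab]
      by_cases han' : a < n + n
      · rw [if_pos (by lia : n + n - a ≠ 0), h.row' _ (by lia)]
        have := h.adj ⟨a - n, by lia⟩ ⟨b, hbn⟩
        simp only at this
        by_cases hadj : G.Adj ⟨a - n, by lia⟩ ⟨b, hbn⟩
        · rw [if_pos (this.2 hadj), if_pos]
          · simp
          · exact ⟨hbn, Or.inr ⟨_, _, hadj, by simp; lia, rfl⟩⟩
        · rw [if_neg (fun h => hadj (this.1 h)), if_neg]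
          · simp
          · rintro ⟨-, h1 | ⟨x, y, hxy, rfl, rfl⟩⟩
            · exact hab h1
            · refine hadj ?_
              convert hxy
              simp
      · rw [if_neg (by lia : ¬ n + n - a ≠ 0), if_neg]
        · simp
        · rintro ⟨-, h1 | ⟨x, y, hxy, rfl, rfl⟩⟩
          · exact hab h1
          · exact han' (by lia)
    · rw [if_neg (by lia : ¬ n - b ≠ 0), if_neg (fun h => hbn h.1)]
      simp

/-- Writes the capacities of the base network. -/
def network : Cmd :=
  .rep 31 2 (.rep 32 2 (.seq capacity (.store 9 (.add (.get 7 (.reg 31)) (.reg 32)) (.reg 30))))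

theorem network_run (h : Env G W k s) {a b : ℕ} (ha : a < 2 * n + 1) (hb : b < 2 * n + 1) :
    (network.run s).arr 9 (a * (2 * n + 1) + b) = baseCap G W k a b := by
  have key := run_rep (s := s) (i := 31) (x := 2)
    (c := .rep 32 2 (.seq capacity (.store 9 (.add (.get 7 (.reg 31)) (.reg 32)) (.reg 30))))
    (fun i u => ∀ a < i, ∀ b < 2 * n + 1,
      u.arr 9 (a * (2 * n + 1) + b) = baseCap G W k a b) (by decide) (by simp) ?_
  · rw [h.nodes] at key
    exact key a ha b hb
  intro i u hi hui hu hP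
  have hEu : Env G W k u := h.same hu (by decide) (by decide)
  rw [h.nodes] at hi
  have key := run_rep (s := u) (i := 32) (x := 2)
    (c := .seq capacity (.store 9 (.add (.get 7 (.reg 31)) (.reg 32)) (.reg 30)))
    (fun j w => (∀ a < i, ∀ b < 2 * n + 1,
      w.arr 9 (a * (2 * n + 1) + b) = baseCap G W k a b) ∧
      ∀ b < j, w.arr 9 (i * (2 * n + 1) + b) = baseCap G W k i b) (by decide)
      ⟨by simpa using hP, by simp⟩ ?_
  · rw [hEu.nodes] at key
    intro a ha b hb
    rw [State.arr_setReg]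
    rcases Nat.lt_succ_iff_lt_or_eq.1 ha with ha | rfl
    · exact key.1 a ha b hb
    · exact key.2 b hb
  · rintro j w hj hwj hw ⟨h1, h2⟩
    rw [hEu.nodes] at hj
    have hEw : Env G W k w := hEu.same hw (by decide) (by decide)
    have hc := capacity_run hEw ((hw.reg 31 (by decide)).trans hui) hwj
    have hs := capacity.run_same w
    have hEc : Env G W k (capacity.run w) := hEw.same hs (by decide) (by decide)
    have e31 : (capacity.run w).reg 31 = i :=
      (hs.reg 31 (by decide)).trans ((hw.reg 31 (by decide)).trans hui)
    have e32 : (capacity.run w).reg 32 = j := (hs.reg 32 (by decide)).trans hwj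
    have e9 : (capacity.run w).arr 9 = w.arr 9 := hs.arr 9 (by decide)
    simp only [run_seq, run_store, Expr.eval, State.arr_setReg, State.arr_setArr, if_true, hc, e31,
      e32, e9, hEc.row i hi]
    refine ⟨fun a ha b hb => ?_, fun b hb => ?_⟩
    · rw [Function.update_of_ne, h1 a ha b hb]
      exact fun he => by
        have := ((mul_add_inj hj hb).1 he).1
        lia
    · rcases Nat.lt_succ_iff_lt_or_eq.1 hb with hb | rfl
      · rw [Function.update_of_ne (by lia), h2 b hb]
      · rw [Function.update_self]

/-- Adds arcs from the source to the vertices of the farthest minimum separator that are not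
selected. -/
def extend : Cmd :=
  .rep 34 0 (.cond (.get 10 (.reg 34)) skip (.cond (.get 10 (.add (.reg 0) (.reg 34)))
    (.cond (.get 6 (.get 4 (.reg 34))) skip
      (.seq (.store 9 (.add (.get 7 (.reg 20)) (.add (.reg 0) (.reg 34)))
        (.add (.get 9 (.add (.get 7 (.reg 20)) (.add (.reg 0) (.reg 34))))
          (.add (.reg 1) (.const 1)))) (.assign 23 (.const 1)))) skip))

/-- The vertices whose colours are selected. -/
def selected (n : ℕ) (s : State) : Set (Fin n) := {x | s.arr 6 (s.arr 4 x) ≠ 0}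

open Classical in
theorem extend_run (h : Env G W k s) {src : ℕ} (hsrc : s.reg 20 = src) (hsrcN : src < 2 * n + 1)
    (hflag : s.reg 23 = 0) {D : Set (Fin n)}
    (hD : ∀ x, x ∈ D ↔ s.arr 10 x = 0 ∧ s.arr 10 (n + x) ≠ 0 ∧ x ∉ selected n s) :
    ((extend.run s).reg 23 ≠ 0 ↔ D.Nonempty) ∧ ∀ a < 2 * n + 1, ∀ b < 2 * n + 1,
      (extend.run s).arr 9 (a * (2 * n + 1) + b) = s.arr 9 (a * (2 * n + 1) + b) +
        if a = src ∧ ∃ x ∈ D, b = n + x then k + 1 else 0 := by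
  have key := run_rep (s := s) (i := 34) (x := 0)
    (c := .cond (.get 10 (.reg 34)) skip (.cond (.get 10 (.add (.reg 0) (.reg 34)))
      (.cond (.get 6 (.get 4 (.reg 34))) skip
      (.seq (.store 9 (.add (.get 7 (.reg 20)) (.add (.reg 0) (.reg 34)))
        (.add (.get 9 (.add (.get 7 (.reg 20)) (.add (.reg 0) (.reg 34))))
          (.add (.reg 1) (.const 1)))) (.assign 23 (.const 1)))) skip))
    (fun j u => (u.reg 23 ≠ 0 ↔ ∃ x ∈ D, (x : ℕ) < j) ∧ ∀ a < 2 * n + 1, ∀ b < 2 * n + 1,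
      u.arr 9 (a * (2 * n + 1) + b) = s.arr 9 (a * (2 * n + 1) + b) +
        if a = src ∧ ∃ x ∈ D, (x : ℕ) < j ∧ b = n + x then k + 1 else 0) (by decide)
    (by simp [hflag]) ?_
  · rw [h.order] at key
    rw [extend]
    generalize (rep 34 0 _).run s = u' at key ⊢
    simpa [Set.Nonempty] using key
  · rintro j u hj huj hu ⟨h1, h2⟩
    rw [h.order] at hj
    have hE : Env G W k u := h.same hu (by decide) (by decide)
    have e20 : u.reg 20 = src := (hu.reg 20 (by decide)).trans hsrc
    have e10 : u.arr 10 = s.arr 10 := hu.arr 10 (by decide)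
    have e6 : u.arr 6 = s.arr 6 := hu.arr 6 (by decide)
    have e4 : u.arr 4 = s.arr 4 := hu.arr 4 (by decide)
    have hDj := hD ⟨j, hj⟩
    simp only [selected, Set.mem_ofPred_eq] at hDj
    by_cases hjD : (⟨j, hj⟩ : Fin n) ∈ D
    · obtain ⟨h3, h4, h5⟩ := hDj.1 hjD
      rw [not_not] at h5
      simp only [run_cond, run_seq, run_store, run_assign, Expr.eval, huj, e10, e6, e4, h3, h4, h5,
        ne_eq, not_true_eq_false, not_false_eq_true, if_true, if_false, hE.order, hE.budget, e20,
        hE.row src hsrcN, State.arr_setReg, State.arr_setArr, State.reg_setReg, Nat.reduceEqDiff,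
        one_ne_zero, true_iff]
      refine ⟨⟨_, hjD, Nat.lt_succ_self j⟩, fun a ha b hb => ?_⟩
      simp only [Function.update_apply, mul_add_inj (by lia : n + j < 2 * n + 1) hb]
      by_cases hab : a = src ∧ b = n + j
      · obtain ⟨rfl, rfl⟩ := hab
        rw [if_pos ⟨rfl, rfl⟩, h2 _ ha _ hb, if_neg, if_pos ⟨rfl, _, hjD, Nat.lt_succ_self j, rfl⟩]
        · lia
        · rintro ⟨-, x, -, hx, hx'⟩
          lia
      · rw [if_neg hab, h2 _ ha _ hb]
        congr 2
        refine propext (and_congr_right fun has => exists_congr fun x => and_congr_right fun hx =>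
          ⟨fun h => ⟨by lia, h.2⟩, fun h => ⟨?_, h.2⟩⟩)
        have : (x : ℕ) ≠ j := fun hxj => hab ⟨has, by rw [h.2, hxj]⟩
        lia
    · have hx : ∀ x ∈ D, (x : ℕ) < j + 1 ↔ (x : ℕ) < j := fun x hx => by
        have : (x : ℕ) ≠ j := fun hxj => hjD (by
          have : x = ⟨j, hj⟩ := Fin.ext hxj
          rwa [this] at hx)
        lia
      have h3 : ∀ u' : State, u'.arr = u.arr → u'.reg 23 = u.reg 23 →
          (u'.reg 23 ≠ 0 ↔ ∃ x ∈ D, (x : ℕ) < j + 1) ∧ ∀ a < 2 * n + 1, ∀ b < 2 * n + 1,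
          u'.arr 9 (a * (2 * n + 1) + b) = s.arr 9 (a * (2 * n + 1) + b) +
          if a = src ∧ ∃ x ∈ D, (x : ℕ) < j + 1 ∧ b = n + x then k + 1 else 0 := by
        intro u' e1 e2
        rw [e1, e2]
        refine ⟨h1.trans (exists_congr fun x => and_congr_right fun h => (hx x h).symm),
          fun a ha b hb => ?_⟩
        rw [h2 a ha b hb]
        congr 2
        refine propext (and_congr_right fun has => exists_congr fun x => and_congr_right fun h => ?_)
        rw [hx x h]
      refine h3 _ ?_ ?_
      all_goals
        simp only [run_cond, Expr.eval, huj, hE.order, e10, e6, e4]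
        split_ifs with h4 h5 h6
        · simp [skip, run_assign]
        · simp [skip, run_assign]
        · exact absurd (hDj.2 ⟨not_not.1 h4, h5, h6⟩) hjD
        · simp [skip, run_assign]

/-- One round of the search. -/
def round : Cmd :=
  .cond (.reg 22) skip (.seq scan (.cond (.get 10 (.reg 20))
    (.seq augment (.seq (.assign 21 (.add (.reg 21) (.const 1)))
      (.cond (.sub (.reg 21) (.reg 1)) (.assign 22 (.const 2)) skip)))
    (.seq (.assign 23 (.const 0)) (.seq extend (.cond (.reg 23) skip (.assign 22 (.const 1)))))))

/-- From a marked node, residual arcs with decreasing marks lead to the sink, so a cut closed under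
residual arcs has no marked node. The unmarked nodes thus form the largest zero cut. -/
theorem IsScan.mem_of_cut_eq_zero {N t : ℕ} {r : ℕ → ℕ → ℕ} {B nxt : ℕ → ℕ}
    (h : IsScan N t r B nxt) {U : Set ℕ} (ht : t ∉ U) (hU : cut N r U = 0) :
    ∀ a < N, a ∈ U → B a = 0 := by
  have key : ∀ m, ∀ a < N, B a = m → a ∈ U → B a = 0 := by
    intro m
    induction m using Nat.strong_induction_on with
    | _ m ih =>
      intro a ha hm haU
      by_contra hB
      rcases h.next a ha hB with rfl | ⟨h1, h2, h3, h4⟩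
      · exact ht haU
      · exact h2 (ih _ (hm ▸ h3) _ h1 rfl (cut_eq_zero_iff.1 hU a ha _ h1 haU h4))
  exact fun a ha haU => key _ a ha rfl haU

theorem search_round (h : Env G W k s) {v : Fin n} (hv : s.reg 20 = n + v) {it : ℕ}
    (hS : Search G W k (selected n s) v it (fun a b => s.arr 9 (a * (2 * n + 1) + b))
      (s.reg 21) (s.reg 22)) :
    Search G W k (selected n s) v (it + 1)
      (fun a b => (round.run s).arr 9 (a * (2 * n + 1) + b))
      ((round.run s).reg 21) ((round.run s).reg 22) := by
  classical
  rw [round, run_cond]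
  by_cases h22 : s.reg 22 = 0
  swap
  · rw [if_pos (by simpa [Expr.eval] using h22)]
    simp only [skip, run_assign, State.reg_setReg, State.arr_setReg, Nat.reduceEqDiff, if_false]
    exact hS.skip h22
  rw [if_neg (by simpa [Expr.eval] using h22), run_seq]
  have hscan := isScan_scan h.order h.nodes (by lia) h.row
  have hs := scan.run_same s
  generalize scan.run s = u at hscan hs ⊢
  have hE : Env G W k u := h.same hs (by decide) (by decide)
  have e20 : u.reg 20 = n + v := (hs.reg 20 (by decide)).trans hv
  have e21 : u.reg 21 = s.reg 21 := hs.reg 21 (by decide)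
  have e22 : u.reg 22 = 0 := (hs.reg 22 (by decide)).trans h22
  have e9 : u.arr 9 = s.arr 9 := hs.arr 9 (by decide)
  have e4 : u.arr 4 = s.arr 4 := hs.arr 4 (by decide)
  have e6 : u.arr 6 = s.arr 6 := hs.arr 6 (by decide)
  have hsel : selected n s = selected n u := by rw [selected, selected, e4, e6]
  rw [h22, ← e9, ← e21, hsel] at hS
  rw [hsel]
  rw [← e9] at hscan
  clear hsel e4 e6 e9 hs h22 hv h
  rw [run_cond]
  by_cases hB : u.arr 10 (n + v) = 0
  · rw [if_neg (by simpa [Expr.eval, e20] using hB)]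
    rw [run_seq, run_seq, run_assign]
    simp only [Expr.eval]
    have hE' : Env G W k (u.setReg 23 0) := hE.same
      ((Same.refl [23] [] u).setReg (by simp) 0) (by decide) (by decide)
    obtain ⟨h1, h2⟩ := extend_run hE' (src := n + v) (by simpa using e20) (by lia) (by simp)
      (D := {x | u.arr 10 x = 0 ∧ u.arr 10 (n + x) ≠ 0 ∧ x ∉ selected n u}) (fun x => Iff.rfl)
    have hs := extend.run_same (u.setReg 23 0)
    generalize extend.run (u.setReg 23 0) = w at h1 h2 hs ⊢
    have e21' : w.reg 21 = u.reg 21 := hs.reg 21 (by decide)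
    have e22' : w.reg 22 = 0 := (hs.reg 22 (by decide)).trans e22
    have hU : cut (2 * n + 1) (fun a b => u.arr 9 (a * (2 * n + 1) + b)) {a | u.arr 10 a = 0} = 0 :=
      cut_eq_zero_iff.2 fun a ha b hb haU hr => by
        by_contra hb'
        exact hscan.closed a ha b hb hb' hr haU
    have ht : 2 * n ∉ {a | u.arr 10 a = 0} := by
      rw [two_mul]
      exact hscan.root
    have hmax : ∀ U' : Set ℕ, n + (v : ℕ) ∈ U' → 2 * n ∉ U' →
        cut (2 * n + 1) (fun a b => u.arr 9 (a * (2 * n + 1) + b)) U' = 0 →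
        ∀ a < 2 * n + 1, a ∈ U' → a ∈ {a | u.arr 10 a = 0} := fun U' _ ht' h0 =>
      hscan.mem_of_cut_eq_zero (by rwa [← two_mul]) h0
    rw [run_cond]
    by_cases hw : w.reg 23 = 0
    · rw [if_neg (by simpa [Expr.eval] using hw)]
      have hD := Set.not_nonempty_iff_eq_empty.1 fun h => h1.2 h hw
      have hst := hS.succeed (U := {a | u.arr 10 a = 0}) hB ht hU hmax (fun x hx hx' => by
        by_contra hxA
        have : x ∈ (∅ : Set (Fin n)) := hD ▸ ⟨hx, hx', hxA⟩
        exact this) (it' := it + 1)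
      simp only [run_assign, Expr.eval, State.reg_setReg, State.arr_setReg, Nat.reduceEqDiff,
        if_false, if_true, e21']
      exact hst.skip one_ne_zero
    · rw [if_pos (by simpa [Expr.eval] using hw)]
      simp only [skip, run_assign, State.reg_setReg, State.arr_setReg, Nat.reduceEqDiff, if_false,
        e21', e22']
      refine hS.extend (U := {a | u.arr 10 a = 0}) hB ht hU hmax
        (D := {x | u.arr 10 x = 0 ∧ u.arr 10 (n + x) ≠ 0 ∧ x ∉ selected n u}) (fun x => Iff.rfl)
        (h1.1 hw) (δ := fun a b => if a = n + v ∧ ∃ x ∈ {x : Fin n | u.arr 10 x = 0 ∧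
          u.arr 10 (n + x) ≠ 0 ∧ x ∉ selected n u}, b = n + x then k + 1 else 0)
        (fun x hx => if_pos ⟨rfl, x, hx, rfl⟩) (fun a b hab => if_neg hab) ?_
      intro a ha b hb
      rw [State.arr_setReg] at h2
      convert h2 a ha b hb
  · rw [if_pos (by simpa [Expr.eval, e20] using hB), run_seq, run_seq]
    have h1 := cut_augment hE.order hE.nodes rfl hE.row e20 (by lia) hB hscan
    have hs := augment.run_same u
    generalize augment.run u = w at h1 hs ⊢
    have e21' : w.reg 21 = u.reg 21 := hs.reg 21 (by decide)
    have e22' : w.reg 22 = 0 := (hs.reg 22 (by decide)).trans e22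
    have e1 : w.reg 1 = k := (hs.reg 1 (by decide)).trans hE.budget
    have h2 := hS.augment h1
    by_cases hk : k < u.reg 21 + 1
    · rw [if_pos hk] at h2
      simp only [run_cond, run_assign, skip, Expr.eval, State.reg_setReg, Nat.reduceEqDiff,
        if_false, if_true, e21', e1, (by lia : u.reg 21 + 1 - k ≠ 0), ne_eq, not_false_eq_true,
        State.arr_setReg]
      exact h2
    · rw [if_neg hk] at h2
      simp only [run_cond, run_assign, skip, Expr.eval, State.reg_setReg, Nat.reduceEqDiff,
        if_false, if_true, e21', e1, (by lia : u.reg 21 + 1 - k = 0), ne_eq, not_true_eq_false,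
        State.arr_setReg, e22']
      exact h2

/-- Decides whether an important separator of size at most `k` between the vertex in register `19`
and `W` consists of selected vertices. -/
def search : Cmd :=
  .seq (.assign 20 (.add (.reg 0) (.reg 19))) <|
  .seq network <|
  .seq (.assign 21 (.const 0)) <|
  .seq (.assign 22 (.const 0)) (.rep 33 8 round)

theorem search_run (h : Env G W k s) {v : Fin n} (hv : s.reg 19 = v) :
    (search.run s).reg 22 = 1 ↔ Captured G W k (selected n s) v := by
  rw [search, run_seq, run_seq, run_seq, run_seq, run_assign, run_assign, run_assign]
  simp only [Expr.eval]
  have h1 : Same [20] [] s (s.setReg 20 (s.reg 0 + s.reg 19)) :=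
    (Same.refl [20] [] s).setReg (by simp) _
  have e20 : (s.setReg 20 (s.reg 0 + s.reg 19)).reg 20 = n + v := by simp [h.order, hv]
  generalize s.setReg 20 (s.reg 0 + s.reg 19) = s₁ at h1 e20 ⊢
  have hE₁ : Env G W k s₁ := h.same h1 (by decide) (by decide)
  have h2 := network.run_same s₁
  have h3 : ∀ a < 2 * n + 1, ∀ b < 2 * n + 1,
      (network.run s₁).arr 9 (a * (2 * n + 1) + b) = baseCap G W k a b :=
    fun a ha b hb => network_run hE₁ ha hb
  generalize network.run s₁ = s₂ at h2 h3 ⊢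
  have hE₂ : Env G W k s₂ := hE₁.same h2 (by decide) (by decide)
  have h4 : Same [21, 22] [] s₂ ((s₂.setReg 21 0).setReg 22 0) :=
    ((Same.refl _ _ _).setReg (by simp) _).setReg (by simp) _
  have e21 : ((s₂.setReg 21 0).setReg 22 0).reg 21 = 0 := by simp
  have e22 : ((s₂.setReg 21 0).setReg 22 0).reg 22 = 0 := by simp
  generalize (s₂.setReg 21 0).setReg 22 0 = s₃ at h4 e21 e22 ⊢
  have hE₃ : Env G W k s₃ := hE₂.same h4 (by decide) (by decide)
  have hsel : selected n s₃ = selected n s := by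
    rw [selected, selected, h4.arr 4 (by decide), h2.arr 4 (by decide), h1.arr 4 (by decide),
      h4.arr 6 (by decide), h2.arr 6 (by decide), h1.arr 6 (by decide)]
  have e20' : s₃.reg 20 = n + v :=
    (h4.reg 20 (by decide)).trans ((h2.reg 20 (by decide)).trans e20)
  have key := run_rep (s := s₃) (i := 33) (x := 8) (c := round)
    (fun it u => Search G W k (selected n s) v it (fun a b => u.arr 9 (a * (2 * n + 1) + b))
      (u.reg 21) (u.reg 22)) (by decide) ?_ ?_
  · rw [hE₃.rounds] at key
    exact key.finish
  · simp only [State.reg_setReg, State.arr_setReg, Nat.reduceEqDiff, if_false, e21, e22]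
    refine Search.start fun a ha b hb => ?_
    rw [h4.arr 9 (by decide)]
    exact h3 a ha b hb
  · intro it u _ _ hu hS
    have hsel' : selected n u = selected n s := by
      rw [← hsel, selected, selected, hu.arr 4 (by decide), hu.arr 6 (by decide)]
    rw [← hsel'] at hS ⊢
    simp only [State.reg_setReg, State.arr_setReg, Nat.reduceEqDiff, if_false]
    exact search_round (hE₃.same hu (by decide) (by decide))
      ((hu.reg 20 (by decide)).trans e20') hS

end

end ShadowRemoval

/-! ### Programs for greedy colourings and for selections of colours. -/

namespace ShadowRemoval

open RAM RAM.Cmd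

section

variable {n M : ℕ} {s : State}

/-- Adds up, for each colour, the weights of the pairs that the vertex in register `50` forms with
earlier vertices of this colour. -/
def tally : Cmd :=
  .seq (.rep 51 3 (.store 5 (.reg 51) (.const 0)))
    (.rep 51 0 (.cond (.sub (.reg 50) (.reg 51))
      (.store 5 (.get 4 (.reg 51)) (.add (.get 5 (.get 4 (.reg 51)))
        (.get 3 (.add (.get 8 (.reg 51)) (.reg 50))))) skip))

theorem tally_run (hn : s.reg 0 = n) (hM : s.reg 3 = M) (hrow : ∀ a < n, s.arr 8 a = a * n) {v : ℕ}
    (hv : s.reg 50 = v) (hvn : v < n) :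
    ∀ c < M, (tally.run s).arr 5 c =
      ∑ u ∈ Finset.range v, if s.arr 4 u = c then s.arr 3 (u * n + v) else 0 := by
  rw [tally, run_seq]
  have h1 : ∀ c < M, ((rep 51 3 (.store 5 (.reg 51) (.const 0))).run s).arr 5 c = 0 := by
    rw [← hM]
    refine run_rep (fun j t => ∀ a < j, t.arr 5 a = 0) (by decide) (by simp) ?_
    intro j t hj hi _ hP a ha
    simp only [run_store, Expr.eval, State.arr_setReg, State.arr_setArr, hi, if_true]
    rw [Function.update_apply]
    split_ifs
    · rfl
    · exact hP a (by lia)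
  have h2 := (rep 51 3 (.store 5 (.reg 51) (.const 0))).run_same s
  generalize (rep 51 3 (.store 5 (.reg 51) (.const 0))).run s = t at h1 h2 ⊢
  have key := run_rep (s := t) (i := 51) (x := 0) (c := .cond (.sub (.reg 50) (.reg 51))
      (.store 5 (.get 4 (.reg 51)) (.add (.get 5 (.get 4 (.reg 51)))
        (.get 3 (.add (.get 8 (.reg 51)) (.reg 50))))) skip)
    -- Only vertices before `v` count, so that each pair is weighed once, when its later vertex gets
    -- its colour.
    (fun j u => ∀ c < M, u.arr 5 c =
      ∑ u ∈ Finset.range (min j v), if s.arr 4 u = c then s.arr 3 (u * n + v) else 0)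
    (by decide) (by simpa using h1) ?_
  · rw [h2.reg 0 (by decide), hn, min_eq_right hvn.le] at key
    exact key
  · intro j u hj huj hu hP c hc
    rw [h2.reg 0 (by decide), hn] at hj
    have e50 : u.reg 50 = v := (hu.reg 50 (by decide)).trans ((h2.reg 50 (by decide)).trans hv)
    have e4 : u.arr 4 = s.arr 4 := (hu.arr 4 (by decide)).trans (h2.arr 4 (by decide))
    have e3 : u.arr 3 = s.arr 3 := (hu.arr 3 (by decide)).trans (h2.arr 3 (by decide))
    have e8 : u.arr 8 = s.arr 8 := (hu.arr 8 (by decide)).trans (h2.arr 8 (by decide))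
    simp only [run_cond, run_store, run_assign, skip, Expr.eval, huj, e50, e4, e3, e8, hrow j hj]
    by_cases hjv : j < v
    · rw [if_pos (by lia), min_eq_left (by lia), Finset.sum_range_succ]
      have := hP c hc
      rw [min_eq_left (by lia)] at this
      simp only [State.arr_setReg, State.arr_setArr, if_true, Function.update_apply, ← this]
      by_cases hjc : s.arr 4 j = c
      · simp [hjc]
      · rw [if_neg (fun h => hjc h.symm), if_neg hjc, add_zero]
    · rw [if_neg (by lia), min_eq_right (by lia)]
      have := hP c hc
      rw [min_eq_right (by lia)] at this
      exact this

/-- Gives the vertex in register `50` the cheapest colour. -/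
def choose : Cmd :=
  .seq (.assign 52 (.const 0)) <|
  .seq (.rep 51 3 (.cond (.sub (.get 5 (.reg 52)) (.get 5 (.reg 51))) (.assign 52 (.reg 51)) skip))
    (.store 4 (.reg 50) (.reg 52))

theorem choose_run (hM : s.reg 3 = M) (hpos : 0 < M) :
    ∃ b < M, (∀ c < M, s.arr 5 b ≤ s.arr 5 c) ∧
      (choose.run s).arr 4 = Function.update (s.arr 4) (s.reg 50) b := by
  rw [choose, run_seq, run_seq, run_assign, run_store]
  have h2 : Same [52] [] s (s.setReg 52 (Expr.eval s (.const 0))) :=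
    (Same.refl _ _ _).setReg (by simp) _
  have h52 : (s.setReg 52 (Expr.eval s (.const 0))).reg 52 = 0 := by simp [Expr.eval]
  generalize s.setReg 52 (Expr.eval s (.const 0)) = t at h2 h52 ⊢
  have hs := (rep 51 3 (.cond (.sub (.get 5 (.reg 52)) (.get 5 (.reg 51)))
    (.assign 52 (.reg 51)) skip)).run_same t
  have key := run_rep (s := t) (i := 51) (x := 3)
    (c := .cond (.sub (.get 5 (.reg 52)) (.get 5 (.reg 51))) (.assign 52 (.reg 51)) skip)
    (fun j u => u.reg 52 < M ∧ ∀ c < j, s.arr 5 (u.reg 52) ≤ s.arr 5 c) (by decide)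
    (by simpa [h52] using hpos) ?_
  · generalize (rep 51 3 _).run t = u at key hs ⊢
    rw [h2.reg 3 (by decide), hM] at key
    refine ⟨u.reg 52, key.1, key.2, ?_⟩
    have e50 : u.reg 50 = s.reg 50 := (hs.reg 50 (by decide)).trans (h2.reg 50 (by decide))
    have e4 : u.arr 4 = s.arr 4 := (hs.arr 4 (by decide)).trans (h2.arr 4 (by decide))
    simp only [Expr.eval, State.arr_setArr, if_true, e50, e4]
  · rintro j u hj huj hu ⟨h3, h4⟩
    rw [h2.reg 3 (by decide), hM] at hj
    have e5 : u.arr 5 = s.arr 5 := (hu.arr 5 (by decide)).trans (h2.arr 5 (by decide))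
    simp only [run_cond, run_assign, skip, Expr.eval, huj, e5]
    split_ifs with h5
    · simp only [State.reg_setReg, Nat.reduceEqDiff, if_false, if_true]
      refine ⟨hj, fun c hc => ?_⟩
      rcases Nat.lt_succ_iff_lt_or_eq.1 hc with hc | rfl
      · have := h4 c hc
        lia
      · exact le_rfl
    · simp only [State.reg_setReg, Nat.reduceEqDiff, if_false]
      refine ⟨h3, fun c hc => ?_⟩
      rcases Nat.lt_succ_iff_lt_or_eq.1 hc with hc | rfl
      · exact h4 c hc
      · lia

/-- Colours the vertices greedily, so that pairs of large weight get different colours. -/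
def color : Cmd := .rep 50 0 (.seq tally choose)

theorem color_run (hn : s.reg 0 = n) (hM : s.reg 3 = M) (hpos : 0 < M)
    (hrow : ∀ a < n, s.arr 8 a = a * n) :
    ∀ v < n, (color.run s).arr 4 v < M ∧
      M * (∑ u ∈ Finset.range v,
        if (color.run s).arr 4 u = (color.run s).arr 4 v then s.arr 3 (u * n + v) else 0) ≤
      ∑ u ∈ Finset.range v, s.arr 3 (u * n + v) := by
  have key := run_rep (s := s) (i := 50) (x := 0) (c := .seq tally choose)
    (fun j t => ∀ v < j, t.arr 4 v < M ∧
      M * (∑ u ∈ Finset.range v, if t.arr 4 u = t.arr 4 v then s.arr 3 (u * n + v) else 0) ≤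
      ∑ u ∈ Finset.range v, s.arr 3 (u * n + v)) (by decide) (by simp) ?_
  · rw [hn] at key
    exact key
  · intro j t hj htj ht hP v hv
    rw [hn] at hj
    have e0 : t.reg 0 = n := (ht.reg 0 (by decide)).trans hn
    have e3 : t.reg 3 = M := (ht.reg 3 (by decide)).trans hM
    have e8 : t.arr 8 = s.arr 8 := ht.arr 8 (by decide)
    have ea3 : t.arr 3 = s.arr 3 := ht.arr 3 (by decide)
    have h1 := tally_run e0 e3 (by rwa [e8]) htj hj
    have hs := tally.run_same t
    rw [State.arr_setReg, run_seq]
    generalize tally.run t = u at h1 hs ⊢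
    obtain ⟨b, hb, h2, h3⟩ := choose_run ((hs.reg 3 (by decide)).trans e3) hpos
    rw [h3, hs.reg 50 (by decide), htj, hs.arr 4 (by decide)]
    rcases Nat.lt_succ_iff_lt_or_eq.1 hv with hv | rfl
    · rw [Function.update_of_ne hv.ne]
      refine ⟨(hP v hv).1, (le_of_eq ?_).trans (hP v hv).2⟩
      congr 1
      refine Finset.sum_congr rfl fun x hx => ?_
      rw [Function.update_of_ne (by have := Finset.mem_range.1 hx; lia)]
    · rw [Function.update_self]
      refine ⟨hb, ?_⟩
      have h4 : (∑ x ∈ Finset.range v,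
          if Function.update (t.arr 4) v b x = b then s.arr 3 (x * n + v) else 0) = u.arr 5 b := by
        rw [h1 b hb, ea3]
        refine Finset.sum_congr rfl fun x hx => ?_
        rw [Function.update_of_ne (Finset.mem_range.1 hx).ne]
      rw [h4]
      -- The cheapest of `M` colours costs at most the average, and the costs of all colours add up
      -- to at most the total weight towards earlier vertices.
      calc M * u.arr 5 b = ∑ c ∈ Finset.range M, u.arr 5 b := by simp
        _ ≤ ∑ c ∈ Finset.range M, u.arr 5 c :=
          Finset.sum_le_sum fun c hc => h2 c (Finset.mem_range.1 hc)
        _ = ∑ c ∈ Finset.range M, ∑ x ∈ Finset.range v,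
            if t.arr 4 x = c then s.arr 3 (x * n + v) else 0 :=
          Finset.sum_congr rfl fun c hc => by rw [h1 c (Finset.mem_range.1 hc), ea3]
        _ = ∑ x ∈ Finset.range v, ∑ c ∈ Finset.range M,
            if t.arr 4 x = c then s.arr 3 (x * n + v) else 0 := Finset.sum_comm
        _ ≤ _ := Finset.sum_le_sum fun x hx => by
            rw [Finset.sum_ite_eq]
            split_ifs
            · exact le_rfl
            · exact Nat.zero_le _

/-- Doubles the weights of the pairs of vertices of the same colour. -/
def reweigh : Cmd :=
  .rep 50 0 (.rep 51 0 (.cond (.add (.sub (.get 4 (.reg 50)) (.get 4 (.reg 51)))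
    (.sub (.get 4 (.reg 51)) (.get 4 (.reg 50)))) skip
    (.store 3 (.add (.get 8 (.reg 50)) (.reg 51))
      (.add (.get 3 (.add (.get 8 (.reg 50)) (.reg 51)))
        (.get 3 (.add (.get 8 (.reg 50)) (.reg 51)))))))

theorem reweigh_run (hn : s.reg 0 = n) (hrow : ∀ a < n, s.arr 8 a = a * n) :
    ∀ u < n, ∀ v < n, (reweigh.run s).arr 3 (u * n + v) =
      if s.arr 4 u = s.arr 4 v then 2 * s.arr 3 (u * n + v) else s.arr 3 (u * n + v) := by
  have hsub : ∀ x y : ℕ, (x - y) + (y - x) ≠ 0 ↔ x ≠ y := fun x y => by lia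
  have key := run_rep (s := s) (i := 50) (x := 0)
    (c := .rep 51 0 (.cond (.add (.sub (.get 4 (.reg 50)) (.get 4 (.reg 51)))
    (.sub (.get 4 (.reg 51)) (.get 4 (.reg 50)))) skip
    (.store 3 (.add (.get 8 (.reg 50)) (.reg 51))
      (.add (.get 3 (.add (.get 8 (.reg 50)) (.reg 51)))
        (.get 3 (.add (.get 8 (.reg 50)) (.reg 51)))))))
    (fun j t => ∀ u < n, ∀ v < n, t.arr 3 (u * n + v) =
      if u < j ∧ s.arr 4 u = s.arr 4 v then 2 * s.arr 3 (u * n + v) else s.arr 3 (u * n + v))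
    (by decide) (by simp) ?_
  · rw [hn] at key
    intro u hu v hv
    simpa [hu, reweigh] using key u hu v hv
  · intro i t hi hti ht hP
    rw [hn] at hi
    have e0 : t.reg 0 = n := (ht.reg 0 (by decide)).trans hn
    have key := run_rep (s := t) (i := 51) (x := 0)
      (c := .cond (.add (.sub (.get 4 (.reg 50)) (.get 4 (.reg 51)))
      (.sub (.get 4 (.reg 51)) (.get 4 (.reg 50)))) skip
      (.store 3 (.add (.get 8 (.reg 50)) (.reg 51))
      (.add (.get 3 (.add (.get 8 (.reg 50)) (.reg 51)))
        (.get 3 (.add (.get 8 (.reg 50)) (.reg 51))))))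
      (fun j w => ∀ u < n, ∀ v < n, w.arr 3 (u * n + v) =
        if (u < i ∨ u = i ∧ v < j) ∧ s.arr 4 u = s.arr 4 v then 2 * s.arr 3 (u * n + v)
        else s.arr 3 (u * n + v)) (by decide) (by simpa using hP) ?_
    · rw [e0] at key
      intro u hu v hv
      rw [State.arr_setReg, key u hu v hv]
      congr 2
      refine propext ⟨fun h => by lia, fun h => by lia⟩
    · intro j w hj hwj hw hQ
      rw [e0] at hj
      have e50 : w.reg 50 = i := (hw.reg 50 (by decide)).trans hti
      have e4 : w.arr 4 = s.arr 4 := (hw.arr 4 (by decide)).trans (ht.arr 4 (by decide))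
      have e8 : w.arr 8 = s.arr 8 := (hw.arr 8 (by decide)).trans (ht.arr 8 (by decide))
      simp only [run_cond, run_store, run_assign, skip, Expr.eval, hwj, e50, e4, e8, hrow i hi, hsub]
      by_cases hij : s.arr 4 i = s.arr 4 j
      · rw [if_neg (not_not.2 hij)]
        intro u hu v hv
        simp only [State.arr_setReg, State.arr_setArr, if_true, Function.update_apply,
          mul_add_inj hj hv]
        by_cases huv : u = i ∧ v = j
        · obtain ⟨rfl, rfl⟩ := huv
          rw [if_pos ⟨rfl, rfl⟩, if_pos ⟨by lia, hij⟩, hQ u hu v hv, if_neg (by lia)]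
          lia
        · rw [if_neg huv, hQ u hu v hv]
          congr 2
          refine propext ⟨fun h => by lia, fun h => by lia⟩
      · rw [if_pos hij]
        intro u hu v hv
        simp only [State.arr_setReg]
        rw [hQ u hu v hv]
        by_cases huv : u = i ∧ v = j
        · obtain ⟨rfl, rfl⟩ := huv
          rw [if_neg (fun h => hij h.2), if_neg (fun h => hij h.2)]
        · congr 2
          refine propext ⟨fun h => by lia, fun h => by lia⟩

/-- Divides register `53` by register `3`; the quotient is left in register `55` and the remainder
in register `53`. -/
def divide : Cmd :=
  .seq (.assign 55 (.const 0)) <|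
    .rep 56 6 (.cond (.sub (.add (.reg 53) (.const 1)) (.reg 3))
      (.seq (.assign 53 (.sub (.reg 53) (.reg 3))) (.assign 55 (.add (.reg 55) (.const 1)))) skip)

theorem divide_run (hM : s.reg 3 = M) (hpos : 0 < M) {x : ℕ} (hx : s.reg 53 = x)
    (hxP : x < s.reg 6) :
    (divide.run s).reg 55 = x / M ∧ (divide.run s).reg 53 = x % M := by
  rw [divide, run_seq, run_assign]
  have h2 : Same [55] [] s (s.setReg 55 (Expr.eval s (.const 0))) :=
    (Same.refl _ _ _).setReg (by simp) _
  have h55 : (s.setReg 55 (Expr.eval s (.const 0))).reg 55 = 0 := by simp [Expr.eval]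
  generalize s.setReg 55 (Expr.eval s (.const 0)) = t at h2 h55 ⊢
  have key := run_rep (s := t) (i := 56) (x := 6)
    (c := .cond (.sub (.add (.reg 53) (.const 1)) (.reg 3))
      (.seq (.assign 53 (.sub (.reg 53) (.reg 3))) (.assign 55 (.add (.reg 55) (.const 1)))) skip)
    -- As long as the remainder is too large, the quotient counts the rounds; after `s.reg 6 > x`
    -- rounds this would make the quotient exceed `x`.
    (fun i u => u.reg 55 * M + u.reg 53 = x ∧ (u.reg 53 < M ∨ u.reg 55 = i)) (by decide)
    (by simp [h55, h2.reg 53 (by decide), hx]) ?_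
  · rw [h2.reg 6 (by decide)] at key
    generalize (rep 56 6 _).run t = u at key ⊢
    obtain ⟨h3, h4⟩ := key
    have h5 : u.reg 53 < M := h4.resolve_right fun h => by
      have := Nat.le_mul_of_pos_right (u.reg 55) hpos
      lia
    rw [← h3, mul_comm, Nat.mul_add_div hpos, Nat.div_eq_of_lt h5, Nat.mul_add_mod,
      Nat.mod_eq_of_lt h5]
    exact ⟨rfl, rfl⟩
  · rintro i u hi hui hu ⟨h3, h4⟩
    have e3 : u.reg 3 = M := (hu.reg 3 (by decide)).trans ((h2.reg 3 (by decide)).trans hM)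
    simp only [run_cond, run_seq, run_assign, skip, Expr.eval, e3]
    by_cases h5 : u.reg 53 < M
    · rw [if_neg (by lia)]
      simp only [State.reg_setReg, Nat.reduceEqDiff, if_false]
      exact ⟨h3, Or.inl h5⟩
    · rw [if_pos (by lia)]
      simp only [State.reg_setReg, Nat.reduceEqDiff, if_false, if_true]
      refine ⟨?_, Or.inr (by lia)⟩
      rw [Nat.succ_mul]
      lia

/-- Selects the digits, to base `M`, of the number in register `60`. -/
def select : Cmd :=
  .seq (.rep 51 3 (.store 6 (.reg 51) (.const 0))) <|
  .seq (.assign 53 (.reg 60)) <|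
    .rep 54 1 (.seq divide (.seq (.store 6 (.reg 53) (.const 1)) (.assign 53 (.reg 55))))

theorem select_run {k x : ℕ} (hk : s.reg 1 = k) (hM : s.reg 3 = M) (hpos : 0 < M)
    (hx : s.reg 60 = x) (hxP : x < s.reg 6) :
    ∀ c < M, (select.run s).arr 6 c ≠ 0 ↔ ∃ d < k, x / M ^ d % M = c := by
  rw [select, run_seq, run_seq, run_assign]
  have h1 : ∀ c < M, ((rep 51 3 (.store 6 (.reg 51) (.const 0))).run s).arr 6 c = 0 := by
    rw [← hM]
    refine run_rep (fun j t => ∀ a < j, t.arr 6 a = 0) (by decide) (by simp) ?_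
    intro j t hj hi _ hP a ha
    simp only [run_store, Expr.eval, State.arr_setReg, State.arr_setArr, hi, if_true]
    rw [Function.update_apply]
    split_ifs
    · rfl
    · exact hP a (by lia)
  have h2 := (rep 51 3 (.store 6 (.reg 51) (.const 0))).run_same s
  generalize (rep 51 3 (.store 6 (.reg 51) (.const 0))).run s = s₁ at h1 h2 ⊢
  have h3 : Same [53] [] s₁ (s₁.setReg 53 (Expr.eval s₁ (.reg 60))) :=
    (Same.refl _ _ _).setReg (by simp) _
  have h53 : (s₁.setReg 53 (Expr.eval s₁ (.reg 60))).reg 53 = x := by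
    simp [Expr.eval, h2.reg 60 (by decide), hx]
  generalize s₁.setReg 53 (Expr.eval s₁ (.reg 60)) = t at h3 h53 ⊢
  have key := run_rep (s := t) (i := 54) (x := 1)
    (c := .seq divide (.seq (.store 6 (.reg 53) (.const 1)) (.assign 53 (.reg 55))))
    (fun i u => u.reg 53 = x / M ^ i ∧
      ∀ c < M, u.arr 6 c ≠ 0 ↔ ∃ d < i, x / M ^ d % M = c) (by decide) ?_ ?_
  · rw [h3.reg 1 (by decide), h2.reg 1 (by decide), hk] at key
    exact key.2
  · simp only [State.reg_setReg, Nat.reduceEqDiff, if_false, State.arr_setReg, pow_zero,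
      Nat.div_one, h53, h3.arr 6 (by decide), true_and]
    intro c hc
    simp [h1 c hc]
  · rintro i u hi hui hu ⟨h4, h5⟩
    have e3 : u.reg 3 = M := (hu.reg 3 (by decide)).trans
      ((h3.reg 3 (by decide)).trans ((h2.reg 3 (by decide)).trans hM))
    have e6 : u.reg 6 = s.reg 6 := (hu.reg 6 (by decide)).trans
      ((h3.reg 6 (by decide)).trans (h2.reg 6 (by decide)))
    obtain ⟨h6, h7⟩ := divide_run e3 hpos h4 (by
      rw [e6]
      exact (Nat.div_le_self _ _).trans_lt hxP)
    have hs := divide.run_same u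
    rw [run_seq, run_seq, run_store, run_assign]
    generalize divide.run u = w at h6 h7 hs ⊢
    simp only [Expr.eval, State.reg_setReg, State.reg_setArr, State.arr_setReg, State.arr_setArr,
      Nat.reduceEqDiff, if_false, if_true, h6, h7, hs.arr 6 (by decide)]
    refine ⟨by rw [Nat.div_div_eq_div_mul, pow_succ], fun c hc => ?_⟩
    rw [Function.update_apply]
    split_ifs with h8
    · simp only [ne_eq, one_ne_zero, not_false_eq_true, true_iff]
      exact ⟨i, Nat.lt_succ_self i, h8.symm⟩
    · rw [h5 c hc]
      constructor
      · rintro ⟨d, hd, hdc⟩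
        exact ⟨d, by lia, hdc⟩
      · rintro ⟨d, hd, hdc⟩
        rcases Nat.lt_succ_iff_lt_or_eq.1 hd with hd | rfl
        · exact ⟨d, hd, hdc⟩
        · exact absurd hdc.symm h8

end

section

variable {n : ℕ} {G : SimpleGraph (Fin n)} {W : Set (Fin n)} {k : ℕ} {s : State}

/-- Outputs the set of vertices for which the search among the selected vertices succeeds. -/
def members : Cmd :=
  .seq (.rep 61 0 (.seq (.assign 19 (.reg 61)) <| .seq search <|
    .seq (.cond (.sub (.reg 22) (.const 1)) (.store 0 (.reg 62) (.const 0))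
      (.store 0 (.reg 62) (.reg 22)))
    (.assign 62 (.add (.reg 62) (.const 1)))))
  (.assign 64 (.add (.reg 64) (.const 1)))

theorem members_run (h : Env G W k s) {p : ℕ} (hp : s.reg 62 = p) :
    (members.run s).reg 62 = p + n ∧ (members.run s).reg 64 = s.reg 64 + 1 ∧
      (∀ a < p, (members.run s).arr 0 a = s.arr 0 a) ∧
      ∀ v : Fin n, (members.run s).arr 0 (p + v) ≠ 0 ↔ Captured G W k (selected n s) v := by
  rw [members, run_seq, run_assign]
  have key := run_rep (s := s) (i := 61) (x := 0)
    (c := .seq (.assign 19 (.reg 61)) <| .seq search <|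
    .seq (.cond (.sub (.reg 22) (.const 1)) (.store 0 (.reg 62) (.const 0))
      (.store 0 (.reg 62) (.reg 22)))
    (.assign 62 (.add (.reg 62) (.const 1))))
    (fun j u => u.reg 62 = p + j ∧ (∀ a < p, u.arr 0 a = s.arr 0 a) ∧
      ∀ v : Fin n, (v : ℕ) < j → (u.arr 0 (p + v) ≠ 0 ↔ Captured G W k (selected n s) v))
    (by decide) (by simp [hp]) ?_
  · have hs := (rep 61 0 (.seq (.assign 19 (.reg 61)) <| .seq search <|
      .seq (.cond (.sub (.reg 22) (.const 1)) (.store 0 (.reg 62) (.const 0))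
      (.store 0 (.reg 62) (.reg 22)))
      (.assign 62 (.add (.reg 62) (.const 1))))).run_same s
    rw [h.order] at key
    generalize (rep 61 0 _).run s = u at key hs ⊢
    simp only [Expr.eval, State.reg_setReg, State.arr_setReg, Nat.reduceEqDiff, if_false, if_true,
      hs.reg 64 (by decide)]
    exact ⟨key.1, trivial, key.2.1, fun v => key.2.2 v v.2⟩
  · rintro j u hj huj hu ⟨h1, h2, h3⟩
    rw [h.order] at hj
    have hE : Env G W k u := h.same hu (by decide) (by decide)
    have hsel : selected n u = selected n s := by
      rw [selected, selected, hu.arr 4 (by decide), hu.arr 6 (by decide)]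
    rw [run_seq, run_seq, run_seq, run_assign, run_assign]
    have h4 : Same [19] [] u (u.setReg 19 (Expr.eval u (.reg 61))) :=
      (Same.refl _ _ _).setReg (by simp) _
    have e19 : (u.setReg 19 (Expr.eval u (.reg 61))).reg 19 = (⟨j, hj⟩ : Fin n) := by
      simp [Expr.eval, huj]
    generalize u.setReg 19 (Expr.eval u (.reg 61)) = t at h4 e19 ⊢
    have h5 := search_run (hE.same h4 (by decide) (by decide)) e19
    have hsel' : selected n t = selected n s := by
      rw [← hsel, selected, selected, h4.arr 4 (by decide), h4.arr 6 (by decide)]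
    rw [hsel'] at h5
    have hs := search.run_same t
    generalize search.run t = w at h5 hs ⊢
    have e62 : w.reg 62 = p + j := (hs.reg 62 (by decide)).trans ((h4.reg 62 (by decide)).trans h1)
    have e0 : w.arr 0 = u.arr 0 := (hs.arr 0 (by decide)).trans (h4.arr 0 (by decide))
    -- Status `2` means failure and must be stored as `0`, since any nonzero entry is read as
    -- membership.
    have h6 : (cond (.sub (.reg 22) (.const 1)) (.store 0 (.reg 62) (.const 0))
        (.store 0 (.reg 62) (.reg 22))).run w =
        w.setArr 0 (p + j) (if w.reg 22 = 1 then 1 else 0) := by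
      simp only [run_cond, run_store, Expr.eval, e62]
      by_cases h7 : w.reg 22 = 1
      · simp [h7]
      · rw [if_neg h7]
        split_ifs with h8
        · rfl
        · rw [(by lia : w.reg 22 = 0)]
    rw [h6]
    simp only [Expr.eval, State.reg_setReg, State.reg_setArr, State.arr_setReg, State.arr_setArr,
      Nat.reduceEqDiff, if_false, if_true, e62, e0]
    refine ⟨by lia, fun a ha => ?_, fun v hv => ?_⟩
    · rw [Function.update_of_ne (by lia), h2 a ha]
    · rcases Nat.lt_succ_iff_lt_or_eq.1 hv with hv | hv
      · rw [Function.update_of_ne (by lia), h3 v hv]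
      · rw [hv, Function.update_self]
        have : v = ⟨j, hj⟩ := Fin.ext hv
        rw [this, ← h5]
        by_cases h7 : w.reg 22 = 1 <;> simp [h7]

end

end ShadowRemoval

/-! ### Few collisions, and the existence of a separating colouring. -/

namespace ShadowRemoval

open RAM RAM.Cmd

/-- The number of the first `i` colourings that give `u` and `v` the same colour. -/
def collisions (h : ℕ → ℕ → ℕ) (i u v : ℕ) : ℕ :=
  ((Finset.range i).filter fun j => h j u = h j v).card

theorem collisions_comm (h : ℕ → ℕ → ℕ) (i u v : ℕ) : collisions h i u v = collisions h i v u := by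
  simp only [collisions, eq_comm]

theorem collisions_succ (h : ℕ → ℕ → ℕ) (i u v : ℕ) :
    collisions h (i + 1) u v = collisions h i u v + if h i u = h i v then 1 else 0 := by
  rw [collisions, Finset.range_add_one, Finset.filter_insert]
  split_ifs
  · rw [Finset.card_insert_of_notMem (by simp), collisions]
  · rfl

theorem collisions_congr {h h' : ℕ → ℕ → ℕ} {i : ℕ} (hh : ∀ j < i, h j = h' j) (u v : ℕ) :
    collisions h i u v = collisions h' i u v := by
  rw [collisions, collisions]
  congr 1
  refine Finset.filter_congr fun j hj => ?_
  rw [hh j (Finset.mem_range.1 hj)]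

/-- The total weight of the pairs of vertices after `i` colourings. -/
def potential (n : ℕ) (h : ℕ → ℕ → ℕ) (i : ℕ) : ℕ :=
  ∑ v ∈ Finset.range n, ∑ u ∈ Finset.range v, 2 ^ collisions h i u v

theorem potential_zero_le (n : ℕ) (h : ℕ → ℕ → ℕ) : potential n h 0 ≤ n * n := by
  calc potential n h 0 = ∑ v ∈ Finset.range n, v := by simp [potential, collisions]
    _ ≤ ∑ v ∈ Finset.range n, n := Finset.sum_le_sum fun v hv => (Finset.mem_range.1 hv).le
    _ = n * n := by simp

/-- A new colouring adds the weight of its monochromatic pairs, which the greedy choice keeps below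
a fraction `1 / M` at every vertex. -/
theorem potential_succ_le {n M i : ℕ} {h : ℕ → ℕ → ℕ}
    (hh : ∀ v < n, M * (∑ u ∈ Finset.range v,
      if h i u = h i v then 2 ^ collisions h i u v else 0) ≤
      ∑ u ∈ Finset.range v, 2 ^ collisions h i u v) :
    M * potential n h (i + 1) ≤ (M + 1) * potential n h i := by
  rw [potential, potential, Finset.mul_sum, Finset.mul_sum]
  refine Finset.sum_le_sum fun v hv => ?_
  have h1 := hh v (Finset.mem_range.1 hv)
  have h2 : ∑ u ∈ Finset.range v, 2 ^ collisions h (i + 1) u v =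
      ∑ u ∈ Finset.range v, 2 ^ collisions h i u v +
        ∑ u ∈ Finset.range v, if h i u = h i v then 2 ^ collisions h i u v else 0 := by
    rw [← Finset.sum_add_distrib]
    refine Finset.sum_congr rfl fun u _ => ?_
    rw [collisions_succ]
    split_ifs
    · rw [pow_succ]; ring
    · simp
  rw [h2, mul_add, add_mul, one_mul]
  lia

/-- This is `(1 + 1 / M) ^ M ≤ e ≤ 4`, so a block of `M` colourings multiplies the potential by at
most `4`. -/
theorem succ_pow_self_le (M : ℕ) (hM : 0 < M) : (M + 1) ^ M ≤ 4 * M ^ M := by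
  have hM' : (0 : ℝ) < M := by exact_mod_cast hM
  have h1 : (1 + 1 / (M : ℝ)) ^ M ≤ 4 := by
    calc (1 + 1 / (M : ℝ)) ^ M ≤ Real.exp (1 / M) ^ M := by
          refine pow_le_pow_left₀ (by positivity) ?_ _
          rw [add_comm]
          exact Real.add_one_le_exp _
      _ = Real.exp 1 := by
          rw [← Real.exp_nat_mul]
          congr 1
          field_simp
      _ ≤ 4 := by
          have := Real.exp_one_lt_d9
          linarith
  have h2 : ((M : ℝ) + 1) ^ M ≤ 4 * (M : ℝ) ^ M := by
    have h3 : ((M : ℝ) + 1) = (1 + 1 / (M : ℝ)) * M := by field_simp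
    rw [h3, mul_pow]
    exact mul_le_mul_of_nonneg_right h1 (by positivity)
  exact_mod_cast h2

/-- The weight of one pair is at most the potential, which is below `4 ^ ℓ * 4 ^ (ℓ + 1)`. This
yields fewer than `4 * ℓ + 2` collisions, which is at most `6 * ℓ` as `1 ≤ ℓ`. -/
theorem collisions_le {n M ℓ : ℕ} (hM : 0 < M) (hℓ : n + 2 < 2 ^ (ℓ + 1)) (hℓ1 : 1 ≤ ℓ)
    {h : ℕ → ℕ → ℕ}
    (hpot : M ^ (ℓ * M) * potential n h (ℓ * M) ≤ (M + 1) ^ (ℓ * M) * (n * n)) {u v : ℕ}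
    (hu : u < n) (hv : v < n) (huv : u ≠ v) : collisions h (ℓ * M) u v ≤ 6 * ℓ := by
  wlog huv' : u < v generalizing u v
  · rw [collisions_comm]
    exact this hv hu huv.symm (by lia)
  have h1 : 2 ^ collisions h (ℓ * M) u v ≤ potential n h (ℓ * M) := by
    refine (Finset.single_le_sum (f := fun u => 2 ^ collisions h (ℓ * M) u v)
      (fun _ _ => Nat.zero_le _) (Finset.mem_range.2 huv')).trans ?_
    exact Finset.single_le_sum
      (f := fun v => ∑ u ∈ Finset.range v, 2 ^ collisions h (ℓ * M) u v)
      (fun _ _ => Nat.zero_le _) (Finset.mem_range.2 hv)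
  have h2 : (M + 1) ^ (ℓ * M) ≤ 4 ^ ℓ * M ^ (ℓ * M) := by
    rw [mul_comm ℓ, pow_mul, pow_mul, ← mul_pow]
    exact Nat.pow_le_pow_left (succ_pow_self_le M hM) _
  have h3 : n * n < 4 ^ (ℓ + 1) := by
    calc n * n < 2 ^ (ℓ + 1) * 2 ^ (ℓ + 1) := by
          have : n < 2 ^ (ℓ + 1) := by lia
          exact Nat.mul_lt_mul'' this this
      _ = 4 ^ (ℓ + 1) := by rw [← mul_pow]; norm_num
  have h4 : M ^ (ℓ * M) * 2 ^ collisions h (ℓ * M) u v < M ^ (ℓ * M) * 4 ^ (2 * ℓ + 1) := by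
    calc _ ≤ M ^ (ℓ * M) * potential n h (ℓ * M) := Nat.mul_le_mul_left _ h1
      _ ≤ (4 ^ ℓ * M ^ (ℓ * M)) * (n * n) := hpot.trans (Nat.mul_le_mul_right _ h2)
      _ < (4 ^ ℓ * M ^ (ℓ * M)) * 4 ^ (ℓ + 1) :=
          Nat.mul_lt_mul_of_pos_left h3 (by positivity)
      _ = _ := by ring
  have h5 := lt_of_mul_lt_mul_left h4 (Nat.zero_le _)
  rw [(by norm_num : 4 = 2 ^ 2), ← pow_mul] at h5
  have h6 := (Nat.pow_lt_pow_iff_right (by norm_num : 1 < 2)).1 h5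
  lia

/-- Some colouring separates two given small disjoint sets. -/
theorem exists_separating {n M ℓ k : ℕ} (hM : M = 12 * k ^ 3 + 1) (hℓ : n + 2 < 2 ^ (ℓ + 1))
    (hℓ1 : 1 ≤ ℓ) {h : ℕ → ℕ → ℕ}
    (hpot : M ^ (ℓ * M) * potential n h (ℓ * M) ≤ (M + 1) ^ (ℓ * M) * (n * n))
    {Y H : Finset (Fin n)} (hYH : Disjoint Y H) (hY : Y.card ≤ k) (hH : H.card ≤ k * (k + 1)) :
    ∃ j < ℓ * M, ∀ y ∈ Y, ∀ x ∈ H, h j y ≠ h j x := by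
  by_contra! hc
  -- If every colouring fails, each is spoiled by a pair in `Y ×ˢ H`. There are at most `k ^ 3 + k ^
  -- 2 ≤ 2 * k ^ 3` pairs with at most `6 * ℓ` collisions each, hence at most `12 * k ^ 3 * ℓ < ℓ *
  -- M` spoiled colourings.
  have h1 : Finset.range (ℓ * M) ⊆ (Y ×ˢ H).biUnion fun p =>
      (Finset.range (ℓ * M)).filter fun j => h j p.1 = h j p.2 := by
    intro j hj
    obtain ⟨y, hy, x, hx, hxy⟩ := hc j (Finset.mem_range.1 hj)
    exact Finset.mem_biUnion.2 ⟨(y, x), Finset.mk_mem_product hy hx,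
      Finset.mem_filter.2 ⟨hj, hxy⟩⟩
  have h2 : ℓ * M ≤ Y.card * H.card * (6 * ℓ) := by
    calc ℓ * M = (Finset.range (ℓ * M)).card := (Finset.card_range _).symm
      _ ≤ _ := Finset.card_le_card h1
      _ ≤ ∑ p ∈ Y ×ˢ H, collisions h (ℓ * M) p.1 p.2 := Finset.card_biUnion_le
      _ ≤ ∑ p ∈ Y ×ˢ H, 6 * ℓ := by
          refine Finset.sum_le_sum fun p hp => ?_
          obtain ⟨hp1, hp2⟩ := Finset.mem_product.1 hp
          refine collisions_le (by lia) hℓ hℓ1 hpot p.1.2 p.2.2 fun he => ?_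
          have : p.1 = p.2 := Fin.ext he
          exact Finset.disjoint_left.1 hYH hp1 (this ▸ hp2)
      _ = Y.card * H.card * (6 * ℓ) := by
          rw [Finset.sum_const, Finset.card_product, smul_eq_mul]
  have h3 : Y.card * H.card ≤ 2 * k ^ 3 := by
    calc Y.card * H.card ≤ k * (k * (k + 1)) := Nat.mul_le_mul hY hH
      _ = k ^ 3 + k ^ 2 := by ring
      _ ≤ 2 * k ^ 3 := by
          have : k ^ 2 ≤ k ^ 3 := by
            rcases Nat.eq_zero_or_pos k with rfl | hk
            · simp
            · exact Nat.pow_le_pow_right hk (by norm_num)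
          lia
  have h4 : Y.card * H.card * (6 * ℓ) ≤ 2 * k ^ 3 * (6 * ℓ) := Nat.mul_le_mul_right _ h3
  have h5 : ℓ * M = 2 * k ^ 3 * (6 * ℓ) + ℓ := by rw [hM]; ring
  lia

theorem exists_digits {M : ℕ} (k : ℕ) (f : ℕ → ℕ) (hf : ∀ i < k, f i < M) :
    ∃ x < M ^ k, ∀ i < k, x / M ^ i % M = f i := by
  induction k generalizing f with
  | zero => exact ⟨0, by simp, fun i hi => absurd hi (Nat.not_lt_zero i)⟩
  | succ k ih =>
    obtain ⟨x, hx, hxf⟩ := ih (fun i => f (i + 1)) fun i hi => hf (i + 1) (by lia)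
    have h0 := hf 0 (by lia)
    refine ⟨M * x + f 0, ?_, fun i hi => ?_⟩
    · have : M * (x + 1) ≤ M * M ^ k := Nat.mul_le_mul_left M hx
      rw [pow_succ, mul_comm (M ^ k)]
      lia
    · rcases i with _ | i
      · simp [Nat.mod_eq_of_lt h0]
      · rw [pow_succ, mul_comm (M ^ i), ← Nat.div_div_eq_div_mul, Nat.mul_add_div (by lia),
          Nat.div_eq_of_lt h0, add_zero]
        exact hxf i (by lia)

/-- Every small nonempty set of colours is the set of digits of some number. -/
theorem exists_digits_eq {M k : ℕ} {T : Finset ℕ} (hT : T.Nonempty) (hk : T.card ≤ k)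
    (hM : ∀ c ∈ T, c < M) : ∃ x < M ^ k, ∀ c, (∃ d < k, x / M ^ d % M = c) ↔ c ∈ T := by
  obtain ⟨c₀, hc₀⟩ := hT
  -- If there are fewer than `k` colours, the remaining digits repeat `c₀`.
  have hmem : ∀ i, T.toList.getD i c₀ ∈ T := fun i => by
    rw [List.getD_eq_getElem?_getD]
    rcases lt_or_ge i T.toList.length with hi | hi
    · rw [List.getElem?_eq_getElem hi]
      exact Finset.mem_toList.1 (List.getElem_mem hi)
    · rw [List.getElem?_eq_none hi]
      exact hc₀
  obtain ⟨x, hx, hxf⟩ := exists_digits k (fun i => T.toList.getD i c₀) fun i _ => hM _ (hmem i)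
  refine ⟨x, hx, fun c => ⟨?_, fun hc => ?_⟩⟩
  · rintro ⟨d, hd, rfl⟩
    rw [hxf d hd]
    exact hmem d
  · obtain ⟨i, hi, hic⟩ := List.getElem_of_mem (Finset.mem_toList.2 hc)
    rw [Finset.length_toList] at hi
    refine ⟨i, by lia, ?_⟩
    rw [hxf i (by lia), List.getD_eq_getElem?_getD,
      List.getElem?_eq_getElem (by rwa [Finset.length_toList]), ← hic]
    rfl

/-! ### Enumerating the family. -/

section

variable {n : ℕ} {G : SimpleGraph (Fin n)} {W : Set (Fin n)} {k M : ℕ} {s : State}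

/-- Outputs the sets that belong to one colouring. -/
def batch : Cmd := .seq color (.seq reweigh (.rep 60 6 (.seq select members)))

/-- The vertices whose colour is one of the `k` digits of `x` to base `M`. -/
def digitSet (n M k x : ℕ) (h : ℕ → ℕ) : Set (Fin n) := {y | ∃ d < k, x / M ^ d % M = h y}

theorem batch_run (h : Env G W k s) (hM : s.reg 3 = M) (hpos : 0 < M) {p P : ℕ} (hP : s.reg 6 = P)
    (hp : s.reg 62 = p) :
    ∃ c : ℕ → ℕ, (∀ v < n, c v < M) ∧
      (∀ v < n, M * (∑ u ∈ Finset.range v, if c u = c v then s.arr 3 (u * n + v) else 0) ≤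
        ∑ u ∈ Finset.range v, s.arr 3 (u * n + v)) ∧
      (∀ u < n, ∀ v < n, (batch.run s).arr 3 (u * n + v) =
        if c u = c v then 2 * s.arr 3 (u * n + v) else s.arr 3 (u * n + v)) ∧
      (batch.run s).reg 62 = p + P * n ∧ (batch.run s).reg 64 = s.reg 64 + P ∧
      (∀ a < p, (batch.run s).arr 0 a = s.arr 0 a) ∧
      ∀ x < P, ∀ v : Fin n, (batch.run s).arr 0 (p + x * n + v) ≠ 0 ↔
        Captured G W k (digitSet n M k x c) v := by
  rw [batch, run_seq, run_seq]
  have h1 := color_run h.order hM hpos h.row'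
  have h2 := color.run_same s
  generalize color.run s = t at h1 h2 ⊢
  have hEt : Env G W k t := h.same h2 (by decide) (by decide)
  have h3 := reweigh_run hEt.order hEt.row'
  have h4 := reweigh.run_same t
  generalize reweigh.run t = u at h3 h4 ⊢
  have hEu : Env G W k u := hEt.same h4 (by decide) (by decide)
  have e4 : u.arr 4 = t.arr 4 := h4.arr 4 (by decide)
  have e3 : u.reg 3 = M := (h4.reg 3 (by decide)).trans ((h2.reg 3 (by decide)).trans hM)
  have e6 : u.reg 6 = P := (h4.reg 6 (by decide)).trans ((h2.reg 6 (by decide)).trans hP)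
  have e62 : u.reg 62 = p := (h4.reg 62 (by decide)).trans ((h2.reg 62 (by decide)).trans hp)
  have e64 : u.reg 64 = s.reg 64 := (h4.reg 64 (by decide)).trans (h2.reg 64 (by decide))
  have e0 : u.arr 0 = s.arr 0 := (h4.arr 0 (by decide)).trans (h2.arr 0 (by decide))
  have hs := (rep 60 6 (.seq select members)).run_same u
  have key := run_rep (s := u) (i := 60) (x := 6) (c := .seq select members)
    (fun x w => w.reg 62 = p + x * n ∧ w.reg 64 = s.reg 64 + x ∧
      (∀ a < p, w.arr 0 a = s.arr 0 a) ∧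
      ∀ y < x, ∀ v : Fin n, w.arr 0 (p + y * n + v) ≠ 0 ↔
        Captured G W k (digitSet n M k y (t.arr 4)) v) (by decide)
    (by simp [e62, e64, e0]) ?_
  · rw [e6] at key
    generalize (rep 60 6 (.seq select members)).run u = w at key hs ⊢
    refine ⟨t.arr 4, fun v hv => (h1 v hv).1, fun v hv => (h1 v hv).2, fun a ha b hb => ?_, key⟩
    rw [hs.arr 3 (by decide), h3 a ha b hb, h2.arr 3 (by decide)]
  · rintro x w hx hwx hw ⟨k1, k2, k3, k4⟩
    have hEw : Env G W k w := hEu.same hw (by decide) (by decide)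
    have f3 : w.reg 3 = M := (hw.reg 3 (by decide)).trans e3
    have f4 : w.arr 4 = t.arr 4 := (hw.arr 4 (by decide)).trans e4
    have m1 := select_run hEw.budget f3 hpos hwx (by rwa [hw.reg 6 (by decide)])
    have m2 := select.run_same w
    rw [run_seq]
    generalize select.run w = w₁ at m1 m2 ⊢
    have hE₁ : Env G W k w₁ := hEw.same m2 (by decide) (by decide)
    have g4 : w₁.arr 4 = t.arr 4 := (m2.arr 4 (by decide)).trans f4
    have g0 : w₁.arr 0 = w.arr 0 := m2.arr 0 (by decide)
    have hsel : selected n w₁ = digitSet n M k x (t.arr 4) := by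
      ext y
      rw [selected, Set.mem_ofPred_eq, g4, m1 _ (h1 y y.2).1, digitSet, Set.mem_ofPred_eq]
    obtain ⟨q1, q2, q3, q4⟩ := members_run hE₁ ((m2.reg 62 (by decide)).trans k1)
    rw [m2.reg 64 (by decide), k2] at q2
    rw [hsel] at q4
    simp only [State.reg_setReg, State.arr_setReg, Nat.reduceEqDiff, if_false]
    refine ⟨by rw [q1]; ring, by rw [q2]; ring, fun a ha => ?_, fun y hy v => ?_⟩
    · rw [q3 a (by lia), g0, k3 a ha]
    · rcases Nat.lt_succ_iff_lt_or_eq.1 hy with hy | rfl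
      · rw [q3 _ ?_, g0, k4 y hy v]
        have : (y + 1) * n ≤ x * n := Nat.mul_le_mul_right n hy
        have hv := v.2
        rw [Nat.succ_mul] at this
        lia
      · exact q4 v

/-- Outputs the sets that belong to all colourings. -/
def family : Cmd := .rep 63 5 batch

theorem family_run (h : Env G W k s) (hM : s.reg 3 = M) (hpos : 0 < M) {L P : ℕ} (hL : s.reg 5 = L)
    (hP : s.reg 6 = P) (h62 : s.reg 62 = 0) (h64 : s.reg 64 = 0)
    (hw : ∀ u < n, ∀ v < n, s.arr 3 (u * n + v) = 1) :
    (family.run s).reg 64 = L * P ∧ ∃ c : ℕ → ℕ → ℕ,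
      (∀ j < L, ∀ v < n, c j v < M) ∧
      M ^ L * potential n c L ≤ (M + 1) ^ L * (n * n) ∧
      ∀ j < L, ∀ x < P, ∀ v : Fin n, (family.run s).arr 0 ((j * P + x) * n + v) ≠ 0 ↔
        Captured G W k (digitSet n M k x (c j)) v := by
  have key := run_rep (s := s) (i := 63) (x := 5) (c := batch)
    -- The stored weights are `2` to the number of collisions so far, so the greedy guarantee of a
    -- batch is exactly what the potential needs.
    (fun i u => u.reg 62 = i * P * n ∧ u.reg 64 = i * P ∧ ∃ c : ℕ → ℕ → ℕ,
      (∀ j < i, ∀ v < n, c j v < M) ∧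
      M ^ i * potential n c i ≤ (M + 1) ^ i * (n * n) ∧
      (∀ u₁ < n, ∀ v < n, u.arr 3 (u₁ * n + v) = 2 ^ collisions c i u₁ v) ∧
      ∀ j < i, ∀ x < P, ∀ v : Fin n, u.arr 0 ((j * P + x) * n + v) ≠ 0 ↔
        Captured G W k (digitSet n M k x (c j)) v) (by decide) ?_ ?_
  · rw [hL] at key
    obtain ⟨-, h1, c, h2, h3, -, h4⟩ := key
    exact ⟨h1, c, h2, h3, h4⟩
  · simp only [State.reg_setReg, State.arr_setReg, Nat.reduceEqDiff, if_false, h62, h64, zero_mul,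
      true_and, Nat.not_lt_zero, false_imp_iff, implies_true, and_true, pow_zero, one_mul]
    exact ⟨fun _ _ => 0, potential_zero_le _ _, fun u hu v hv => by
      rw [hw u hu v hv]; simp [collisions]⟩
  · rintro i u hi hui hu ⟨h1, h2, c, h3, h4, h5, h6⟩
    have hE : Env G W k u := h.same hu (by decide) (by decide)
    obtain ⟨b, k1, k2, k3, k4, k5, k6, k7⟩ := batch_run hE ((hu.reg 3 (by decide)).trans hM) hpos
      ((hu.reg 6 (by decide)).trans hP) h1
    simp only [State.reg_setReg, State.arr_setReg, Nat.reduceEqDiff, if_false]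
    generalize batch.run u = w at k3 k4 k5 k6 k7 ⊢
    -- The new colouring enters at index `i`, which the collisions counted so far do not see.
    have hcol : ∀ u v, collisions (Function.update c i b) i u v = collisions c i u v :=
      collisions_congr fun j hj => Function.update_of_ne hj.ne _ _
    have hpot : potential n (Function.update c i b) i = potential n c i := by
      simp only [potential, hcol]
    refine ⟨by rw [k4]; ring, by rw [k5, h2]; ring, Function.update c i b, fun j hj v hv => ?_, ?_,
      fun x hx y hy => ?_, fun j hj x hx v => ?_⟩
    · rcases Nat.lt_succ_iff_lt_or_eq.1 hj with hj | rfl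
      · rw [Function.update_of_ne hj.ne]
        exact h3 j hj v hv
      · rw [Function.update_self]
        exact k1 v hv
    · have hsum : ∀ v < n, ∑ x ∈ Finset.range v, 2 ^ collisions (Function.update c i b) i x v =
          ∑ x ∈ Finset.range v, u.arr 3 (x * n + v) := fun v hv =>
        Finset.sum_congr rfl fun x hx => by
          rw [hcol, h5 x ((Finset.mem_range.1 hx).trans hv) v hv]
      have h7 : M * potential n (Function.update c i b) (i + 1) ≤
          (M + 1) * potential n (Function.update c i b) i := by
        refine potential_succ_le fun v hv => ?_
        rw [hsum v hv, Function.update_self]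
        refine le_trans (le_of_eq ?_) (k2 v hv)
        congr 1
        refine Finset.sum_congr rfl fun x hx => ?_
        rw [hcol, h5 x ((Finset.mem_range.1 hx).trans hv) v hv]
      rw [hpot] at h7
      calc M ^ (i + 1) * potential n (Function.update c i b) (i + 1)
          = M ^ i * (M * potential n (Function.update c i b) (i + 1)) := by ring
        _ ≤ M ^ i * ((M + 1) * potential n c i) := Nat.mul_le_mul_left _ h7
        _ = (M + 1) * (M ^ i * potential n c i) := by ring
        _ ≤ (M + 1) * ((M + 1) ^ i * (n * n)) := Nat.mul_le_mul_left _ h4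
        _ = _ := by ring
    · rw [k3 x hx y hy, collisions_succ, hcol, Function.update_self, h5 x hx y hy]
      split_ifs
      · rw [pow_succ]; ring
      · simp
    · rcases Nat.lt_succ_iff_lt_or_eq.1 hj with hj | rfl
      · rw [Function.update_of_ne hj.ne, k6, h6 j hj x hx v]
        have h8 : (j * P + x + 1) * n ≤ i * P * n := Nat.mul_le_mul_right n (by
          have : (j + 1) * P ≤ i * P := Nat.mul_le_mul_right P hj
          rw [Nat.succ_mul] at this
          lia)
        have hv := v.2
        rw [Nat.succ_mul] at h8
        lia
      · rw [Function.update_self, ← k7 x hx v]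
        rw [add_mul]

end

end ShadowRemoval

/-! ### Running time as a polynomial in the loop bounds. -/

namespace RAM.Cmd

/-- The nesting depth of loops is fixed by the program, and each level contributes one factor. The
degree and constant do not depend on the input. -/
theorem exists_time_le (c : Cmd) :
    ∃ K d, ∀ (g : ℕ → ℕ) (Z : ℕ), (∀ x ∈ c.bounds, g x ≤ Z) → c.time g ≤ K * (Z + 1) ^ d := by
  induction c with
  | assign x e => exact ⟨e.cost + 1, 0, fun g Z _ => by simp [time]⟩
  | store a i e => exact ⟨i.cost + e.cost + 1, 0, fun g Z _ => by simp [time]⟩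
  | seq c d ihc ihd =>
    obtain ⟨K, m, h⟩ := ihc
    obtain ⟨K', m', h'⟩ := ihd
    refine ⟨K + K', m + m', fun g Z hg => ?_⟩
    have h1 := h g Z fun x hx => hg x (by simp [bounds, hx])
    have h2 := h' g Z fun x hx => hg x (by simp [bounds, hx])
    have h3 : (Z + 1) ^ m ≤ (Z + 1) ^ (m + m') := Nat.pow_le_pow_right (by lia) (by lia)
    have h4 : (Z + 1) ^ m' ≤ (Z + 1) ^ (m + m') := Nat.pow_le_pow_right (by lia) (by lia)
    rw [time, add_mul]
    exact add_le_add (h1.trans (Nat.mul_le_mul_left _ h3)) (h2.trans (Nat.mul_le_mul_left _ h4))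
  | cond e c d ihc ihd =>
    obtain ⟨K, m, h⟩ := ihc
    obtain ⟨K', m', h'⟩ := ihd
    refine ⟨e.cost + 1 + (K + K'), m + m', fun g Z hg => ?_⟩
    have h1 := h g Z fun x hx => hg x (by simp [bounds, hx])
    have h2 := h' g Z fun x hx => hg x (by simp [bounds, hx])
    have h3 : (Z + 1) ^ m ≤ (Z + 1) ^ (m + m') := Nat.pow_le_pow_right (by lia) (by lia)
    have h4 : (Z + 1) ^ m' ≤ (Z + 1) ^ (m + m') := Nat.pow_le_pow_right (by lia) (by lia)
    rw [time, add_mul, add_mul K]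
    exact add_le_add (Nat.le_mul_of_pos_right _ (by positivity))
      (add_le_add (h1.trans (Nat.mul_le_mul_left _ h3)) (h2.trans (Nat.mul_le_mul_left _ h4)))
  | rep i x c ih =>
    obtain ⟨K, m, h⟩ := ih
    refine ⟨K + 8 + 6, m + 1, fun g Z hg => ?_⟩
    have h1 := h g Z fun y hy => hg y (by simp [bounds, hy])
    have h2 := hg x (by simp [bounds])
    have h3 : 1 ≤ (Z + 1) ^ m := Nat.one_le_pow _ _ (by lia)
    have h4 : 1 ≤ (Z + 1) ^ (m + 1) := Nat.one_le_pow _ _ (by lia)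
    rw [time]
    calc g x * (c.time g + 8) + 6
        ≤ (Z + 1) * (K * (Z + 1) ^ m + 8 * (Z + 1) ^ m) + 6 * (Z + 1) ^ (m + 1) :=
          add_le_add (Nat.mul_le_mul (by lia) (by lia)) (by lia)
      _ = _ := by ring

end RAM.Cmd

/-! ### Arithmetic without multiplication, and the initial tables. -/

namespace ShadowRemoval

open RAM RAM.Cmd

section Arithmetic

variable {s : State}

/-- Adds the product of registers `x` and `z` to register `y`. -/
def multiply (x y z : ℕ) : Cmd := .rep 70 x (.assign y (.add (.reg y) (.reg z)))

theorem multiply_run {x y z : ℕ} (hy : y ≠ 70) (hz : z ≠ 70) (hzy : z ≠ y) :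
    ((multiply x y z).run s).reg y = s.reg y + s.reg x * s.reg z := by
  refine run_rep (s := s) (i := 70) (x := x) (c := .assign y (.add (.reg y) (.reg z)))
    (fun j t => t.reg y = s.reg y + j * s.reg z) (by simpa [regs] using hy.symm) (by simp [hy]) ?_
  intro j t _ _ ht hP
  have : t.reg z = s.reg z := ht.reg z (by simp [regs, hz, hzy])
  simp only [run_assign, Expr.eval, State.reg_setReg, hy, if_false, if_true, hP, this]
  ring

/-- Writes the multiples of register `x` to array `a`. -/
def table (a x : ℕ) : Cmd :=
  .rep 70 x (.seq (.store a (.reg 70) (.reg 71)) (.assign 71 (.add (.reg 71) (.reg x))))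

theorem table_run {a x : ℕ} (hx : x ≠ 70) (hx' : x ≠ 71) (h : s.reg 71 = 0) :
    ∀ j < s.reg x, ((table a x).run s).arr a j = j * s.reg x := by
  refine (run_rep (s := s) (i := 70) (x := x)
    (c := .seq (.store a (.reg 70) (.reg 71)) (.assign 71 (.add (.reg 71) (.reg x))))
    (fun j t => t.reg 71 = j * s.reg x ∧ ∀ i < j, t.arr a i = i * s.reg x) (by simp [regs])
    (by simp [h]) ?_).2
  rintro j t _ htj ht ⟨h1, h2⟩
  have : t.reg x = s.reg x := ht.reg x (by simp [regs, hx, hx'])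
  simp only [run_seq, run_store, run_assign, Expr.eval, State.reg_setReg, State.reg_setArr,
    State.arr_setReg, State.arr_setArr, if_true, Nat.reduceEqDiff, if_false, htj, h1, this]
  refine ⟨by ring, fun i hi => ?_⟩
  rcases Nat.lt_succ_iff_lt_or_eq.1 hi with hi | rfl
  · rw [Function.update_of_ne hi.ne, h2 i hi]
  · rw [Function.update_self]

/-- Computes in register `4` the binary logarithm of register `7`. -/
def logarithm : Cmd :=
  .seq (.assign 75 (.const 1)) <|
    .rep 70 7 (.cond (.sub (.add (.reg 7) (.const 1)) (.add (.reg 75) (.reg 75)))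
      (.seq (.assign 75 (.add (.reg 75) (.reg 75))) (.assign 4 (.add (.reg 4) (.const 1)))) skip)

theorem logarithm_run {m : ℕ} (hm : s.reg 7 = m) (hpos : m ≠ 0) (h4 : s.reg 4 = 0) :
    (logarithm.run s).reg 4 = Nat.log 2 m := by
  rw [logarithm, run_seq, run_assign]
  have h1 : Same [75] [] s (s.setReg 75 (Expr.eval s (.const 1))) :=
    (Same.refl _ _ _).setReg (by simp) _
  have e75 : (s.setReg 75 (Expr.eval s (.const 1))).reg 75 = 1 := by simp [Expr.eval]
  generalize s.setReg 75 (Expr.eval s (.const 1)) = t at h1 e75 ⊢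
  have e7 : t.reg 7 = m := (h1.reg 7 (by decide)).trans hm
  have key := run_rep (s := t) (i := 70) (x := 7)
    (c := .cond (.sub (.add (.reg 7) (.const 1)) (.add (.reg 75) (.reg 75)))
      (.seq (.assign 75 (.add (.reg 75) (.reg 75))) (.assign 4 (.add (.reg 4) (.const 1)))) skip)
    -- Doubling either has stopped or has happened in every round; `m` doublings would give `2 ^ m ≤
    -- m`.
    (fun i u => u.reg 75 = 2 ^ u.reg 4 ∧ u.reg 75 ≤ m ∧ (m < 2 ^ (u.reg 4 + 1) ∨ u.reg 4 = i))
    (by decide) ?_ ?_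
  · rw [e7] at key
    generalize (rep 70 7 _).run t = u at key ⊢
    obtain ⟨h2, h3, h5⟩ := key
    symm
    rw [Nat.log_eq_iff (Or.inr ⟨by norm_num, hpos⟩)]
    refine ⟨by lia, h5.resolve_right fun h => ?_⟩
    have := Nat.lt_two_pow_self (n := m)
    rw [h2, h] at h3
    lia
  · simp [e75, h1.reg 4 (by decide), h4]
    lia
  · rintro i u _ _ hu ⟨h2, h3, h5⟩
    have f7 : u.reg 7 = m := (hu.reg 7 (by decide)).trans e7
    simp only [run_cond, run_seq, run_assign, skip, Expr.eval, f7]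
    by_cases h6 : u.reg 75 + u.reg 75 ≤ m
    · rw [if_pos (by lia)]
      simp only [State.reg_setReg, Nat.reduceEqDiff, if_false, if_true]
      refine ⟨by rw [pow_succ]; lia, h6, Or.inr ?_⟩
      rcases h5 with h5 | h5
      · rw [pow_succ] at h5
        lia
      · lia
    · rw [if_neg (by lia)]
      simp only [State.reg_setReg, Nat.reduceEqDiff, if_false]
      refine ⟨h2, h3, Or.inl ?_⟩
      rw [pow_succ]
      lia

/-- Computes in register `6` the power of register `3` whose exponent is in register `1`. -/
def power : Cmd :=
  .seq (.assign 6 (.const 1)) <|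
    .rep 71 1 (.seq (.assign 76 (.const 0)) (.seq (multiply 3 76 6) (.assign 6 (.reg 76))))

theorem power_run : (power.run s).reg 6 = s.reg 3 ^ s.reg 1 := by
  rw [power, run_seq, run_assign]
  have h1 : Same [6] [] s (s.setReg 6 (Expr.eval s (.const 1))) :=
    (Same.refl _ _ _).setReg (by simp) _
  have e6 : (s.setReg 6 (Expr.eval s (.const 1))).reg 6 = 1 := by simp [Expr.eval]
  generalize s.setReg 6 (Expr.eval s (.const 1)) = t at h1 e6 ⊢
  rw [← h1.reg 1 (by decide), ← h1.reg 3 (by decide)]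
  refine run_rep (s := t) (i := 71) (x := 1)
    (c := .seq (.assign 76 (.const 0)) (.seq (multiply 3 76 6) (.assign 6 (.reg 76))))
    (fun i u => u.reg 6 = t.reg 3 ^ i) (by decide) (by simp [e6]) ?_
  intro i u _ _ hu hP
  rw [run_seq, run_seq, run_assign, run_assign]
  have h2 := multiply_run (s := u.setReg 76 (Expr.eval u (.const 0))) (x := 3) (y := 76) (z := 6)
    (by decide) (by decide) (by decide)
  simp only [State.reg_setReg, Nat.reduceEqDiff, if_false, if_true, Expr.eval, zero_add, hP,
    hu.reg 3 (by decide)] at h2 ⊢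
  rw [h2, pow_succ, mul_comm]

end Arithmetic

section Setup

variable {n : ℕ} {G : SimpleGraph (Fin n)} {W : Set (Fin n)} {k : ℕ} {s : State}

/-- Copies the adjacency matrix and gives all pairs of vertices weight `1`. -/
def copy : Cmd :=
  .rep 70 0 (.rep 71 0 (.seq
    (.store 2 (.add (.get 8 (.reg 70)) (.reg 71)) (.get 0 (.add (.get 8 (.reg 70)) (.reg 71))))
    (.store 3 (.add (.get 8 (.reg 70)) (.reg 71)) (.const 1))))

theorem copy_run (hn : s.reg 0 = n) (hrow : ∀ a < n, s.arr 8 a = a * n) :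
    ∀ u < n, ∀ v < n, (copy.run s).arr 2 (u * n + v) = s.arr 0 (u * n + v) ∧
      (copy.run s).arr 3 (u * n + v) = 1 := by
  have key := run_rep (s := s) (i := 70) (x := 0) (c := .rep 71 0 (.seq
    (.store 2 (.add (.get 8 (.reg 70)) (.reg 71)) (.get 0 (.add (.get 8 (.reg 70)) (.reg 71))))
    (.store 3 (.add (.get 8 (.reg 70)) (.reg 71)) (.const 1))))
    (fun i t => ∀ u < i, ∀ v < n, t.arr 2 (u * n + v) = s.arr 0 (u * n + v) ∧
      t.arr 3 (u * n + v) = 1) (by decide) (by simp) ?_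
  · rw [hn] at key
    exact key
  · intro i t hi hti ht hP
    rw [hn] at hi
    have e0 : t.reg 0 = n := (ht.reg 0 (by decide)).trans hn
    have key := run_rep (s := t) (i := 71) (x := 0) (c := .seq
      (.store 2 (.add (.get 8 (.reg 70)) (.reg 71)) (.get 0 (.add (.get 8 (.reg 70)) (.reg 71))))
      (.store 3 (.add (.get 8 (.reg 70)) (.reg 71)) (.const 1)))
      (fun j w => ∀ u v, v < n → (u < i ∨ u = i ∧ v < j) →
        w.arr 2 (u * n + v) = s.arr 0 (u * n + v) ∧ w.arr 3 (u * n + v) = 1) (by decide)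
      (by simpa using fun u v hv hu => hP u hu v hv) ?_
    · rw [e0] at key
      intro u hu v hv
      rw [State.arr_setReg]
      exact key u v hv (by lia)
    · intro j w hj hwj hw hQ u v hv huv
      rw [e0] at hj
      have e70 : w.reg 70 = i := (hw.reg 70 (by decide)).trans hti
      have ea0 : w.arr 0 = s.arr 0 := (hw.arr 0 (by decide)).trans (ht.arr 0 (by decide))
      have e8 : w.arr 8 = s.arr 8 := (hw.arr 8 (by decide)).trans (ht.arr 8 (by decide))
      simp only [run_seq, run_store, Expr.eval, hwj, e70, ea0, e8, hrow i hi, State.arr_setReg,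
        State.arr_setArr, State.reg_setArr, if_true, Nat.reduceEqDiff, if_false,
        Function.update_apply, mul_add_inj hj hv]
      by_cases h : u = i ∧ v = j
      · obtain ⟨rfl, rfl⟩ := h
        simp
      · rw [if_neg h, if_neg h]
        exact hQ u v hv (by lia)

/-- Computes the numbers that bound the first loops. -/
def setupSizes : Cmd :=
  .seq (.assign 2 (.add (.add (.reg 0) (.reg 0)) (.const 1))) <|
  .seq (.assign 8 (.add (.add (.reg 1) (.reg 1)) (.const 2)))
    (.assign 7 (.add (.reg 0) (.const 2)))

/-- Prepares the arrays, the number of colours, and the logarithm. -/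
def setupTables : Cmd :=
  .seq (table 7 2) <|
  .seq (.assign 71 (.const 0)) <|
  .seq (table 8 0) <|
  .seq copy <|
  .seq (multiply 1 72 1) <|
  .seq (multiply 1 73 72) <|
  .seq (.assign 74 (.add (.reg 73) (.add (.reg 73) (.reg 73)))) <|
  .seq (.assign 74 (.add (.reg 74) (.reg 74))) <|
  .seq (.assign 3 (.add (.add (.reg 74) (.reg 74)) (.const 1)))
    logarithm

/-- Computes the numbers of colourings and of selections of colours. -/
def setupCounts : Cmd := .seq (multiply 4 5 3) power

/-- The number of colours. -/
def colors (k : ℕ) : ℕ := 12 * k ^ 3 + 1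

theorem setupSizes_run :
    (setupSizes.run (input G W k)).reg = fun x =>
      if x = 7 then n + 2 else if x = 8 then 2 * k + 2 else if x = 2 then 2 * n + 1 else
        (input G W k).reg x := by
  funext x
  simp only [setupSizes, run_seq, run_assign, Expr.eval, State.reg_setReg, Nat.reduceEqDiff,
    if_false]
  have h0 : (input G W k).reg 0 = n := rfl
  have h1 : (input G W k).reg 1 = k := rfl
  simp only [h0, h1, two_mul]

theorem input_adj (x y : Fin n) : (input G W k).arr 0 (x * n + y) ≠ 0 ↔ G.Adj x y := by
  have : (input G W k).arr 0 (x * n + y) ≠ 0 ↔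
      ∃ u v : Fin n, G.Adj u v ∧ (x : ℕ) * n + y = u * n + v := by
    simp [input]
  rw [this]
  constructor
  · rintro ⟨u, v, h, he⟩
    obtain ⟨h1, h2⟩ := (mul_add_inj v.2 y.2).1 he
    rwa [Fin.ext h1, Fin.ext h2]
  · exact fun h => ⟨x, y, h, rfl⟩

theorem input_terminals (x : Fin n) : (input G W k).arr 1 x ≠ 0 ↔ x ∈ W := by
  have : (input G W k).arr 1 x ≠ 0 ↔ ∃ w ∈ W, (x : ℕ) = w := by
    simp [input]
  rw [this]
  constructor
  · rintro ⟨w, hw, he⟩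
    rwa [Fin.ext he]
  · exact fun h => ⟨x, h, rfl⟩

theorem setupTables_run (hs : s = setupSizes.run (input G W k)) :
    Env G W k (setupTables.run s) ∧ (setupTables.run s).reg 3 = colors k ∧
      (setupTables.run s).reg 4 = Nat.log 2 (n + 2) ∧
      (∀ u < n, ∀ v < n, (setupTables.run s).arr 3 (u * n + v) = 1) ∧
      ∀ x ∈ [5, 62, 64], (setupTables.run s).reg x = 0 := by
  have hreg := setupSizes_run (G := G) (W := W) (k := k)
  have hsz := setupSizes.run_same (input G W k)
  rw [← hs] at hreg hsz
  have r : ∀ x, s.reg x = if x = 7 then n + 2 else if x = 8 then 2 * k + 2 else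
    if x = 2 then 2 * n + 1 else (input G W k).reg x := fun x => by rw [hreg]
  have r0 : s.reg 0 = n := r 0
  have r1 : s.reg 1 = k := r 1
  have r2 : s.reg 2 = 2 * n + 1 := r 2
  have r7 : s.reg 7 = n + 2 := r 7
  have r8 : s.reg 8 = 2 * k + 2 := r 8
  have r72 : s.reg 72 = 0 := r 72
  have r73 : s.reg 73 = 0 := r 73
  have hfin := setupTables.run_same s
  have t1 := table_run (s := s) (a := 7) (x := 2) (by decide) (by decide) (r 71)
  rw [r2] at t1
  have q1 := (table 7 2).run_same s
  have hrun : setupTables.run s = (Cmd.seq (.assign 71 (.const 0)) <|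
    .seq (table 8 0) <| .seq copy <| .seq (multiply 1 72 1) <| .seq (multiply 1 73 72) <|
    .seq (.assign 74 (.add (.reg 73) (.add (.reg 73) (.reg 73)))) <|
    .seq (.assign 74 (.add (.reg 74) (.reg 74))) <|
    .seq (.assign 3 (.add (.add (.reg 74) (.reg 74)) (.const 1))) logarithm).run
      ((table 7 2).run s) := rfl
  generalize (table 7 2).run s = s₁ at t1 q1 hrun
  rw [run_seq, run_assign] at hrun
  have q2 : Same [71] [] s₁ (s₁.setReg 71 (Expr.eval s₁ (.const 0))) :=
    (Same.refl _ _ _).setReg (by simp) _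
  have h71 : (s₁.setReg 71 (Expr.eval s₁ (.const 0))).reg 71 = 0 := by simp [Expr.eval]
  generalize s₁.setReg 71 (Expr.eval s₁ (.const 0)) = s₂ at q2 h71 hrun
  rw [run_seq] at hrun
  have t2 := table_run (a := 8) (x := 0) (by decide) (by decide) h71
  rw [q2.reg 0 (by decide), q1.reg 0 (by decide), r0] at t2
  have q3 := (table 8 0).run_same s₂
  generalize (table 8 0).run s₂ = s₃ at t2 q3 hrun
  rw [run_seq] at hrun
  have e0 : s₃.reg 0 = n := (q3.reg 0 (by decide)).trans
    ((q2.reg 0 (by decide)).trans ((q1.reg 0 (by decide)).trans r0))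
  have t3 := copy_run e0 t2
  have q4 := copy.run_same s₃
  generalize copy.run s₃ = s₄ at t3 q4 hrun
  have q14 : Same [70, 71] [7, 8, 2, 3] s s₄ :=
    (q1.mono (by decide) (by decide)).trans <| (q2.mono (by decide) (by decide)).trans <|
      (q3.mono (by decide) (by decide)).trans (q4.mono (by decide) (by decide))
  rw [run_seq] at hrun
  have t4 := multiply_run (s := s₄) (x := 1) (y := 72) (z := 1) (by decide) (by decide) (by decide)
  have q5 := (multiply 1 72 1).run_same s₄
  generalize (multiply 1 72 1).run s₄ = s₅ at t4 q5 hrun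
  rw [q14.reg 72 (by decide), q14.reg 1 (by decide), r1, r72] at t4
  have q15 : Same [70, 71, 72] [7, 8, 2, 3] s s₅ :=
    (q14.mono (by decide) (by decide)).trans (q5.mono (by decide) (by decide))
  rw [run_seq] at hrun
  have t5 := multiply_run (s := s₅) (x := 1) (y := 73) (z := 72) (by decide) (by decide) (by decide)
  have q6 := (multiply 1 73 72).run_same s₅
  generalize (multiply 1 73 72).run s₅ = s₆ at t5 q6 hrun
  rw [q15.reg 73 (by decide), q15.reg 1 (by decide), r1, r73, t4, zero_add, zero_add] at t5
  have q16 : Same [70, 71, 72, 73] [7, 8, 2, 3] s s₆ :=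
    (q15.mono (by decide) (by decide)).trans (q6.mono (by decide) (by decide))
  rw [run_seq, run_seq, run_seq, run_assign, run_assign, run_assign] at hrun
  generalize h7 : ((s₆.setReg 74 _).setReg 74 _).setReg 3 _ = s₇ at hrun
  have t6 : s₇.reg 3 = colors k := by
    rw [← h7]
    simp only [Expr.eval, State.reg_setReg, Nat.reduceEqDiff, if_false, if_true, t5, colors]
    ring
  have q7 : Same [70, 71, 72, 73, 74, 3] [7, 8, 2, 3] s s₇ := by
    rw [← h7]
    exact (((q16.mono (by decide) (by decide)).setReg (by decide) _).setReg (by decide) _).setReg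
      (by decide) _
  have arrs : s₇.arr = s₄.arr := by
    rw [← h7]
    simp only [State.arr_setReg]
    funext a
    rw [q6.arr a (by simp [multiply, Cmd.arrs]), q5.arr a (by simp [multiply, Cmd.arrs])]
  have t7 := logarithm_run ((q7.reg 7 (by decide)).trans r7) (by lia)
    ((q7.reg 4 (by decide)).trans (r 4))
  have q8 := logarithm.run_same s₇
  rw [hrun] at hfin ⊢
  have arrs' : (logarithm.run s₇).arr = s₄.arr := by
    rw [← arrs]
    funext a
    exact q8.arr a (by simp [logarithm, skip, Cmd.arrs])
  have hrest : ∀ x ∈ [5, 62, 64], (logarithm.run s₇).reg x = 0 := by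
    intro x hx
    simp only [List.mem_cons, List.not_mem_nil, or_false] at hx
    rcases hx with rfl | rfl | rfl
    · exact (hfin.reg 5 (by decide)).trans (r 5)
    · exact (hfin.reg 62 (by decide)).trans (r 62)
    · exact (hfin.reg 64 (by decide)).trans (r 64)
  refine ⟨⟨?_, ?_, ?_, ?_, ?_, ?_, ?_, ?_⟩, (q8.reg 3 (by decide)).trans t6, t7, ?_, hrest⟩
  · exact (hfin.reg 0 (by decide)).trans r0
  · exact (hfin.reg 1 (by decide)).trans r1
  · exact (hfin.reg 2 (by decide)).trans r2
  · exact (hfin.reg 8 (by decide)).trans r8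
  · rw [arrs', q4.arr 7 (by decide), q3.arr 7 (by decide), q2.arr 7 (by decide)]
    exact t1
  · rw [arrs', q4.arr 8 (by decide)]
    exact t2
  · intro x
    rw [arrs', q14.arr 1 (by decide), hsz.arr 1 (by decide)]
    exact input_terminals x
  · intro x y
    rw [arrs', (t3 x x.2 y y.2).1, q3.arr 0 (by decide), q2.arr 0 (by decide), q1.arr 0 (by decide),
      hsz.arr 0 (by decide)]
    exact input_adj x y
  · intro u hu v hv
    rw [arrs']
    exact (t3 u hu v hv).2

theorem setupCounts_run {ℓ M : ℕ} (h : Env G W k s) (h3 : s.reg 3 = M) (h4 : s.reg 4 = ℓ)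
    (h5 : s.reg 5 = 0) :
    Env G W k (setupCounts.run s) ∧ (setupCounts.run s).reg 3 = M ∧
      (setupCounts.run s).reg 5 = ℓ * M ∧ (setupCounts.run s).reg 6 = M ^ k := by
  have hs := setupCounts.run_same s
  refine ⟨h.same hs (by decide) (by decide), (hs.reg 3 (by decide)).trans h3, ?_, ?_⟩
  · rw [setupCounts, run_seq, (power.run_same _).reg 5 (by decide),
      multiply_run (by decide) (by decide) (by decide), h3, h4, h5, zero_add]
  · rw [setupCounts, run_seq, power_run, ((multiply 4 5 3).run_same s).reg 3 (by decide),
      ((multiply 4 5 3).run_same s).reg 1 (by decide), h3, h.budget]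

end Setup

end ShadowRemoval

/-! ### The whole algorithm and its bounds. -/

namespace ShadowRemoval

open RAM RAM.Cmd

/-- The whole algorithm. -/
def algorithm : Prog :=
  .seq setupSizes.toProg <| .seq setupTables.toProg <| .seq setupCounts.toProg <|
    .seq family.toProg (.assign 0 (.reg 64))

/-- For `k ≥ 2` there are at most `16 * k ^ 3 ≤ k ^ 7` colours. The case `k = 1` needs `13 ^ 2 =
169`, and `k = 0` uses `0 ^ 0 = 1`. -/
theorem colors_pow_le (k : ℕ) : colors k ^ (k + 1) ≤ 169 * k ^ (14 * k) := by
  rcases Nat.lt_or_ge k 2 with hk | hk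
  · interval_cases k <;> simp [colors]
  · have h1 : colors k ≤ k ^ 7 := by
      have h3 : 2 ^ 3 ≤ k ^ 3 := Nat.pow_le_pow_left hk 3
      have h4 : 2 ^ 4 ≤ k ^ 4 := Nat.pow_le_pow_left hk 4
      calc colors k ≤ 2 ^ 4 * k ^ 3 := by rw [colors]; lia
        _ ≤ k ^ 4 * k ^ 3 := Nat.mul_le_mul_right _ h4
        _ = k ^ 7 := by ring
    calc colors k ^ (k + 1) ≤ (k ^ 7) ^ (k + 1) := Nat.pow_le_pow_left h1 _
      _ = k ^ (7 * (k + 1)) := by rw [pow_mul]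
      _ ≤ k ^ (14 * k) := Nat.pow_le_pow_right (by lia) (by lia)
      _ ≤ _ := Nat.le_mul_of_pos_left _ (by norm_num)

theorem colors_pos (k : ℕ) : 0 < colors k := Nat.succ_pos _

theorem log_le (n : ℕ) : Nat.log 2 (n + 2) ≤ n + 2 := Nat.log_le_self _ _

section

variable {n : ℕ} {G : SimpleGraph (Fin n)} {W : Set (Fin n)} {k : ℕ} {s : State}

/-- A bound for all loops. -/
def loopBound (n k : ℕ) : ℕ := (2 * n + 4) * colors k ^ (k + 1)

theorem le_loopBound (n k : ℕ) : n ≤ loopBound n k ∧ k ≤ loopBound n k ∧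
    2 * n + 1 ≤ loopBound n k ∧ n + 2 ≤ loopBound n k ∧ 2 * k + 2 ≤ loopBound n k ∧
    colors k ≤ loopBound n k ∧ Nat.log 2 (n + 2) ≤ loopBound n k ∧
    Nat.log 2 (n + 2) * colors k ≤ loopBound n k ∧ colors k ^ k ≤ loopBound n k := by
  have h1 : colors k ≤ colors k ^ (k + 1) := Nat.le_self_pow (by lia) _
  have h2 : colors k ^ k ≤ colors k ^ (k + 1) := Nat.pow_le_pow_right (colors_pos k) (by lia)
  have h3 : k + 1 ≤ colors k := by
    have : k ≤ k ^ 3 := Nat.le_self_pow (by lia) _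
    rw [colors]
    lia
  have h4 := log_le n
  have h5 : (2 * n + 4) * 1 ≤ loopBound n k :=
    Nat.mul_le_mul_left _ (Nat.one_le_pow _ _ (colors_pos k))
  have h6 : 2 * colors k ^ (k + 1) ≤ loopBound n k := Nat.mul_le_mul_right _ (by lia)
  have h7 : Nat.log 2 (n + 2) * colors k ≤ loopBound n k := Nat.mul_le_mul (by lia) h1
  refine ⟨?_, ?_, ?_, ?_, ?_, ?_, ?_, ?_, ?_⟩ <;> lia

/-- The setup is split into stages because `runs_toProg` requires that a stage does not write its
own loop bounds; each stage computes bounds for later ones. -/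
theorem exists_algorithm_time : ∃ K d, ∀ (n : ℕ) (G : SimpleGraph (Fin n)) (W : Set (Fin n))
    (k : ℕ), ∃ t s, Runs algorithm (input G W k) t s ∧ t ≤ K * (loopBound n k + 1) ^ d ∧
      s.reg 0 = Nat.log 2 (n + 2) * colors k * colors k ^ k ∧ ∃ c : ℕ → ℕ → ℕ,
      (∀ j < Nat.log 2 (n + 2) * colors k, ∀ v < n, c j v < colors k) ∧
      colors k ^ (Nat.log 2 (n + 2) * colors k) *
        potential n c (Nat.log 2 (n + 2) * colors k) ≤
        (colors k + 1) ^ (Nat.log 2 (n + 2) * colors k) * (n * n) ∧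
      ∀ j < Nat.log 2 (n + 2) * colors k, ∀ x < colors k ^ k, ∀ v : Fin n,
        s.arr 0 ((j * colors k ^ k + x) * n + v) ≠ 0 ↔
        Captured G W k (digitSet n (colors k) k x (c j)) v := by
  obtain ⟨K₁, d₁, T₁⟩ := exists_time_le setupSizes
  obtain ⟨K₂, d₂, T₂⟩ := exists_time_le setupTables
  obtain ⟨K₃, d₃, T₃⟩ := exists_time_le setupCounts
  obtain ⟨K₄, d₄, T₄⟩ := exists_time_le family
  refine ⟨K₁ + K₂ + K₃ + K₄ + 2, d₁ + d₂ + d₃ + d₄, fun n G W k => ?_⟩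
  obtain ⟨b1, b2, b3, b4, b5, b6, b7, b8, b9⟩ := le_loopBound n k
  obtain ⟨t₁, ht₁, hr₁⟩ := runs_toProg setupSizes (by decide) (by decide) (input G W k)
  have hreg := setupSizes_run (G := G) (W := W) (k := k)
  obtain ⟨hE₂, e3, e4, ew, e0⟩ := setupTables_run (G := G) (W := W) (k := k) rfl
  generalize setupSizes.run (input G W k) = s₁ at *
  obtain ⟨t₂, ht₂, hr₂⟩ := runs_toProg setupTables (by decide) (by decide) s₁
  generalize setupTables.run s₁ = s₂ at *
  obtain ⟨t₃, ht₃, hr₃⟩ := runs_toProg setupCounts (by decide) (by decide) s₂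
  obtain ⟨hE₃, f3, f5, f6⟩ := setupCounts_run hE₂ e3 e4 (e0 5 (by simp))
  have hs₃ := setupCounts.run_same s₂
  have f62 := (hs₃.reg 62 (by decide)).trans (e0 62 (by simp))
  have f64 := (hs₃.reg 64 (by decide)).trans (e0 64 (by simp))
  have fw : ∀ u < n, ∀ v < n, (setupCounts.run s₂).arr 3 (u * n + v) = 1 := by
    rw [hs₃.arr 3 (by decide)]
    exact ew
  clear hs₃
  generalize setupCounts.run s₂ = s₃ at *
  obtain ⟨t₄, ht₄, hr₄⟩ := runs_toProg family (by decide) (by decide) s₃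
  obtain ⟨g1, c, g2, g3, g4⟩ := family_run hE₃ f3 (colors_pos k) f5 f6 f62 f64 fw
  generalize family.run s₃ = s₄ at *
  refine ⟨_, _, .seq hr₁ (.seq hr₂ (.seq hr₃ (.seq hr₄ (.assign s₄ 0 (.reg 64))))), ?_, ?_, c, g2,
    g3, ?_⟩
  · have u₁ := ht₁.trans (T₁ _ (loopBound n k) (by
      intro x hx
      exact absurd hx (by simp [setupSizes, Cmd.bounds])))
    have u₂ := ht₂.trans (T₂ _ (loopBound n k) (by
      have hb : ∀ x ∈ setupTables.bounds, x = 0 ∨ x = 1 ∨ x = 2 ∨ x = 7 := by decide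
      intro x hx
      rw [hreg]
      rcases hb x hx with rfl | rfl | rfl | rfl
      exacts [b1, b2, b3, b4]))
    have u₃ := ht₃.trans (T₃ _ (loopBound n k) (by
      have hb : ∀ x ∈ setupCounts.bounds, x = 1 ∨ x = 3 ∨ x = 4 := by decide
      intro x hx
      rcases hb x hx with rfl | rfl | rfl
      exacts [hE₂.budget.trans_le b2, e3.trans_le b6, e4.trans_le b7]))
    have u₄ := ht₄.trans (T₄ _ (loopBound n k) (by
      have hb : ∀ x ∈ family.bounds, x = 0 ∨ x = 1 ∨ x = 2 ∨ x = 3 ∨ x = 5 ∨ x = 6 ∨ x = 8 := by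
        decide
      intro x hx
      rcases hb x hx with rfl | rfl | rfl | rfl | rfl | rfl | rfl
      exacts [hE₃.order.trans_le b1, hE₃.budget.trans_le b2, hE₃.nodes.trans_le b3,
        f3.trans_le b6, f5.trans_le b8, f6.trans_le b9, hE₃.rounds.trans_le b5]))
    have hp : ∀ K d, d ≤ d₁ + d₂ + d₃ + d₄ → K * (loopBound n k + 1) ^ d ≤
        K * (loopBound n k + 1) ^ (d₁ + d₂ + d₃ + d₄) := fun K d hd =>
      Nat.mul_le_mul_left _ (Nat.pow_le_pow_right (by lia) hd)
    have p₁ := hp K₁ d₁ (by lia)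
    have p₂ := hp K₂ d₂ (by lia)
    have p₃ := hp K₃ d₃ (by lia)
    have p₄ := hp K₄ d₄ (by lia)
    have p₅ := hp 2 0 (by lia)
    rw [pow_zero, mul_one] at p₅
    simp only [add_mul, Expr.cost]
    lia
  · simp [Expr.eval, g1]
  · exact g4

/-- The sets obtained from a separating colouring satisfy the claim. -/
theorem exists_captured (hn : 1 ≤ Nat.log 2 (n + 2)) {c : ℕ → ℕ → ℕ}
    (hc : ∀ j < Nat.log 2 (n + 2) * colors k, ∀ v < n, c j v < colors k)
    (hpot : colors k ^ (Nat.log 2 (n + 2) * colors k) *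
        potential n c (Nat.log 2 (n + 2) * colors k) ≤
        (colors k + 1) ^ (Nat.log 2 (n + 2) * colors k) * (n * n))
    {Y : Set (Fin n)} (hY : IsShadowRemovable G W k Y) :
    ∃ j < Nat.log 2 (n + 2) * colors k, ∃ x < colors k ^ k,
      (∀ v ∈ Y, ¬ Captured G W k (digitSet n (colors k) k x (c j)) v) ∧
      ∀ v ∈ shadow G W Y, Captured G W k (digitSet n (colors k) k x (c j)) v := by
  classical
  have hhit : ∀ v, ∃ H : Finset (Fin n), v ∈ Y → H.card ≤ k + 1 ∧ Disjoint (H : Set (Fin n)) Y ∧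
      ∀ X, IsImportantSeparator G {v} W X → X.ncard ≤ k → ∃ x ∈ H, x ∈ X := by
    intro v
    by_cases hv : v ∈ Y
    · obtain ⟨H, hH⟩ := exists_hitting_set (hY.not_subset v hv)
      exact ⟨H, fun _ => hH⟩
    · exact ⟨∅, fun h => absurd h hv⟩
  choose H hH using hhit
  have hcard : Y.toFinset.card ≤ k := by
    rw [← Set.ncard_eq_toFinset_card']
    exact hY.card_le
  have hdisj : Disjoint Y.toFinset (Y.toFinset.biUnion H) := by
    rw [Finset.disjoint_biUnion_right]
    intro v hv
    rw [Finset.disjoint_right]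
    intro x hx hxY
    exact Set.disjoint_left.1 (hH v (Set.mem_toFinset.1 hv)).2.1 hx (Set.mem_toFinset.1 hxY)
  have hHcard : (Y.toFinset.biUnion H).card ≤ k * (k + 1) :=
    (Finset.card_biUnion_le_card_mul _ _ _ fun v hv => (hH v (Set.mem_toFinset.1 hv)).1).trans
      (Nat.mul_le_mul_right _ hcard)
  obtain ⟨j, hj, hsep⟩ := exists_separating (k := k) rfl (Nat.lt_pow_succ_log_self (by norm_num) _)
    hn hpot hdisj hcard hHcard
  obtain ⟨x, hx, hx1, hx2⟩ : ∃ x < colors k ^ k,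
      (∀ y ∈ Y, y ∈ digitSet n (colors k) k x (c j)) ∧
      ∀ z ∈ Y.toFinset.biUnion H, z ∉ digitSet n (colors k) k x (c j) := by
    -- A number always selects some colour if `k > 0`. For empty `Y` this is harmless: there is
    -- nothing to avoid, and any selection contains `Y`.
    rcases Y.eq_empty_or_nonempty with hY0 | hY0
    · exact ⟨0, Nat.pow_pos (colors_pos k), by simp [hY0], by simp [hY0]⟩
    · obtain ⟨x, hx, hxT⟩ := exists_digits_eq (M := colors k) (k := k)
        (T := Y.toFinset.image fun y : Fin n => c j y) ((Set.toFinset_nonempty.2 hY0).image _)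
        (Finset.card_image_le.trans hcard) (by
          intro a ha
          obtain ⟨y, -, rfl⟩ := Finset.mem_image.1 ha
          exact hc j hj y y.2)
      refine ⟨x, hx, fun y hy => (hxT _).2 (Finset.mem_image.2 ⟨y, Set.mem_toFinset.2 hy, rfl⟩),
        fun z hz hzd => ?_⟩
      obtain ⟨y, hy, hyz⟩ := Finset.mem_image.1 ((hxT _).1 hzd)
      exact hsep y hy z hz hyz
  refine ⟨j, hj, x, hx, ?_, fun v hv => ?_⟩
  · rintro v hv ⟨X, hX, hXk, hXA⟩
    obtain ⟨z, hz, hzX⟩ := (hH v hv).2.2 X hX hXk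
    exact hx2 z (Finset.mem_biUnion.2 ⟨v, Set.mem_toFinset.2 hv, hz⟩) (hXA hzX)
  · obtain ⟨X, hX, hXk, hXY⟩ := hY.exists_important v hv
    exact ⟨X, hX, hXk, fun y hy => hx1 y (hXY hy)⟩

end

end ShadowRemoval

theorem mainTheorem2 :
    ∃ (P : RAM.Prog) (C c d : ℕ),
      ∀ (n : ℕ) (G : SimpleGraph (Fin n)) (W : Set (Fin n)) (k : ℕ),
        ∃ (t : ℕ) (s : RAM.State),
          RAM.Runs P (ShadowRemoval.input G W k) t s ∧
          t ≤ C * k ^ (c * k) * (n + 1) ^ d ∧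
          (ShadowRemoval.output n s).length ≤ C * k ^ (c * k) * Nat.log 2 (n + 2) ∧
          (∀ Z ∈ ShadowRemoval.output n s, Disjoint Z W) ∧
          ∀ Y : Set (Fin n), ShadowRemoval.IsShadowRemovable G W k Y →
            ∃ Z ∈ ShadowRemoval.output n s,
              Disjoint Y Z ∧ ShadowRemoval.shadow G W Y ⊆ Z := by
  obtain ⟨K, d, hK⟩ := ShadowRemoval.exists_algorithm_time
  -- The summand `169` covers the size of the family and `K * 845 ^ d` the time, where `845 = 5 *
  -- 169`. The exponent `14 * (d + 1)` exceeds both `14` and `14 * d`, so one pair of constants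
  -- serves both bounds.
  refine ⟨ShadowRemoval.algorithm, 169 + K * 845 ^ d, 14 * (d + 1), d, fun n G W k => ?_⟩
  obtain ⟨t, s, hr, ht, h0, c, hc, hpot, hout⟩ := hK n G W k
  have hone : 1 ≤ k ^ (14 * k) := by
    rcases Nat.eq_zero_or_pos k with rfl | hk
    · simp
    · exact Nat.one_le_pow _ _ hk
  have hM := ShadowRemoval.colors_pow_le k
  have hexp : k ^ (14 * (d + 1) * k) = (k ^ (14 * k)) ^ (d + 1) := by
    rw [← pow_mul]
    congr 1
    ring
  refine ⟨t, s, hr, ?_, ?_, ?_, ?_⟩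
  · have h1 : ShadowRemoval.loopBound n k + 1 ≤ 845 * k ^ (14 * k) * (n + 1) := by
      have h2 : ShadowRemoval.loopBound n k ≤ (2 * n + 4) * (169 * k ^ (14 * k)) :=
        Nat.mul_le_mul_left _ hM
      nlinarith [Nat.zero_le (n * k ^ (14 * k))]
    calc t ≤ K * (845 * k ^ (14 * k) * (n + 1)) ^ d :=
          ht.trans (Nat.mul_le_mul_left _ (Nat.pow_le_pow_left h1 _))
      _ = K * 845 ^ d * (k ^ (14 * k)) ^ d * (n + 1) ^ d := by rw [mul_pow, mul_pow]; ring
      _ ≤ (169 + K * 845 ^ d) * k ^ (14 * (d + 1) * k) * (n + 1) ^ d := by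
          rw [hexp]
          exact Nat.mul_le_mul_right _ (Nat.mul_le_mul (Nat.le_add_left _ _)
            (Nat.pow_le_pow_right hone (by lia)))
  · rw [ShadowRemoval.output, List.length_map, List.length_range, h0, mul_assoc, ← pow_succ', mul_comm]
    refine Nat.mul_le_mul_right _ (hM.trans (Nat.mul_le_mul (Nat.le_add_right _ _) ?_))
    rw [hexp]
    exact Nat.le_self_pow (by lia) _
  · intro Z hZ
    obtain ⟨q, hq, rfl⟩ := List.mem_map.1 hZ
    rw [List.mem_range, h0] at hq
    have hP : 0 < ShadowRemoval.colors k ^ k := Nat.pow_pos (ShadowRemoval.colors_pos k)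
    refine Set.disjoint_left.2 fun v hv hvW => ?_
    -- Quotient and remainder of the index of an output set are its colouring and its selection of
    -- colours.
    have h1 := hout (q / ShadowRemoval.colors k ^ k) (Nat.div_lt_of_lt_mul (by rwa [mul_comm]))
      (q % ShadowRemoval.colors k ^ k) (Nat.mod_lt _ hP) v
    rw [mul_comm (q / _), Nat.div_add_mod] at h1
    obtain ⟨X, hX, -⟩ := h1.1 hv
    exact hX.notMem_right hvW
  · intro Y hY
    obtain ⟨j, hj, x, hx, h1, h2⟩ := ShadowRemoval.exists_captured
      (Nat.log_pos (by norm_num) (by lia)) hc hpot hY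
    refine ⟨_, List.mem_map.2 ⟨j * ShadowRemoval.colors k ^ k + x, ?_, rfl⟩, ?_, ?_⟩
    · rw [List.mem_range, h0]
      have : (j + 1) * ShadowRemoval.colors k ^ k ≤
        Nat.log 2 (n + 2) * ShadowRemoval.colors k * ShadowRemoval.colors k ^ k :=
        Nat.mul_le_mul_right _ hj
      rw [Nat.succ_mul] at this
      lia
    · exact Set.disjoint_left.2 fun v hv hvZ => h1 v hv ((hout j hj x hx v).1 hvZ)
    · exact fun v hv => (hout j hj x hx v).2 (h2 v hv)
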